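/- A long-legged ${\sf H}$ is a plane figure consisting of two distinct points (its tips), two infinite rays (legs) starting at each tip, and the line segment (bar) joining the tips, where the two legs and the bar leave each tip in three different directions; the angles are otherwise arbitrary. Its five arms are the four legs and the bar. A self-crossing of ${\sf H}$ is a point other than a tip that lies on two different arms. A 5-chain is a broken line with nodes $c_1,c_2,c_3,c_4$ consisting of an infinite ray from $c_1$, the segments $c_1c_2$, $c_2c_3$, $c_3c_4$, and an infinite ray from $c_4$, where the two arms at each node leave it in different directions; a self-crossing is a point other than a node that lies on two different arms. The number of regions formed by a set of figures is the number of connected components of the complement of their union in the plane. "Raising the bar" of an ${\sf H}$ means: choose one leg at each tip $p$, $q$, cut these two legs off at points $a\ne p$ and $b\ne q$ respectively, and replace the bar $pq$ by the segment $ab$; the result, if non-degenerate, is a 5-chain with nodes $p,a,b,q$ whose infinite arms are the two remaining legs. Inversely, "lowering the bar" of a 5-chain prolongs the arms $c_1c_2$ (beyond $c_2$) and $c_4c_3$ (beyond $c_3$) to infinite rays and replaces the arm $c_2c_3$ by the segment $c_1c_4$. When the points $a$, $b$ are recorded as marks on the two chosen legs, these operations are inverse to each other. 1. The maximum number of self-crossings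 of a long-legged ${\sf H}$ is $\sigma({\sf H})=4$, and the maximum number of points in the intersection of two long-legged ${\sf H}$'s that have only finitely many points in common is $\kappa({\sf H})=25$. 2. Every long-legged ${\sf H}$ with 4 self-crossings can be transformed, by raising its bar suitably, into a 5-chain with 6 self-crossings; and lowering the bar of any 5-chain with 6 self-crossings gives a long-legged ${\sf H}$ with 4 self-crossings. 3. For every $n\ge 0$, the maximum number of regions into which the plane can be divided by $n$ long-legged ${\sf H}$'s is $(25n^2-11n+2)/2$, and this is also the maximum number of regions for $n$ 5-chains. Moreover, there is an arrangement of $n$ long-legged ${\sf H}$'s attaining this maximum that is transformed into an arrangement of $n$ 5-chains attaining the maximum by raising the bar of each ${\sf H}$. -/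

import Mathlib

/-- The plane. Only its affine structure and its topology are used. -/
abbrev Plane : Type := ℝ × ℝ

/-- The ray (half-line) with endpoint `p` in the direction `v`; the endpoint belongs to it. -/
def ray (p v : Plane) : Set Plane := {x | ∃ t : ℝ, 0 ≤ t ∧ x = p + t • v}

/-- The number of regions into which a plane set `U` cuts the plane: the number of connected
components of its complement. -/
noncomputable def regionCount (U : Set Plane) : ℕ∞ :=
  ENat.card (ConnectedComponents ↥(Uᶜ))

/-- A long-legged H, given by its two tips and, at each tip, the direction vectors of two infinite
legs. The two legs at a tip form a V, and the tips are joined by a bar. The lengths of the leg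
vectors do not affect the H as a plane figure. -/
structure LongLeggedH where
  tip : Fin 2 → Plane
  leg : Fin 2 → Fin 2 → Plane

namespace LongLeggedH

/-- The five arms: the legs `some (i, j)` and the bar `none`. -/
def arm (S : LongLeggedH) : Option (Fin 2 × Fin 2) → Set Plane
  | some (i, j) => ray (S.tip i) (S.leg i j)
  | none => segment ℝ (S.tip 0) (S.tip 1)

/-- The H as a plane figure: the union of its arms. -/
def carrier (S : LongLeggedH) : Set Plane := ⋃ a, S.arm a

/-- Non-degeneracy: the two legs and the bar leave each tip in three different directions.
(`SameRay` also holds when one of the vectors is zero, so this includes that the leg vectors are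
nonzero and that the tips are distinct.) There is no other restriction on the angles; in
particular the two legs at a tip may be opposite. -/
def Proper (S : LongLeggedH) : Prop :=
  (∀ i, ¬ SameRay ℝ (S.leg i 0) (S.leg i 1)) ∧
  (∀ j, ¬ SameRay ℝ (S.leg 0 j) (S.tip 1 - S.tip 0)) ∧
  (∀ j, ¬ SameRay ℝ (S.leg 1 j) (S.tip 0 - S.tip 1))

/-- The self-crossings: the points, other than the tips, that lie on two different arms. -/
def selfCrossings (S : LongLeggedH) : Set Plane :=
  {x | x ∉ Set.range S.tip ∧ ∃ a b, a ≠ b ∧ x ∈ S.arm a ∧ x ∈ S.arm b}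

end LongLeggedH

/-- A 5-chain: a broken line with four nodes, whose first and last arms are infinite (in the
directions `out 0`, `out 1`) and whose three middle arms are finite. -/
structure FiveChain where
  node : Fin 4 → Plane
  out : Fin 2 → Plane

namespace FiveChain

/-- The five arms, in the order in which they are traversed. -/
def arm (C : FiveChain) : Fin 5 → Set Plane :=
  ![ray (C.node 0) (C.out 0),
    segment ℝ (C.node 0) (C.node 1),
    segment ℝ (C.node 1) (C.node 2),
    segment ℝ (C.node 2) (C.node 3),
    ray (C.node 3) (C.out 1)]

/-- The 5-chain as a plane figure. -/
def carrier (C : FiveChain) : Set Plane := ⋃ a, C.arm a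

/-- Non-degeneracy: the two arms at each node leave it in different directions (in particular
all the arms have nonzero length). -/
def Proper (C : FiveChain) : Prop :=
  ¬ SameRay ℝ (C.out 0) (C.node 1 - C.node 0) ∧
  ¬ SameRay ℝ (C.node 0 - C.node 1) (C.node 2 - C.node 1) ∧
  ¬ SameRay ℝ (C.node 1 - C.node 2) (C.node 3 - C.node 2) ∧
  ¬ SameRay ℝ (C.node 2 - C.node 3) (C.out 1)

/-- The self-crossings: the points, other than the nodes, that lie on two different arms. -/
def selfCrossings (C : FiveChain) : Set Plane :=
  {x | x ∉ Set.range C.node ∧ ∃ a b, a ≠ b ∧ x ∈ C.arm a ∧ x ∈ C.arm b}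

end FiveChain

/-- "Raising the bar": the leg `leg i 0` at each tip is cut off at the point `tip i + leg i 0`,
and the bar joining the tips is replaced by the segment joining these two points. The result is
the 5-chain with nodes `tip 0`, `tip 0 + leg 0 0`, `tip 1 + leg 1 0`, `tip 1`, whose infinite arms
are the remaining legs. The inverse ("lowering the bar") prolongs the second and fourth arms of a
5-chain to infinity and replaces the middle arm by the segment joining the first and last nodes. -/
def raiseBar : LongLeggedH ≃ FiveChain where
  toFun S :=
    { node := ![S.tip 0, S.tip 0 + S.leg 0 0, S.tip 1 + S.leg 1 0, S.tip 1]
      out := ![S.leg 0 1, S.leg 1 1] }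
  invFun C :=
    { tip := ![C.node 0, C.node 3]
      leg := ![![C.node 1 - C.node 0, C.out 0], ![C.node 2 - C.node 3, C.out 1]] }
  left_inv S := by
    obtain ⟨tip, leg⟩ := S
    simp only [LongLeggedH.mk.injEq]
    constructor
    · funext i
      fin_cases i <;> simp
    · funext i j
      fin_cases i <;> fin_cases j <;> simp
  right_inv C := by
    obtain ⟨node, out⟩ := C
    simp only [FiveChain.mk.injEq]
    constructor
    · funext i
      fin_cases i <;> simp
    · funext i
      fin_cases i <;> simp

/-- The numbers of regions obtainable by drawing `n` long-legged H's. -/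
def hRegionCounts (n : ℕ) : Set ℕ∞ :=
  {r | ∃ S : Fin n → LongLeggedH, (∀ i, (S i).Proper) ∧ r = regionCount (⋃ i, (S i).carrier)}

/-- The numbers of regions obtainable by drawing `n` 5-chains. -/
def chainRegionCounts (n : ℕ) : Set ℕ∞ :=
  {r | ∃ C : Fin n → FiveChain, (∀ i, (C i).Proper) ∧ r = regionCount (⋃ i, (C i).carrier)}

/-! ### Regions gained by adding an interval of a line -/

section Topology
open Set Topology

/-! Regions, upper bound. Let an interval of a line be added to a closed set that it does not meet,
so that the union is again closed. The points close to the interval on one side all lie in one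
region, so at most one region is split, into two; if the interval contains one of its ends, one can
walk around that end and nothing is split (`regionCount_union_interval_le`,
`regionCount_union_interval_le_of_dangling`). A ray or segment is cut into such intervals by the
closed set already drawn, and if it meets that set in at most `k` convex pieces, then a ray gains at
most `k` regions and a segment at most `k - 1` (when `k` is positive and the two meet). Drawing the
five arms one after the other onto a union of `N` convex arms gains at most `5 * N + 7` regions,
both for an H and for a 5-chain. With `N = 5 * i` for the next figure after `i` figures, the sum is
`maxRegions n = 1 + 7 * n + 25 * n.choose 2`.

Regions, lower bound. Sample points in different regions are exhibited, each pair being told apart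
by an open set whose frontier lies in the figures (`card_le_regionCount`). Near the vertical axis
the model H, and the 5-chain obtained by raising its bar, look like five lines that do not cross.
Flattened copies are placed along the tangents `y = i * x - i ^ 2` of a parabola, so that any two
copies cross in 25 points, all within the strips where they look like lines. The resulting
arrangement of `5 * n` lines gives `1 + 5 * n + 25 * n.choose 2` cells, and far from the crossings
each copy keeps two further regions (`StripModel.maxRegions_le_regionCount`).

Crossings. Two convex arms that meet in finitely many points meet in at most one, which gives 25 for
two H's. Within an H only a leg at one tip and a leg at the other can cross, which gives 4. For four
crossings all legs lie on one side of the bar; cutting off the two inner legs beyond all their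
crossings makes the new bar cross both outer legs, and with the four old crossings this makes 6
(`exists_raised_of_ordered`). Conversely, a 5-chain has six pairs of arms without a common node; if
all six cross, four of the crossings are those of the lowered H, and they also force it to be
non-degenerate (`FiveChain.Proper.lowerBar`). -/

theorem mk_eq_mk_iff_mem_connectedComponentIn {X : Type*} [TopologicalSpace X] {W : Set X}
    {x y : X} (hx : x ∈ W) (hy : y ∈ W) :
    (ConnectedComponents.mk (⟨x, hx⟩ : W) = ConnectedComponents.mk ⟨y, hy⟩) ↔
      y ∈ connectedComponentIn W x := by
  rw [ConnectedComponents.coe_eq_coe, connectedComponentIn_eq_image hx]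
  constructor
  · intro h
    exact ⟨⟨y, hy⟩, h ▸ mem_connectedComponent, rfl⟩
  · rintro ⟨z, hz, rfl⟩
    exact connectedComponent_eq hz

theorem isClosed_connectedComponentIn_inter {X : Type*} [TopologicalSpace X] {W : Set X}
    {x z : X} (hx : x ∈ W) (hz : z ∈ W) (h : z ∈ closure (connectedComponentIn W x)) :
    z ∈ connectedComponentIn W x := by
  have h1 : IsPreconnected (insert z (connectedComponentIn W x)) :=
    isPreconnected_connectedComponentIn.subset_closure (subset_insert _ _)
      (insert_subset h subset_closure)
  exact h1.subset_connectedComponentIn (mem_insert_of_mem _ (mem_connectedComponentIn hx))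
    (insert_subset hz (connectedComponentIn_subset _ _)) (mem_insert _ _)

/-- A component of the complement of `K'` that does not accumulate at `K' \ K` is a component of
the complement of `K`. -/
theorem connectedComponentIn_compl_subset {K K' : Set Plane} (hK' : IsClosed K')
    {x : Plane} (hx : x ∉ K') (hKx : x ∉ K)
    (h : ∀ z ∈ K', z ∉ K → z ∉ closure (connectedComponentIn K'ᶜ x)) :
    connectedComponentIn Kᶜ x ⊆ connectedComponentIn K'ᶜ x := by
  refine IsPreconnected.subset_left_of_subset_union (hK'.isOpen_compl.connectedComponentIn)
    (isClosed_closure (s := connectedComponentIn K'ᶜ x)).isOpen_compl ?_ ?_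
    ⟨x, mem_connectedComponentIn hKx, mem_connectedComponentIn hx⟩
    isPreconnected_connectedComponentIn
  · exact disjoint_compl_right.mono_left subset_closure |>.mono_right le_rfl
  · intro z hz
    by_cases hc : z ∈ closure (connectedComponentIn K'ᶜ x)
    · left
      by_cases hz' : z ∈ K'
      · exact absurd hc (h z hz' (connectedComponentIn_subset _ _ hz))
      · exact isClosed_connectedComponentIn_inter hx hz' hc
    · exact Or.inr hc

def componentMap {K K' : Set Plane} (h : K ⊆ K') :
    ConnectedComponents ↥(K'ᶜ) → ConnectedComponents ↥(Kᶜ) :=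
  (continuous_inclusion (compl_subset_compl.2 h)).connectedComponentsMap

theorem regionCount_le_of_forall {K K' : Set Plane} (h : K ⊆ K')
    (H : ∀ x ∈ K'ᶜ, ∀ y ∈ K'ᶜ, y ∈ connectedComponentIn Kᶜ x → y ∈ connectedComponentIn K'ᶜ x) :
    regionCount K' ≤ regionCount K := by
  refine ENat.card_le_card_of_injective (f := componentMap h) ?_
  intro a b
  obtain ⟨⟨x, hx⟩, rfl⟩ := ConnectedComponents.surjective_coe a
  obtain ⟨⟨y, hy⟩, rfl⟩ := ConnectedComponents.surjective_coe b
  intro hab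
  rw [mk_eq_mk_iff_mem_connectedComponentIn]
  exact H x hx y hy ((mk_eq_mk_iff_mem_connectedComponentIn (W := Kᶜ) (fun hh => hx (h hh))
    (fun hh => hy (h hh))).1 hab)

/-- Sending the region of `l` to an extra point `none`, and every other region to the region of `Kᶜ`
that contains it, is injective. -/
theorem regionCount_le_add_one_of_forall {K K' : Set Plane} (h : K ⊆ K') (l : Plane)
    (hl : l ∉ K')
    (H : ∀ x ∈ K'ᶜ, ∀ y ∈ K'ᶜ, y ∈ connectedComponentIn Kᶜ x →
      l ∈ connectedComponentIn K'ᶜ x ∨ l ∈ connectedComponentIn K'ᶜ y ∨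
      y ∈ connectedComponentIn K'ᶜ x) :
    regionCount K' ≤ regionCount K + 1 := by
  classical
  let f : ConnectedComponents ↥(K'ᶜ) → Option (ConnectedComponents ↥(Kᶜ)) := fun c =>
    if c = ConnectedComponents.mk ⟨l, hl⟩ then none else some (componentMap h c)
  have hf : Function.Injective f := by
    intro a b
    obtain ⟨⟨x, hx⟩, rfl⟩ := ConnectedComponents.surjective_coe a
    obtain ⟨⟨y, hy⟩, rfl⟩ := ConnectedComponents.surjective_coe b
    intro hab
    simp only [f] at hab
    split_ifs at hab with h1 h2 h2
    · rw [h1, h2]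
    · have h3 := (mk_eq_mk_iff_mem_connectedComponentIn (W := Kᶜ) (fun hh => hx (h hh))
        (fun hh => hy (h hh))).1 (Option.some_injective _ hab)
      rcases H x hx y hy h3 with h4 | h4 | h4
      · exact absurd ((mk_eq_mk_iff_mem_connectedComponentIn _ _).2 h4) h1
      · exact absurd ((mk_eq_mk_iff_mem_connectedComponentIn _ _).2 h4) h2
      · exact (mk_eq_mk_iff_mem_connectedComponentIn _ _).2 h4
  refine (ENat.card_le_card_of_injective hf).trans ?_
  rw [ENat.card_congr (Equiv.optionEquivSumPUnit.{0} _), ENat.card_sum]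
  simp [regionCount]

/-- Half of the ball of radius `δ` around the point `t` of the horizontal axis. -/
def halfBall (σ t δ : ℝ) : Set Plane := Metric.ball (t, 0) δ ∩ {z | 0 < σ * z.2}

theorem convex_halfBall (σ t δ : ℝ) : Convex ℝ (halfBall σ t δ) := by
  refine (convex_ball _ _).inter ?_
  have : IsLinearMap ℝ (fun z : Plane => σ * z.2) :=
    ⟨fun x y => by simp [mul_add], fun c x => by simp; ring⟩
  exact convex_halfSpace_gt this 0

theorem mem_ball_axis {t δ : ℝ} {z : Plane} :
    z ∈ Metric.ball ((t, 0) : Plane) δ ↔ |z.1 - t| < δ ∧ |z.2| < δ := by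
  simp [Metric.mem_ball, Prod.dist_eq, Real.dist_eq]

theorem exists_halfBall_radius {K : Set Plane} (hK : IsClosed K) {J : Set ℝ}
    (hd : ∀ t ∈ J, ((t, 0) : Plane) ∉ K) :
    ∃ δ : ℝ → ℝ, ∀ t ∈ J, 0 < δ t ∧ Metric.ball ((t, 0) : Plane) (δ t) ⊆ Kᶜ := by
  have : ∀ t, ∃ d : ℝ, t ∈ J → 0 < d ∧ Metric.ball ((t, 0) : Plane) d ⊆ Kᶜ := by
    intro t
    by_cases ht : t ∈ J
    · obtain ⟨d, hd0, hd1⟩ := Metric.isOpen_iff.1 hK.isOpen_compl _ (hd t ht)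
      exact ⟨d, fun _ => ⟨hd0, hd1⟩⟩
    · exact ⟨0, fun h => absurd h ht⟩
  choose δ hδ using this
  exact ⟨δ, fun t ht => hδ t ht⟩

theorem halfBall_subset_compl {K : Set Plane} {J : Set ℝ} {σ t δ : ℝ}
    (h : Metric.ball ((t, 0) : Plane) δ ⊆ Kᶜ) :
    halfBall σ t δ ⊆ (K ∪ (fun s : ℝ => ((s, 0) : Plane)) '' J)ᶜ := by
  rintro z ⟨hz1, hz2⟩ (hz | ⟨s, -, rfl⟩)
  · exact h hz1 hz
  · simp at hz2

/-- All the points close to the interval `J` of the axis and on one side of it are in the same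
component. -/
theorem exists_side_component {K : Set Plane} (hK : IsClosed K) {J : Set ℝ}
    (hJ : IsPreconnected J) (hd : ∀ t ∈ J, ((t, 0) : Plane) ∉ K) (hne : J.Nonempty)
    {σ : ℝ} (hσ : σ ^ 2 = 1) :
    ∃ l ∉ K ∪ (fun s : ℝ => ((s, 0) : Plane)) '' J, ∀ t ∈ J, ∃ δ > 0, halfBall σ t δ ⊆
      connectedComponentIn (K ∪ (fun s : ℝ => ((s, 0) : Plane)) '' J)ᶜ l := by
  set W := (K ∪ (fun s : ℝ => ((s, 0) : Plane)) '' J)ᶜ with hW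
  obtain ⟨δ, hδ⟩ := exists_halfBall_radius hK hd
  have hσ1 : |σ| = 1 := by
    have := sq_abs σ
    rw [hσ] at this
    exact (pow_eq_one_iff_of_nonneg (abs_nonneg _) two_ne_zero).1 this
  have hmem : ∀ t s e d : ℝ, |s - t| < d → 0 < e → e < d → ((s, σ * e) : Plane) ∈ halfBall σ t d := by
    intro t s e d h1 h2 h3
    refine ⟨mem_ball_axis.2 ⟨h1, ?_⟩, ?_⟩
    · simp only [abs_mul, hσ1, one_mul, abs_of_pos h2]; exact h3
    · simp only [mem_ofPred_eq, ← mul_assoc, ← pow_two, hσ]; linarith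
  have hsub : ∀ t ∈ J, ∀ z ∈ halfBall σ t (δ t), halfBall σ t (δ t) ⊆ connectedComponentIn W z :=
    fun t ht z hz => (convex_halfBall σ t (δ t)).isPreconnected.subset_connectedComponentIn hz
      (halfBall_subset_compl (hδ t ht).2)
  have hc : ∀ t ∈ J, ((t, σ * (δ t / 2)) : Plane) ∈ halfBall σ t (δ t) := fun t ht =>
    hmem _ _ _ _ (by simpa using (hδ t ht).1) (half_pos (hδ t ht).1) (half_lt_self (hδ t ht).1)
  obtain ⟨t₀, ht₀⟩ := hne
  refine ⟨(t₀, σ * (δ t₀ / 2)), halfBall_subset_compl (hδ t₀ ht₀).2 (hc t₀ ht₀), ?_⟩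
  intro t ht
  refine ⟨δ t, (hδ t ht).1, ?_⟩
  -- The component seen from `t` is locally constant in `t`: just beside `b` and low enough, a point
  -- lies in the half balls around both `a` and `b`. Since `J` is preconnected, it is constant.
  have key : connectedComponentIn W (t₀, σ * (δ t₀ / 2)) = connectedComponentIn W (t, σ * (δ t / 2)) := by
    refine hJ.induction₂ (fun a b => connectedComponentIn W (a, σ * (δ a / 2)) =
      connectedComponentIn W (b, σ * (δ b / 2))) ?_ (fun _ _ _ _ _ _ => Eq.trans)
      (fun _ _ _ _ => Eq.symm) ht₀ ht
    intro a ha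
    have h1 : ∀ᶠ b in 𝓝[J] a, |b - a| < δ a :=
      nhdsWithin_le_nhds (Metric.ball_mem_nhds a (hδ a ha).1)
    filter_upwards [h1, self_mem_nhdsWithin] with b hb hbJ
    have h2 := lt_min (hδ a ha).1 (hδ b hbJ).1
    have hm1 := hmem a b (min (δ a) (δ b) / 2) (δ a) hb (half_pos h2)
      ((half_lt_self h2).trans_le (min_le_left _ _))
    have hm2 := hmem b b (min (δ a) (δ b) / 2) (δ b) (by simpa using (hδ b hbJ).1) (half_pos h2)
      ((half_lt_self h2).trans_le (min_le_right _ _))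
    exact (connectedComponentIn_eq (hsub a ha _ (hc a ha) hm1)).trans
      (connectedComponentIn_eq (hsub b hbJ _ (hc b hbJ) hm2)).symm
  rw [key]
  exact hsub t ht _ (hc t ht)

/-- Close to a point of `J`, everything off the axis belongs to the region of `l` or to that of `r`.
A region different from both could accumulate there only along the axis, which is impossible for a
nonempty open set. Hence it survives unchanged from the complement of `K`. -/
theorem connectedComponentIn_compl_subset_of_sides {K : Set Plane} {J : Set ℝ}
    (hK' : IsClosed (K ∪ (fun s : ℝ => ((s, 0) : Plane)) '' J))
    {l r : Plane}
    (hl : ∀ t ∈ J, ∃ δ > 0, halfBall 1 t δ ⊆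
      connectedComponentIn (K ∪ (fun s : ℝ => ((s, 0) : Plane)) '' J)ᶜ l)
    (hr : ∀ t ∈ J, ∃ δ > 0, halfBall (-1) t δ ⊆
      connectedComponentIn (K ∪ (fun s : ℝ => ((s, 0) : Plane)) '' J)ᶜ r)
    {x : Plane} (hx : x ∉ K ∪ (fun s : ℝ => ((s, 0) : Plane)) '' J)
    (hxl : l ∉ connectedComponentIn (K ∪ (fun s : ℝ => ((s, 0) : Plane)) '' J)ᶜ x)
    (hxr : r ∉ connectedComponentIn (K ∪ (fun s : ℝ => ((s, 0) : Plane)) '' J)ᶜ x) :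
    connectedComponentIn Kᶜ x ⊆
      connectedComponentIn (K ∪ (fun s : ℝ => ((s, 0) : Plane)) '' J)ᶜ x := by
  set W := (K ∪ (fun s : ℝ => ((s, 0) : Plane)) '' J)ᶜ with hW
  refine connectedComponentIn_compl_subset hK' hx (fun h => hx (Or.inl h)) ?_
  rintro _ (h | ⟨t, ht, rfl⟩) hzK hcl
  · exact hzK h
  obtain ⟨d1, hd1, h1⟩ := hl t ht
  obtain ⟨d2, hd2, h2⟩ := hr t ht
  have hdisj : ∀ p : Plane, p ∉ connectedComponentIn W x → ∀ z ∈ connectedComponentIn W p,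
      z ∉ connectedComponentIn W x := by
    intro p hp z hz hzx
    have e1 := connectedComponentIn_eq hz
    have e2 := connectedComponentIn_eq hzx
    have hpW : p ∈ W := by
      by_contra hpW
      rw [connectedComponentIn_eq_empty hpW] at hz
      exact hz
    rw [e2, ← e1] at hp
    exact hp (mem_connectedComponentIn hpW)
  have hd : 0 < min d1 d2 := lt_min hd1 hd2
  rw [_root_.mem_closure_iff] at hcl
  obtain ⟨z, hz1, hz2⟩ := hcl _ Metric.isOpen_ball (Metric.mem_ball_self hd)
  have hopen : IsOpen (Metric.ball ((t, 0) : Plane) (min d1 d2) ∩ connectedComponentIn W x) :=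
    Metric.isOpen_ball.inter hK'.isOpen_compl.connectedComponentIn
  have hoff : ∀ z ∈ Metric.ball ((t, 0) : Plane) (min d1 d2) ∩ connectedComponentIn W x,
      z.2 = 0 := by
    rintro z ⟨hz1, hz2⟩
    rcases lt_trichotomy z.2 0 with h | h | h
    · refine absurd hz2 (hdisj r hxr z (h2 ⟨Metric.ball_subset_ball (min_le_right _ _) hz1, ?_⟩))
      simpa using h
    · exact h
    · refine absurd hz2 (hdisj l hxl z (h1 ⟨Metric.ball_subset_ball (min_le_left _ _) hz1, ?_⟩))
      simpa using h
  have hev : ∀ᶠ e : ℝ in 𝓝 0, ((z.1, z.2 + e) : Plane) ∈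
      Metric.ball ((t, 0) : Plane) (min d1 d2) ∩ connectedComponentIn W x := by
    have hcont : Continuous fun e : ℝ => ((z.1, z.2 + e) : Plane) := by fun_prop
    refine hcont.continuousAt.eventually_mem (hopen.mem_nhds ?_)
    rw [add_zero]
    exact ⟨hz1, hz2⟩
  obtain ⟨ε, hε, hball⟩ := Metric.eventually_nhds_iff.1 hev
  have h3 := hoff _ (hball (y := ε / 2) (by simp [abs_of_pos hε, hε]))
  have h4 := hoff z ⟨hz1, hz2⟩
  simp only at h3
  linarith

/-- Let `x` and `y` be connected off `K`, with neither in the region of `l`. Either both are in the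
region of `r`, or one of them is in a region touching neither side of `J`; that region is a whole
component of `Kᶜ` and so contains the other point. -/
theorem regionCount_union_axis_le {K : Set Plane} (hK : IsClosed K) {J : Set ℝ}
    (hJ : IsPreconnected J) (hd : ∀ t ∈ J, ((t, 0) : Plane) ∉ K)
    (hK' : IsClosed (K ∪ (fun s : ℝ => ((s, 0) : Plane)) '' J)) :
    regionCount (K ∪ (fun s : ℝ => ((s, 0) : Plane)) '' J) ≤ regionCount K + 1 := by
  rcases J.eq_empty_or_nonempty with rfl | hne
  · simp
  obtain ⟨l, hlW, hl⟩ := exists_side_component hK hJ hd hne (σ := 1) (by norm_num)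
  obtain ⟨r, hrW, hr⟩ := exists_side_component hK hJ hd hne (σ := -1) (by norm_num)
  refine regionCount_le_add_one_of_forall subset_union_left l hlW ?_
  intro x hx y hy hxy
  by_cases h1 : l ∈ connectedComponentIn (K ∪ (fun s : ℝ => ((s, 0) : Plane)) '' J)ᶜ x
  · exact Or.inl h1
  by_cases h2 : l ∈ connectedComponentIn (K ∪ (fun s : ℝ => ((s, 0) : Plane)) '' J)ᶜ y
  · exact Or.inr (Or.inl h2)
  right; right
  by_cases h3 : r ∈ connectedComponentIn (K ∪ (fun s : ℝ => ((s, 0) : Plane)) '' J)ᶜ x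
  · by_cases h4 : r ∈ connectedComponentIn (K ∪ (fun s : ℝ => ((s, 0) : Plane)) '' J)ᶜ y
    · rw [connectedComponentIn_eq h3, ← connectedComponentIn_eq h4]
      exact mem_connectedComponentIn hy
    · have h5 := connectedComponentIn_compl_subset_of_sides hK' hl hr hy h2 h4
      have h6 : x ∈ connectedComponentIn Kᶜ y := by
        rw [← connectedComponentIn_eq hxy]
        exact mem_connectedComponentIn fun h => hx (Or.inl h)
      rw [← connectedComponentIn_eq (h5 h6)]
      exact mem_connectedComponentIn hy
  · exact connectedComponentIn_compl_subset_of_sides hK' hl hr hx h1 h3 hxy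

/-- Adding a dangling interval does not increase the number of regions. -/
theorem regionCount_union_axis_le_of_dangling {K : Set Plane} (hK : IsClosed K) {J : Set ℝ}
    (hJ : IsPreconnected J) (hd : ∀ t ∈ J, ((t, 0) : Plane) ∉ K)
    (hK' : IsClosed (K ∪ (fun s : ℝ => ((s, 0) : Plane)) '' J))
    (hb : (∃ b, IsGreatest J b) ∨ ∃ b, IsLeast J b) :
    regionCount (K ∪ (fun s : ℝ => ((s, 0) : Plane)) '' J) ≤ regionCount K := by
  obtain ⟨b, τ, hbJ, hτ, hτJ⟩ : ∃ b τ : ℝ, b ∈ J ∧ τ ^ 2 = 1 ∧ ∀ t ∈ J, τ * (t - b) ≤ 0 := by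
    rcases hb with ⟨b, h1, h2⟩ | ⟨b, h1, h2⟩
    · exact ⟨b, 1, h1, by norm_num, fun t ht => by linarith [h2 ht]⟩
    · exact ⟨b, -1, h1, by norm_num, fun t ht => by linarith [h2 ht]⟩
  have hne : J.Nonempty := ⟨b, hbJ⟩
  obtain ⟨l, hlW, hl⟩ := exists_side_component hK hJ hd hne (σ := 1) (by norm_num)
  obtain ⟨r, hrW, hr⟩ := exists_side_component hK hJ hd hne (σ := -1) (by norm_num)
  set W := (K ∪ (fun s : ℝ => ((s, 0) : Plane)) '' J)ᶜ with hW
  have hlr : connectedComponentIn W l = connectedComponentIn W r := by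
    obtain ⟨d0, hd0, h0⟩ := Metric.isOpen_iff.1 hK.isOpen_compl _ (hd b hbJ)
    obtain ⟨d1, hd1, h1⟩ := hl b hbJ
    obtain ⟨d2, hd2, h2⟩ := hr b hbJ
    -- The half ball beyond the end `b` misses `J` and overlaps the half balls above and below the
    -- axis, so it joins the two sides.
    set B : Set Plane := Metric.ball ((b, 0) : Plane) d0 ∩ {z | 0 < τ * z.1 - τ * b}
    have hτ1 : |τ| = 1 := by
      have := sq_abs τ
      rw [hτ] at this
      exact (pow_eq_one_iff_of_nonneg (abs_nonneg _) two_ne_zero).1 this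
    have hBc : Convex ℝ B := by
      refine (convex_ball _ _).inter ?_
      have : IsLinearMap ℝ (fun z : Plane => τ * z.1) :=
        ⟨fun x y => by simp [mul_add], fun c x => by simp; ring⟩
      simpa [sub_pos] using convex_halfSpace_gt this (τ * b)
    have hBW : B ⊆ W := by
      rintro z ⟨hz1, hz2⟩ (hz | ⟨s, hs, rfl⟩)
      · exact h0 hz1 hz
      · have := hτJ s hs
        simp only [mem_ofPred_eq] at hz2
        linarith
    set e := min d0 (min d1 d2) / 2
    have hm : 0 < min d0 (min d1 d2) := lt_min hd0 (lt_min hd1 hd2)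
    have he : 0 < e := half_pos hm
    have he0 : e < d0 := (half_lt_self hm).trans_le (min_le_left _ _)
    have he1 : e < d1 := (half_lt_self hm).trans_le ((min_le_right _ _).trans (min_le_left _ _))
    have he2 : e < d2 := (half_lt_self hm).trans_le ((min_le_right _ _).trans (min_le_right _ _))
    have hτe : |τ * e| = e := by rw [abs_mul, hτ1, one_mul, abs_of_pos he]
    have hpos : 0 < τ * (b + τ * e) - τ * b := by
      have : τ * (b + τ * e) - τ * b = τ ^ 2 * e := by ring
      rw [this, hτ]; linarith
    have hu : ((b + τ * e, e) : Plane) ∈ B ∩ halfBall 1 b d1 :=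
      ⟨⟨mem_ball_axis.2 (by simp [hτe, abs_of_pos he, he0]), hpos⟩,
        mem_ball_axis.2 (by simp [hτe, abs_of_pos he, he1]), by simpa using he⟩
    have hv : ((b + τ * e, -e) : Plane) ∈ B ∩ halfBall (-1) b d2 :=
      ⟨⟨mem_ball_axis.2 (by simp [hτe, abs_of_pos he, he0]), hpos⟩,
        mem_ball_axis.2 (by simp [hτe, abs_of_pos he, he2]), by simpa using he⟩
    rw [connectedComponentIn_eq (h1 hu.2), connectedComponentIn_eq (h2 hv.2)]
    exact connectedComponentIn_eq
      (hBc.isPreconnected.subset_connectedComponentIn hu.1 hBW hv.1)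
  refine regionCount_le_of_forall subset_union_left ?_
  intro x hx y hy hxy
  by_cases h1 : l ∈ connectedComponentIn W x
  · have h1' : r ∈ connectedComponentIn W x := by
      rw [connectedComponentIn_eq h1, hlr]
      exact mem_connectedComponentIn hrW
    by_cases h2 : l ∈ connectedComponentIn W y
    · rw [connectedComponentIn_eq h1, ← connectedComponentIn_eq h2]
      exact mem_connectedComponentIn hy
    · have h4 : r ∉ connectedComponentIn W y := by
        intro h
        rw [connectedComponentIn_eq h, ← hlr] at h2
        exact h2 (mem_connectedComponentIn hlW)
      have h5 := connectedComponentIn_compl_subset_of_sides hK' hl hr hy h2 h4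
      have h6 : x ∈ connectedComponentIn Kᶜ y := by
        rw [← connectedComponentIn_eq hxy]
        exact mem_connectedComponentIn fun h => hx (Or.inl h)
      rw [← connectedComponentIn_eq (h5 h6)]
      exact mem_connectedComponentIn hy
  · have h4 : r ∉ connectedComponentIn W x := by
      intro h
      rw [connectedComponentIn_eq h, ← hlr] at h1
      exact h1 (mem_connectedComponentIn hlW)
    exact connectedComponentIn_compl_subset_of_sides hK' hl hr hx h1 h4 hxy

theorem regionCount_preimage_homeomorph (Φ : Plane ≃ₜ Plane) (K : Set Plane) :
    regionCount (Φ ⁻¹' K) = regionCount K := by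
  have e : ↥((Φ ⁻¹' K)ᶜ) ≃ₜ ↥(Kᶜ) := Φ.sets rfl
  refine ENat.card_congr
    ⟨e.continuous.connectedComponentsMap, e.symm.continuous.connectedComponentsMap, ?_, ?_⟩
  · intro a
    obtain ⟨x, rfl⟩ := ConnectedComponents.surjective_coe a
    exact congrArg ConnectedComponents.mk (e.symm_apply_apply x)
  · intro a
    obtain ⟨x, rfl⟩ := ConnectedComponents.surjective_coe a
    exact congrArg ConnectedComponents.mk (e.apply_symm_apply x)

/-- The affine coordinate system with origin `p` and first axis in the direction `v`. -/
noncomputable def lineCoordinates (p v : Plane) (hv : v ≠ 0) : Plane ≃ₜ Plane where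
  toFun z := (p.1 + z.1 * v.1 - z.2 * v.2, p.2 + z.1 * v.2 + z.2 * v.1)
  invFun z := (((z.1 - p.1) * v.1 + (z.2 - p.2) * v.2) / (v.1 ^ 2 + v.2 ^ 2),
    ((z.2 - p.2) * v.1 - (z.1 - p.1) * v.2) / (v.1 ^ 2 + v.2 ^ 2))
  left_inv z := by
    have h : v.1 ^ 2 + v.2 ^ 2 ≠ 0 := fun h => hv (by
      ext <;> simp <;> nlinarith [sq_nonneg v.1, sq_nonneg v.2])
    ext <;> simp <;> field_simp <;> ring
  right_inv z := by
    have h : v.1 ^ 2 + v.2 ^ 2 ≠ 0 := fun h => hv (by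
      ext <;> simp <;> nlinarith [sq_nonneg v.1, sq_nonneg v.2])
    ext <;> simp <;> field_simp <;> ring
  continuous_toFun := by fun_prop
  continuous_invFun := by fun_prop

theorem lineCoordinates_axis (p v : Plane) (hv : v ≠ 0) (t : ℝ) :
    lineCoordinates p v hv (t, 0) = p + t • v := by
  ext <;> simp [lineCoordinates]

theorem lineCoordinates_preimage_image (p v : Plane) (hv : v ≠ 0) (J : Set ℝ) :
    lineCoordinates p v hv ⁻¹' ((fun t : ℝ => p + t • v) '' J) =
      (fun s : ℝ => ((s, 0) : Plane)) '' J := by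
  ext z
  constructor
  · rintro ⟨t, ht, h⟩
    refine ⟨t, ht, (lineCoordinates p v hv).injective ?_⟩
    rw [lineCoordinates_axis]
    exact h
  · rintro ⟨t, ht, rfl⟩
    exact ⟨t, ht, (lineCoordinates_axis p v hv t).symm⟩

theorem regionCount_union_interval_le {K : Set Plane} (hK : IsClosed K) {J : Set ℝ} {p v : Plane}
    (hv : v ≠ 0) (hJ : IsPreconnected J) (hd : ∀ t ∈ J, p + t • v ∉ K)
    (hK' : IsClosed (K ∪ (fun t : ℝ => p + t • v) '' J)) :
    regionCount (K ∪ (fun t : ℝ => p + t • v) '' J) ≤ regionCount K + 1 := by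
  rw [← regionCount_preimage_homeomorph (lineCoordinates p v hv),
    ← regionCount_preimage_homeomorph (lineCoordinates p v hv) K, preimage_union,
    lineCoordinates_preimage_image]
  refine regionCount_union_axis_le (hK.preimage (lineCoordinates p v hv).continuous) hJ ?_ ?_
  · intro t ht
    rw [mem_preimage, lineCoordinates_axis]
    exact hd t ht
  · rw [← lineCoordinates_preimage_image p v hv, ← preimage_union]
    exact hK'.preimage (lineCoordinates p v hv).continuous

theorem regionCount_union_interval_le_of_dangling {K : Set Plane} (hK : IsClosed K) {J : Set ℝ}
    {p v : Plane} (hv : v ≠ 0) (hJ : IsPreconnected J) (hd : ∀ t ∈ J, p + t • v ∉ K)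
    (hK' : IsClosed (K ∪ (fun t : ℝ => p + t • v) '' J))
    (hb : (∃ b, IsGreatest J b) ∨ ∃ b, IsLeast J b) :
    regionCount (K ∪ (fun t : ℝ => p + t • v) '' J) ≤ regionCount K := by
  rw [← regionCount_preimage_homeomorph (lineCoordinates p v hv),
    ← regionCount_preimage_homeomorph (lineCoordinates p v hv) K, preimage_union,
    lineCoordinates_preimage_image]
  refine regionCount_union_axis_le_of_dangling
    (hK.preimage (lineCoordinates p v hv).continuous) hJ ?_ ?_ hb
  · intro t ht
    rw [mem_preimage, lineCoordinates_axis]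
    exact hd t ht
  · rw [← lineCoordinates_preimage_image p v hv, ← preimage_union]
    exact hK'.preimage (lineCoordinates p v hv).continuous

end Topology

/-! ### Cutting a ray or a segment at a closed set -/

section Gaps
open Set Topology

/-- The part of `I` after `α` and before the next point of `T`. -/
def gapAfter (I T : Set ℝ) (α : ℝ) : Set ℝ := {t | t ∈ I ∧ α < t ∧ ∀ r ∈ T, r ≤ t → r ≤ α}

/-- The part of `I` before `T`. -/
def gapBefore (I T : Set ℝ) : Set ℝ := {t | t ∈ I ∧ ∀ r ∈ T, t < r}

theorem isPreconnected_gapAfter {I T : Set ℝ} (hI : I.OrdConnected) (α : ℝ) :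
    IsPreconnected (gapAfter I T α) := by
  have : (gapAfter I T α).OrdConnected := ⟨fun a ha b hb c hc =>
    ⟨hI.out ha.1 hb.1 hc, ha.2.1.trans_le hc.1, fun r hr hrc => hb.2.2 r hr (hrc.trans hc.2)⟩⟩
  exact this.isPreconnected

theorem isPreconnected_gapBefore {I T : Set ℝ} (hI : I.OrdConnected) :
    IsPreconnected (gapBefore I T) := by
  have : (gapBefore I T).OrdConnected := ⟨fun a ha b hb c hc =>
    ⟨hI.out ha.1 hb.1 hc, fun r hr => hc.2.trans_lt (hb.2 r hr)⟩⟩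
  exact this.isPreconnected

theorem isClosed_gapAfter_union {I T : Set ℝ} (hI : IsClosed I) (hT : IsClosed T) {α : ℝ}
    (hα : α ∈ T) : IsClosed (gapAfter I T α ∪ T) := by
  have : gapAfter I T α ∪ T = (I ∩ Ici α ∩ ⋂ r ∈ T ∩ Ioi α, Iic r) ∪ T := by
    ext t
    simp only [mem_union, gapAfter, mem_ofPred_eq, mem_inter_iff, mem_Ici, mem_iInter, mem_Iic,
      mem_Ioi]
    constructor
    · rintro (⟨h1, h2, h3⟩ | h)
      · refine Or.inl ⟨⟨h1, h2.le⟩, fun r hr => ?_⟩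
        by_contra hc
        exact absurd (h3 r hr.1 (not_le.1 hc).le) (not_le.2 hr.2)
      · exact Or.inr h
    · rintro (⟨⟨h1, h2⟩, h3⟩ | h)
      · by_cases ht : t ∈ T
        · exact Or.inr ht
        · refine Or.inl ⟨h1, lt_of_le_of_ne h2 (fun h => ht (h ▸ hα)), fun r hr hrt => ?_⟩
          by_contra hc
          exact ht (le_antisymm hrt (h3 r ⟨hr, not_le.1 hc⟩) ▸ hr)
      · exact Or.inr h
  rw [this]
  exact ((hI.inter isClosed_Ici).inter
    (isClosed_iInter fun _ => isClosed_iInter fun _ => isClosed_Iic)).union hT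

theorem isClosed_gapBefore_union {I T : Set ℝ} (hI : IsClosed I) (hT : IsClosed T) :
    IsClosed (gapBefore I T ∪ T) := by
  have : gapBefore I T ∪ T = (I ∩ ⋂ r ∈ T, Iic r) ∪ T := by
    ext t
    simp only [mem_union, gapBefore, mem_ofPred_eq, mem_inter_iff, mem_iInter, mem_Iic]
    constructor
    · rintro (⟨h1, h2⟩ | h)
      · exact Or.inl ⟨h1, fun r hr => (h2 r hr).le⟩
      · exact Or.inr h
    · rintro (⟨h1, h2⟩ | h)
      · by_cases ht : t ∈ T
        · exact Or.inr ht
        · exact Or.inl ⟨h1, fun r hr => lt_of_le_of_ne (h2 r hr) (fun h => ht (h ▸ hr))⟩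
      · exact Or.inr h
  rw [this]
  exact (hI.inter (isClosed_iInter fun _ => isClosed_iInter fun _ => isClosed_Iic)).union hT

theorem subset_union_gaps {I T : Set ℝ} (hT : IsClosed T) {t : ℝ} (ht : t ∈ I) :
    t ∈ T ∨ t ∈ gapBefore I T ∨ ∃ α ∈ T, t ∈ gapAfter I T α := by
  by_cases htT : t ∈ T
  · exact Or.inl htT
  right
  by_cases hne : (T ∩ Iic t).Nonempty
  · right
    have hb : BddAbove (T ∩ Iic t) := ⟨t, fun r hr => hr.2⟩
    have hm := (hT.inter isClosed_Iic).csSup_mem hne hb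
    refine ⟨_, hm.1, ht, lt_of_le_of_ne hm.2 (fun h => htT (h ▸ hm.1)), fun r hr hrt => ?_⟩
    exact le_csSup hb ⟨hr, hrt⟩
  · left
    refine ⟨ht, fun r hr => ?_⟩
    by_contra hc
    exact hne ⟨r, hr, not_lt.1 hc⟩

theorem isClosed_image_line {p v : Plane} (hv : v ≠ 0) {S : Set ℝ} (hS : IsClosed S) :
    IsClosed ((fun t : ℝ => p + t • v) '' S) := by
  have : (fun t : ℝ => p + t • v) '' S = lineCoordinates p v hv '' (S ×ˢ {0}) := by
    ext z
    constructor
    · rintro ⟨t, ht, rfl⟩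
      exact ⟨(t, 0), ⟨ht, rfl⟩, lineCoordinates_axis p v hv t⟩
    · rintro ⟨⟨t, u⟩, ⟨ht, hu⟩, rfl⟩
      obtain rfl : u = 0 := hu
      exact ⟨t, ht, (lineCoordinates_axis p v hv t).symm⟩
  rw [this]
  exact (lineCoordinates p v hv).isClosedMap _ (hS.prod isClosed_singleton)

theorem line_injective {p v : Plane} (hv : v ≠ 0) : Function.Injective fun t : ℝ => p + t • v := by
  intro a b h
  exact smul_left_injective ℝ hv (add_left_cancel h)

/-- The parameters in `I` for which the point of the line is in `K`. -/
def hitTimes (K : Set Plane) (p v : Plane) (I : Set ℝ) : Set ℝ := {t | t ∈ I ∧ p + t • v ∈ K}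

theorem isClosed_hitTimes {K : Set Plane} (hK : IsClosed K) (p v : Plane) {I : Set ℝ}
    (hI : IsClosed I) : IsClosed (hitTimes K p v I) :=
  hI.inter (hK.preimage (by fun_prop : Continuous fun t : ℝ => p + t • v))

theorem isClosed_union_image_of_hitTimes {K : Set Plane} (hK : IsClosed K) {p v : Plane}
    (hv : v ≠ 0) {I J : Set ℝ} (hJ : IsClosed (J ∪ hitTimes K p v I)) :
    IsClosed (K ∪ (fun t : ℝ => p + t • v) '' J) := by
  have : K ∪ (fun t : ℝ => p + t • v) '' J =
      K ∪ (fun t : ℝ => p + t • v) '' (J ∪ hitTimes K p v I) := by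
    refine subset_antisymm (union_subset_union_right _ (image_mono subset_union_left)) ?_
    rintro z (hz | ⟨t, ht | ht, rfl⟩)
    · exact Or.inl hz
    · exact Or.inr ⟨t, ht, rfl⟩
    · exact Or.inl ht.2
  rw [this]
  exact hK.union (isClosed_image_line hv hJ)

theorem regionCount_union_gapsAfter_le {K : Set Plane} (hK : IsClosed K) {p v : Plane}
    (hv : v ≠ 0) {I : Set ℝ} (hI : IsClosed I) (hIc : I.OrdConnected)
    {L : Set Plane} (hL : IsClosed L) (hKL : K ⊆ L) (s : Finset ℝ)
    (hs : ∀ α ∈ s, α ∈ hitTimes K p v I)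
    (hd : ∀ α ∈ s, ∀ t ∈ gapAfter I (hitTimes K p v I) α, p + t • v ∉ L) :
    IsClosed (L ∪ ⋃ α ∈ s, (fun t : ℝ => p + t • v) '' gapAfter I (hitTimes K p v I) α) ∧
    regionCount (L ∪ ⋃ α ∈ s, (fun t : ℝ => p + t • v) '' gapAfter I (hitTimes K p v I) α) ≤
      regionCount L + s.card := by
  classical
  induction s using Finset.induction_on with
  | empty => simpa using hL
  | insert α s hα ih =>
    obtain ⟨h1, h2⟩ := ih (fun β hβ => hs β (Finset.mem_insert_of_mem hβ))
      (fun β hβ => hd β (Finset.mem_insert_of_mem hβ))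
    have hαT := hs α (Finset.mem_insert_self _ _)
    set M := L ∪ ⋃ α ∈ s, (fun t : ℝ => p + t • v) '' gapAfter I (hitTimes K p v I) α
    have e : (L ∪ ⋃ β ∈ insert α s, (fun t : ℝ => p + t • v) '' gapAfter I (hitTimes K p v I) β) =
        M ∪ (fun t : ℝ => p + t • v) '' gapAfter I (hitTimes K p v I) α := by
      rw [Finset.set_biUnion_insert, union_comm _ (⋃ β ∈ s, _), ← union_assoc]
    have hKM : K ⊆ M := hKL.trans subset_union_left
    have hcl : IsClosed (M ∪ (fun t : ℝ => p + t • v) '' gapAfter I (hitTimes K p v I) α) := by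
      have h3 := h1.union (isClosed_union_image_of_hitTimes hK hv
        (isClosed_gapAfter_union hI (isClosed_hitTimes hK p v hI) hαT))
      rwa [← union_assoc, union_eq_left.2 hKM] at h3
    rw [e, Finset.card_insert_of_notMem hα]
    refine ⟨hcl, (regionCount_union_interval_le h1 hv (isPreconnected_gapAfter hIc α) ?_ hcl).trans
      ?_⟩
    · rintro t ht (h | h)
      · exact hd α (Finset.mem_insert_self _ _) t ht h
      · simp only [mem_iUnion] at h
        obtain ⟨β, hβ, u, hu, hut⟩ := h
        obtain rfl : u = t := line_injective hv hut
        have e1 := ht.2.2 β (hs β (Finset.mem_insert_of_mem hβ)) hu.2.1.le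
        have e2 := hu.2.2 α hαT ht.2.1.le
        exact hα (le_antisymm e1 e2 ▸ hβ)
    · push_cast
      rw [← add_assoc]
      gcongr

/-- A set of points of `T` that, except possibly for the last, are followed by gaps has at most
as many elements as there are convex sets covering `T`. -/
theorem finite_card_le_of_gaps {I T : Set ℝ} (C : Finset (Set ℝ)) (hC : ∀ c ∈ C, c.OrdConnected)
    (hT : T = ⋃ c ∈ C, c) (Γ : Set ℝ) (hΓ : Γ ⊆ T)
    (hgap : ∀ α ∈ Γ, ∀ β ∈ Γ, α < β → (gapAfter I T α).Nonempty) :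
    Γ.Finite ∧ Γ.ncard ≤ C.card := by
  have hsel : ∀ α : ℝ, ∃ c, α ∈ Γ → c ∈ C ∧ α ∈ c := by
    intro α
    by_cases h : α ∈ Γ
    · have := hΓ h
      rw [hT] at this
      simp only [mem_iUnion] at this
      obtain ⟨c, hc, hαc⟩ := this
      exact ⟨c, fun _ => ⟨hc, hαc⟩⟩
    · exact ⟨∅, fun h' => absurd h' h⟩
  choose f hf using hsel
  -- If one convex piece contained both `α` and `β`, then all of `[α, β]` would be in `T`, leaving
  -- no room for a gap right after `α`.
  have key : ∀ α ∈ Γ, ∀ β ∈ Γ, f α = f β → ¬ α < β := by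
    intro α hα β hβ hab hlt
    obtain ⟨t, -, ht1, ht2⟩ := hgap α hα β hβ hlt
    rcases lt_or_ge t β with h | h
    · have htT : t ∈ T := by
        rw [hT]
        simp only [mem_iUnion]
        exact ⟨f α, (hf α hα).1, (hC _ (hf α hα).1).out (hf α hα).2 (hab ▸ (hf β hβ).2) ⟨ht1.le, h.le⟩⟩
      exact absurd (ht2 t htT le_rfl) (not_le.2 ht1)
    · exact absurd (ht2 β (hΓ hβ) h) (not_le.2 hlt)
  have hinj : InjOn f Γ := by
    intro α hα β hβ hab
    rcases lt_trichotomy α β with h | h | h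
    · exact absurd h (key α hα β hβ hab)
    · exact h
    · exact absurd h (key β hβ α hα hab.symm)
  have hmaps : MapsTo f Γ (C : Set (Set ℝ)) := fun α hα => (hf α hα).1
  refine ⟨Finite.of_injOn hmaps hinj C.finite_toSet, ?_⟩
  rw [← ncard_coe_finset]
  exact ncard_le_ncard_of_injOn f (fun a ha => hmaps ha) hinj C.finite_toSet

/-- If the part before the first hit is nonempty, it contains the starting point `b`; it dangles
there and splits nothing. -/
theorem regionCount_union_gapBefore_le {K : Set Plane} (hK : IsClosed K) {p v : Plane}
    (hv : v ≠ 0) {I : Set ℝ} (hI : IsClosed I) (hIc : I.OrdConnected) {b : ℝ} (hb : IsLeast I b) :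
    IsClosed (K ∪ (fun t : ℝ => p + t • v) '' gapBefore I (hitTimes K p v I)) ∧
    regionCount (K ∪ (fun t : ℝ => p + t • v) '' gapBefore I (hitTimes K p v I)) ≤
      regionCount K := by
  have hcl := isClosed_union_image_of_hitTimes hK hv
    (isClosed_gapBefore_union hI (isClosed_hitTimes hK p v hI))
  refine ⟨hcl, ?_⟩
  rcases (gapBefore I (hitTimes K p v I)).eq_empty_or_nonempty with h | ⟨t, ht⟩
  · rw [h]; simp
  · refine regionCount_union_interval_le_of_dangling hK hv (isPreconnected_gapBefore hIc)
      (fun t ht h => lt_irrefl t (ht.2 t ⟨ht.1, h⟩)) hcl (Or.inr ⟨b, ?_, fun s hs => hb.2 hs.1⟩)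
    exact ⟨hb.1, fun r hr => (hb.2 ht.1).trans_lt (ht.2 r hr)⟩

theorem union_image_line_eq {K : Set Plane} (hK : IsClosed K) {p v : Plane} {I : Set ℝ}
    (hI : IsClosed I) (s : Set ℝ)
    (hs : ∀ α ∈ hitTimes K p v I, (gapAfter I (hitTimes K p v I) α).Nonempty → α ∈ s) :
    K ∪ (fun t : ℝ => p + t • v) '' I =
      (K ∪ (fun t : ℝ => p + t • v) '' gapBefore I (hitTimes K p v I)) ∪
        ⋃ α ∈ s, (fun t : ℝ => p + t • v) '' gapAfter I (hitTimes K p v I) α := by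
  apply subset_antisymm
  · rintro z (hz | ⟨t, ht, rfl⟩)
    · exact Or.inl (Or.inl hz)
    · rcases subset_union_gaps (isClosed_hitTimes hK p v hI) ht with h | h | ⟨α, hα, h⟩
      · exact Or.inl (Or.inl h.2)
      · exact Or.inl (Or.inr ⟨t, h, rfl⟩)
      · exact Or.inr (mem_biUnion (hs α hα ⟨t, h⟩) ⟨t, h, rfl⟩)
  · refine union_subset (union_subset_union_right _ (image_mono fun t ht => ht.1)) ?_
    refine iUnion₂_subset fun α _ => subset_union_of_subset_right (image_mono fun t ht => ht.1) _

theorem gapAfter_notMem {K : Set Plane} {p v : Plane} (hv : v ≠ 0) {I : Set ℝ} {α t : ℝ}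
    (hα : α ∈ hitTimes K p v I) (ht : t ∈ gapAfter I (hitTimes K p v I) α) :
    p + t • v ∉ K ∪ (fun t : ℝ => p + t • v) '' gapBefore I (hitTimes K p v I) := by
  rintro (h | ⟨u, hu, hut⟩)
  · exact absurd (ht.2.2 t ⟨ht.1, h⟩ le_rfl) (not_le.2 ht.2.1)
  · obtain rfl : u = t := line_injective hv hut
    exact absurd (hu.2 α hα) (not_lt.2 ht.2.1.le)

/-- Only the gaps that follow a hit can create regions, at most one each, and there are at most as
many of them as convex pieces. -/
theorem regionCount_union_halfLine_le {K : Set Plane} (hK : IsClosed K) {p v : Plane}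
    (hv : v ≠ 0) (C : Finset (Set ℝ)) (hC : ∀ c ∈ C, c.OrdConnected)
    (hT : hitTimes K p v (Ici 0) = ⋃ c ∈ C, c) :
    regionCount (K ∪ (fun t : ℝ => p + t • v) '' Ici 0) ≤ regionCount K + C.card := by
  set T := hitTimes K p v (Ici 0) with hTdef
  set Γ := {α | α ∈ T ∧ (gapAfter (Ici 0) T α).Nonempty} with hΓ
  obtain ⟨hfin, hcard⟩ := finite_card_le_of_gaps (I := Ici 0) C hC hT Γ (fun α h => h.1)
    (fun α hα _ _ _ => hα.2)
  obtain ⟨hL, hle⟩ := regionCount_union_gapBefore_le hK (p := p) hv isClosed_Ici ordConnected_Ici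
    (b := 0) isLeast_Ici
  have h := regionCount_union_gapsAfter_le hK hv isClosed_Ici ordConnected_Ici hL
    subset_union_left hfin.toFinset (fun α hα => (hfin.mem_toFinset.1 hα).1)
    (fun α hα t ht => gapAfter_notMem hv (hfin.mem_toFinset.1 hα).1 ht)
  rw [union_image_line_eq hK isClosed_Ici Γ (fun α h1 h2 => ⟨h1, h2⟩)]
  rw [ncard_eq_toFinset_card Γ hfin] at hcard
  simp only [Finite.mem_toFinset] at h
  refine h.2.trans (add_le_add hle ?_)
  exact_mod_cast hcard

/-- In contrast to a ray, the part of a segment after its last hit dangles as well, at the parameter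
`1`; this saves one region. -/
theorem regionCount_union_interval_add_one_le {K : Set Plane} (hK : IsClosed K) {p v : Plane}
    (hv : v ≠ 0) (C : Finset (Set ℝ)) (hC : ∀ c ∈ C, c.OrdConnected)
    (hT : hitTimes K p v (Icc 0 1) = ⋃ c ∈ C, c) (hne : (hitTimes K p v (Icc 0 1)).Nonempty) :
    regionCount (K ∪ (fun t : ℝ => p + t • v) '' Icc 0 1) + 1 ≤ regionCount K + C.card := by
  classical
  have hTc := isClosed_hitTimes hK p v (isClosed_Icc (a := (0 : ℝ)) (b := 1))
  set T := hitTimes K p v (Icc 0 1) with hTdef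
  obtain ⟨m, hm⟩ : ∃ m, IsGreatest T m :=
    (isCompact_Icc.of_isClosed_subset hTc (fun t ht => ht.1)).exists_isGreatest hne
  -- The last hit `m` is counted whether or not a gap follows it. Removing it again leaves at most
  -- `C.card - 1` hits whose gaps can cost a region.
  set Γ := insert m {α | α ∈ T ∧ (gapAfter (Icc 0 1) T α).Nonempty} with hΓ
  have hΓT : Γ ⊆ T := insert_subset hm.1 fun α h => h.1
  obtain ⟨hfin, hcard⟩ := finite_card_le_of_gaps (I := Icc 0 1) C hC hT Γ hΓT (by
    intro α hα β hβ hlt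
    rcases hα with rfl | hα
    · exact absurd (hm.2 (hΓT hβ)) (not_le.2 hlt)
    · exact hα.2)
  obtain ⟨hL, hle⟩ := regionCount_union_gapBefore_le hK (p := p) hv isClosed_Icc ordConnected_Icc
    (b := 0) (isLeast_Icc zero_le_one)
  set s := hfin.toFinset.erase m with hs
  have hsΓ : ∀ α ∈ s, α ∈ Γ := fun α hα => hfin.mem_toFinset.1 (Finset.mem_of_mem_erase hα)
  have h := regionCount_union_gapsAfter_le hK hv isClosed_Icc ordConnected_Icc hL
    subset_union_left s (fun α hα => hΓT (hsΓ α hα))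
    (fun α hα t ht => gapAfter_notMem hv (hΓT (hsΓ α hα)) ht)
  set M := (K ∪ (fun t : ℝ => p + t • v) '' gapBefore (Icc 0 1) T) ∪
    ⋃ α ∈ s, (fun t : ℝ => p + t • v) '' gapAfter (Icc 0 1) T α with hM
  have hKM : K ⊆ M := subset_union_left.trans subset_union_left
  have e : K ∪ (fun t : ℝ => p + t • v) '' Icc 0 1 =
      M ∪ (fun t : ℝ => p + t • v) '' gapAfter (Icc 0 1) T m := by
    rw [union_image_line_eq hK isClosed_Icc Γ (fun α h1 h2 => Or.inr ⟨h1, h2⟩)]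
    refine (congrArg (fun X => (K ∪ (fun t : ℝ => p + t • v) '' gapBefore (Icc 0 1) T) ∪ X)
      ?_).trans (union_assoc _ _ _).symm
    ext z
    simp only [mem_iUnion, mem_union, exists_prop, hs, Finset.mem_erase, Finite.mem_toFinset]
    constructor
    · rintro ⟨α, hα, hz⟩
      by_cases hαm : α = m
      · exact Or.inr (hαm ▸ hz)
      · exact Or.inl ⟨α, ⟨hαm, hα⟩, hz⟩
    · rintro (⟨α, ⟨-, hα⟩, hz⟩ | hz)
      · exact ⟨α, hα, hz⟩
      · exact ⟨m, Or.inl rfl, hz⟩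
  have hlast : regionCount (M ∪ (fun t : ℝ => p + t • v) '' gapAfter (Icc 0 1) T m) ≤
      regionCount M := by
    rcases (gapAfter (Icc 0 1) T m).eq_empty_or_nonempty with h0 | ⟨t, ht⟩
    · rw [h0]; simp
    · refine regionCount_union_interval_le_of_dangling h.1 hv
        (isPreconnected_gapAfter ordConnected_Icc m) ?_ ?_ (Or.inl ⟨1, ?_, fun u hu => hu.1.2⟩)
      · rintro u hu (h1 | h1)
        · exact gapAfter_notMem hv hm.1 hu h1
        · simp only [mem_iUnion] at h1
          obtain ⟨β, hβ, w, hw, hwu⟩ := h1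
          obtain rfl : w = u := line_injective hv hwu
          have e1 := hw.2.2 m hm.1 hu.2.1.le
          exact (Finset.ne_of_mem_erase hβ) (le_antisymm (hm.2 (hΓT (hsΓ β hβ))) e1)
      · have h3 := h.1.union (isClosed_union_image_of_hitTimes (I := Icc 0 1) hK hv
          (isClosed_gapAfter_union (I := Icc 0 1) isClosed_Icc hTc hm.1))
        rwa [← union_assoc, union_eq_left.2 hKM] at h3
      · exact ⟨⟨zero_le_one, le_rfl⟩, ht.2.1.trans_le ht.1.2, fun r hr _ => hm.2 hr⟩
  have hcard' : s.card + 1 ≤ C.card := by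
    rw [hs, Finset.card_erase_add_one (hfin.mem_toFinset.2 (Or.inl rfl)),
      ← ncard_eq_toFinset_card Γ hfin]
    exact hcard
  rw [e]
  calc _ ≤ regionCount M + 1 := by gcongr
    _ ≤ regionCount K + s.card + 1 := by
      gcongr
      exact h.2.trans (add_le_add hle le_rfl)
    _ ≤ regionCount K + C.card := by
      rw [add_assoc]
      gcongr
      exact_mod_cast hcard'

end Gaps

/-! ### Upper bound for the number of regions -/

section UpperBound
open Set Topology

theorem ray_eq_image (p v : Plane) : ray p v = (fun t : ℝ => p + t • v) '' Ici 0 := by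
  ext x
  constructor
  · rintro ⟨t, ht, rfl⟩
    exact ⟨t, ht, rfl⟩
  · rintro ⟨t, ht, rfl⟩
    exact ⟨t, ht, rfl⟩

theorem mem_ray_self (p v : Plane) : p ∈ ray p v := ⟨0, le_rfl, by simp⟩

theorem convex_ray (p v : Plane) : Convex ℝ (ray p v) := by
  rintro _ ⟨s, hs, rfl⟩ _ ⟨t, ht, rfl⟩ a b ha hb hab
  refine ⟨a * s + b * t, by positivity, ?_⟩
  calc a • (p + s • v) + b • (p + t • v) = (a + b) • p + (a * s + b * t) • v := by module
    _ = _ := by rw [hab, one_smul]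

theorem isClosed_ray {p v : Plane} (hv : v ≠ 0) : IsClosed (ray p v) := by
  rw [ray_eq_image]
  exact isClosed_image_line hv isClosed_Ici

theorem segment_eq_image_line (p q : Plane) :
    segment ℝ p q = (fun t : ℝ => p + t • (q - p)) '' Icc 0 1 := segment_eq_image' ℝ p q

theorem isClosed_segment_plane {p q : Plane} (h : p ≠ q) : IsClosed (segment ℝ p q) := by
  rw [segment_eq_image_line]
  exact isClosed_image_line (sub_ne_zero.2 h.symm) isClosed_Icc

theorem segment_subset_ray (p q : Plane) : segment ℝ p q ⊆ ray p (q - p) := by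
  rw [segment_eq_image_line, ray_eq_image]
  exact image_mono fun t ht => ht.1

theorem segment_subset_ray' (p q : Plane) : segment ℝ p q ⊆ ray q (p - q) := by
  rw [segment_symm]
  exact segment_subset_ray q p

theorem eq_of_mem_ray_of_not_sameRay {p u v x : Plane} (h : ¬ SameRay ℝ u v) (hu : x ∈ ray p u)
    (hv : x ∈ ray p v) : x = p := by
  obtain ⟨s, hs, rfl⟩ := hu
  obtain ⟨t, ht, hst⟩ := hv
  have hst : s • u = t • v := add_left_cancel hst
  rcases hs.eq_or_lt with rfl | hs
  · simp
  rcases ht.eq_or_lt with rfl | ht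
  · rw [hst]; simp
  exact absurd (Or.inr (Or.inr ⟨s, t, hs, ht, hst⟩)) h

theorem ordConnected_preimage_line {c : Set Plane} (hc : Convex ℝ c) (p v : Plane) {I : Set ℝ}
    (hI : I.OrdConnected) : (hitTimes c p v I).OrdConnected := by
  refine Convex.ordConnected (𝕜 := ℝ) ?_
  refine hI.convex.inter ?_
  have := hc.affine_preimage (AffineMap.lineMap p (p + v) : ℝ →ᵃ[ℝ] Plane)
  have e : {t : ℝ | p + t • v ∈ c} = (AffineMap.lineMap p (p + v) : ℝ →ᵃ[ℝ] Plane) ⁻¹' c := by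
    ext t
    simp [AffineMap.lineMap_apply, add_comm]
  rw [← e] at this
  exact this

theorem hitTimes_eq_iUnion {K : Set Plane} {p v : Plane} {I : Set ℝ} (C : Finset (Set Plane))
    [DecidableEq (Set ℝ)]
    (h : ∀ x ∈ (fun t : ℝ => p + t • v) '' I, x ∈ K ↔ ∃ c ∈ C, x ∈ c) :
    hitTimes K p v I = ⋃ c ∈ C.image (fun c => hitTimes c p v I), c := by
  ext t
  simp only [Finset.mem_image, mem_iUnion, hitTimes, mem_ofPred_eq]
  constructor
  · rintro ⟨h1, h2⟩
    obtain ⟨c, hc, hx⟩ := (h _ ⟨t, h1, rfl⟩).1 h2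
    exact ⟨_, ⟨c, hc, rfl⟩, h1, hx⟩
  · rintro ⟨_, ⟨c, hc, rfl⟩, h1, hx⟩
    exact ⟨h1, (h _ ⟨t, h1, rfl⟩).2 ⟨c, hc, hx⟩⟩

theorem regionCount_union_ray_le {K : Set Plane} (hK : IsClosed K) {p v : Plane} (hv : v ≠ 0)
    (C : Finset (Set Plane)) (hC : ∀ c ∈ C, Convex ℝ c)
    (h : ∀ x ∈ ray p v, x ∈ K ↔ ∃ c ∈ C, x ∈ c) :
    regionCount (K ∪ ray p v) ≤ regionCount K + C.card := by
  classical
  rw [ray_eq_image] at h ⊢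
  refine (regionCount_union_halfLine_le hK hv (C.image fun c => hitTimes c p v (Ici 0)) ?_
    (hitTimes_eq_iUnion C h)).trans ?_
  · intro c hc
    obtain ⟨d, hd, rfl⟩ := Finset.mem_image.1 hc
    exact ordConnected_preimage_line (hC d hd) p v ordConnected_Ici
  · gcongr
    exact Finset.card_image_le

/-- The starting point `p`, assumed to be drawn already, is one more convex piece; it cancels
against the region saved by a segment. So only the pieces other than `p` count. -/
theorem regionCount_union_segment_le {K : Set Plane} (hK : IsClosed K) {p q : Plane} (hpq : p ≠ q)
    (C : Finset (Set Plane)) (hC : ∀ c ∈ C, Convex ℝ c)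
    (h : ∀ x ∈ segment ℝ p q, x ∈ K ↔ x = p ∨ ∃ c ∈ C, x ∈ c) :
    regionCount (K ∪ segment ℝ p q) ≤ regionCount K + C.card := by
  classical
  have hp : p ∈ K := (h p (left_mem_segment ℝ p q)).2 (Or.inl rfl)
  rw [segment_eq_image_line] at h ⊢
  have h' : ∀ x ∈ (fun t : ℝ => p + t • (q - p)) '' Icc 0 1,
      x ∈ K ↔ ∃ c ∈ insert {p} C, x ∈ c := by
    intro x hx
    simpa using h x hx
  have key := regionCount_union_interval_add_one_le hK (sub_ne_zero.2 hpq.symm)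
    ((insert {p} C).image fun c => hitTimes c p (q - p) (Icc 0 1)) (fun c hc => by
      obtain ⟨d, hd, rfl⟩ := Finset.mem_image.1 hc
      refine ordConnected_preimage_line ?_ p _ ordConnected_Icc
      rcases Finset.mem_insert.1 hd with rfl | hd
      · exact convex_singleton p
      · exact hC d hd) (hitTimes_eq_iUnion _ h') ⟨0, by simp, by simpa using hp⟩
  have hcard : ((insert {p} C).image fun c => hitTimes c p (q - p) (Icc 0 1)).card ≤ C.card + 1 :=
    Finset.card_image_le.trans (Finset.card_insert_le _ _)
  have := key.trans (add_le_add le_rfl (Nat.cast_le.2 hcard))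
  push_cast at this
  rw [← add_assoc] at this
  exact (ENat.add_le_add_iff_right (by simp)).1 this

/-- `K` is the union of at most `N` closed convex sets. -/
def IsConvexUnion (K : Set Plane) (N : ℕ) : Prop :=
  ∃ C : Finset (Set Plane), C.card ≤ N ∧ (∀ c ∈ C, IsClosed c ∧ Convex ℝ c) ∧ K = ⋃ c ∈ C, c

theorem isConvexUnion_empty : IsConvexUnion ∅ 0 := ⟨∅, by simp⟩

theorem IsConvexUnion.isClosed {K : Set Plane} {N : ℕ} (h : IsConvexUnion K N) : IsClosed K := by
  obtain ⟨C, -, hC, rfl⟩ := h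
  exact isClosed_biUnion_finset fun c hc => (hC c hc).1

theorem IsConvexUnion.union {K A : Set Plane} {N : ℕ} (h : IsConvexUnion K N) (hA : IsClosed A)
    (hAc : Convex ℝ A) : IsConvexUnion (K ∪ A) (N + 1) := by
  classical
  obtain ⟨C, hN, hC, rfl⟩ := h
  refine ⟨insert A C, (Finset.card_insert_le _ _).trans (by omega), ?_, ?_⟩
  · intro c hc
    rcases Finset.mem_insert.1 hc with rfl | hc
    · exact ⟨hA, hAc⟩
    · exact hC c hc
  · rw [Finset.set_biUnion_insert, union_comm]

theorem LongLeggedH.carrier_eq (S : LongLeggedH) :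
    S.carrier = (((ray (S.tip 0) (S.leg 0 0) ∪ ray (S.tip 0) (S.leg 0 1)) ∪
      ray (S.tip 1) (S.leg 1 0)) ∪ ray (S.tip 1) (S.leg 1 1)) ∪ segment ℝ (S.tip 0) (S.tip 1) := by
  ext x
  simp only [carrier, mem_iUnion, Option.exists, Prod.exists, Fin.exists_fin_two, arm, mem_union]
  tauto

theorem FiveChain.carrier_eq (S : FiveChain) :
    S.carrier = (((ray (S.node 0) (S.out 0) ∪ segment ℝ (S.node 0) (S.node 1)) ∪
      segment ℝ (S.node 1) (S.node 2)) ∪ segment ℝ (S.node 2) (S.node 3)) ∪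
      ray (S.node 3) (S.out 1) := by
  ext x
  simp only [carrier, mem_iUnion, Fin.exists_fin_succ, Fin.exists_fin_zero, arm, mem_union]
  simp
  tauto

theorem ne_zero_of_not_sameRay_left {u v : Plane} (h : ¬ SameRay ℝ u v) : u ≠ 0 := by
  rintro rfl
  exact h (SameRay.zero_left _)

theorem ne_zero_of_not_sameRay_right {u v : Plane} (h : ¬ SameRay ℝ u v) : v ≠ 0 := by
  rintro rfl
  exact h (SameRay.zero_right _)

/-- The four legs and then the bar gain at most `N`, `N + 1`, `N + 2`, `N + 3` and `N + 1` regions.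
The second leg meets the first only at `p`; the third can meet both legs at `p`; the fourth meets
these two and, at `q` only, the third; the bar starts at `p` and meets the legs only at the tips. -/
theorem LongLeggedH.Proper.regionCount_union_le {S : LongLeggedH} (hS : S.Proper) {K : Set Plane}
    {N : ℕ} (hK : IsConvexUnion K N) :
    IsConvexUnion (K ∪ S.carrier) (N + 5) ∧
      regionCount (K ∪ S.carrier) ≤ regionCount K + (5 * N + 7 : ℕ) := by
  classical
  obtain ⟨hleg, h0, h1⟩ := hS
  obtain ⟨C, hN, hC, hKC⟩ := id hK
  have hmem : ∀ x, x ∈ K ↔ ∃ c ∈ C, x ∈ c := fun x => by rw [hKC]; simp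
  set p := S.tip 0
  set q := S.tip 1
  have hpq : p ≠ q := (sub_ne_zero.1 (ne_zero_of_not_sameRay_right (h0 0))).symm
  have n00 := ne_zero_of_not_sameRay_left (h0 0)
  have n01 := ne_zero_of_not_sameRay_left (h0 1)
  have n10 := ne_zero_of_not_sameRay_left (h1 0)
  have n11 := ne_zero_of_not_sameRay_left (h1 1)
  have k1 := hK.union (isClosed_ray (p := p) n00) (convex_ray _ _)
  have k2 := k1.union (isClosed_ray (p := p) n01) (convex_ray _ _)
  have k3 := k2.union (isClosed_ray (p := q) n10) (convex_ray _ _)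
  have k4 := k3.union (isClosed_ray (p := q) n11) (convex_ray _ _)
  have k5 := k4.union (isClosed_segment_plane hpq) (convex_segment _ _)
  have e1 := regionCount_union_ray_le hK.isClosed (p := p) n00 C (fun c hc => (hC c hc).2)
    (fun x _ => hmem x)
  have e2 := regionCount_union_ray_le k1.isClosed (p := p) n01 (insert {p} C) (by
      intro c hc
      rcases Finset.mem_insert.1 hc with rfl | hc
      exacts [convex_singleton p, (hC c hc).2]) (by
      intro x hx
      have : x ∈ ray p (S.leg 0 0) ↔ x = p := ⟨fun h =>
        eq_of_mem_ray_of_not_sameRay (hleg 0) h hx, fun h => h ▸ mem_ray_self _ _⟩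
      simp [hmem, this, or_comm])
  have e3 := regionCount_union_ray_le k2.isClosed (p := q) n10
    (insert (ray p (S.leg 0 0)) (insert (ray p (S.leg 0 1)) C)) (by
      intro c hc
      simp only [Finset.mem_insert] at hc
      rcases hc with rfl | rfl | hc
      exacts [convex_ray _ _, convex_ray _ _, (hC c hc).2]) (by
      intro x hx
      simp [hmem]
      generalize (∃ c ∈ C, x ∈ c) = P
      tauto)
  have e4 := regionCount_union_ray_le k3.isClosed (p := q) n11
    (insert {q} (insert (ray p (S.leg 0 0)) (insert (ray p (S.leg 0 1)) C))) (by
      intro c hc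
      simp only [Finset.mem_insert] at hc
      rcases hc with rfl | rfl | rfl | hc
      exacts [convex_singleton _, convex_ray _ _, convex_ray _ _, (hC c hc).2]) (by
      intro x hx
      have : x ∈ ray q (S.leg 1 0) ↔ x = q := ⟨fun h =>
        eq_of_mem_ray_of_not_sameRay (hleg 1) h hx, fun h => h ▸ mem_ray_self _ _⟩
      simp [hmem, this]
      generalize (∃ c ∈ C, x ∈ c) = P
      tauto)
  have e5 := regionCount_union_segment_le k4.isClosed hpq (insert {q} C) (by
      intro c hc
      rcases Finset.mem_insert.1 hc with rfl | hc
      exacts [convex_singleton q, (hC c hc).2]) (by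
      intro x hx
      have f0 : ∀ j, x ∈ ray p (S.leg 0 j) ↔ x = p := fun j => ⟨fun h =>
        eq_of_mem_ray_of_not_sameRay (h0 j) h (segment_subset_ray _ _ hx),
        fun h => h ▸ mem_ray_self _ _⟩
      have f1 : ∀ j, x ∈ ray q (S.leg 1 j) ↔ x = q := fun j => ⟨fun h =>
        eq_of_mem_ray_of_not_sameRay (h1 j) h (segment_subset_ray' _ _ hx),
        fun h => h ▸ mem_ray_self _ _⟩
      simp [hmem, f0, f1]
      generalize (∃ c ∈ C, x ∈ c) = P
      tauto)
  have c2 := Finset.card_insert_le ({p} : Set Plane) C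
  have c3' := Finset.card_insert_le (ray p (S.leg 0 1)) C
  have c3 := Finset.card_insert_le (ray p (S.leg 0 0)) (insert (ray p (S.leg 0 1)) C)
  have c4 := Finset.card_insert_le ({q} : Set Plane)
    (insert (ray p (S.leg 0 0)) (insert (ray p (S.leg 0 1)) C))
  have c5 := Finset.card_insert_le ({q} : Set Plane) C
  have e : K ∪ S.carrier = K ∪ ray p (S.leg 0 0) ∪ ray p (S.leg 0 1) ∪ ray q (S.leg 1 0) ∪
      ray q (S.leg 1 1) ∪ segment ℝ p q := by
    rw [S.carrier_eq]; simp only [union_assoc, p, q]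
  rw [e]
  refine ⟨k5, e5.trans ?_⟩
  refine (add_le_add (e4.trans (add_le_add (e3.trans (add_le_add (e2.trans (add_le_add e1
    le_rfl)) le_rfl)) le_rfl)) le_rfl).trans ?_
  simp only [add_assoc]
  gcongr
  norm_cast
  omega

/-- In the order of traversal the arms gain at most `N`, `N`, `N + 1`, `N + 2` and `N + 4` regions,
again `5 * N + 7` in all. The three segments start at a node already drawn, which is free; the last
ray pays for its node `d`. -/
theorem FiveChain.Proper.regionCount_union_le {S : FiveChain} (hS : S.Proper) {K : Set Plane}
    {N : ℕ} (hK : IsConvexUnion K N) :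
    IsConvexUnion (K ∪ S.carrier) (N + 5) ∧
      regionCount (K ∪ S.carrier) ≤ regionCount K + (5 * N + 7 : ℕ) := by
  classical
  obtain ⟨s0, s1, s2, s3⟩ := hS
  obtain ⟨C, hN, hC, hKC⟩ := id hK
  have hmem : ∀ x, x ∈ K ↔ ∃ c ∈ C, x ∈ c := fun x => by rw [hKC]; simp
  set a := S.node 0
  set b := S.node 1
  set c := S.node 2
  set d := S.node 3
  have hab : a ≠ b := (sub_ne_zero.1 (ne_zero_of_not_sameRay_right s0)).symm
  have hbc : b ≠ c := (sub_ne_zero.1 (ne_zero_of_not_sameRay_right s1)).symm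
  have hcd : c ≠ d := (sub_ne_zero.1 (ne_zero_of_not_sameRay_right s2)).symm
  have n0 := ne_zero_of_not_sameRay_left s0
  have n1 := ne_zero_of_not_sameRay_right s3
  have k1 := hK.union (isClosed_ray (p := a) n0) (convex_ray _ _)
  have k2 := k1.union (isClosed_segment_plane hab) (convex_segment _ _)
  have k3 := k2.union (isClosed_segment_plane hbc) (convex_segment _ _)
  have k4 := k3.union (isClosed_segment_plane hcd) (convex_segment _ _)
  have k5 := k4.union (isClosed_ray (p := d) n1) (convex_ray _ _)
  have e1 := regionCount_union_ray_le hK.isClosed (p := a) n0 C (fun c hc => (hC c hc).2)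
    (fun x _ => hmem x)
  have e2 := regionCount_union_segment_le k1.isClosed hab C (fun c hc => (hC c hc).2) (by
      intro x hx
      have : x ∈ ray a (S.out 0) ↔ x = a := ⟨fun h =>
        eq_of_mem_ray_of_not_sameRay s0 h (segment_subset_ray _ _ hx),
        fun h => h ▸ mem_ray_self _ _⟩
      simp [hmem, this, or_comm])
  have e3 := regionCount_union_segment_le k2.isClosed hbc (insert (ray a (S.out 0)) C) (by
      intro c hc
      simp only [Finset.mem_insert] at hc
      rcases hc with rfl | hc
      exacts [convex_ray _ _, (hC c hc).2]) (by
      intro x hx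
      have : x ∈ segment ℝ a b ↔ x = b := ⟨fun h =>
        eq_of_mem_ray_of_not_sameRay s1 (segment_subset_ray' _ _ h) (segment_subset_ray _ _ hx),
        fun h => h ▸ right_mem_segment ℝ _ _⟩
      simp [hmem, this]
      generalize (∃ c ∈ C, x ∈ c) = P
      tauto)
  have e4 := regionCount_union_segment_le k3.isClosed hcd
    (insert (ray a (S.out 0)) (insert (segment ℝ a b) C)) (by
      intro c hc
      simp only [Finset.mem_insert] at hc
      rcases hc with rfl | rfl | hc
      exacts [convex_ray _ _, convex_segment _ _, (hC c hc).2]) (by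
      intro x hx
      have : x ∈ segment ℝ b c ↔ x = c := ⟨fun h =>
        eq_of_mem_ray_of_not_sameRay s2 (segment_subset_ray' _ _ h) (segment_subset_ray _ _ hx),
        fun h => h ▸ right_mem_segment ℝ _ _⟩
      simp [hmem, this]
      generalize (∃ c ∈ C, x ∈ c) = P
      tauto)
  have e5 := regionCount_union_ray_le k4.isClosed (p := d) n1
    (insert {d} (insert (ray a (S.out 0)) (insert (segment ℝ a b) (insert (segment ℝ b c) C)))) (by
      intro c hc
      simp only [Finset.mem_insert] at hc
      rcases hc with rfl | rfl | rfl | rfl | hc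
      exacts [convex_singleton _, convex_ray _ _, convex_segment _ _, convex_segment _ _,
        (hC c hc).2]) (by
      intro x hx
      have : x ∈ segment ℝ c d ↔ x = d := ⟨fun h =>
        eq_of_mem_ray_of_not_sameRay s3 (segment_subset_ray' _ _ h) hx,
        fun h => h ▸ right_mem_segment ℝ _ _⟩
      simp [hmem, this]
      generalize (∃ c ∈ C, x ∈ c) = P
      tauto)
  have c3 := Finset.card_insert_le (ray a (S.out 0)) C
  have c4' := Finset.card_insert_le (segment ℝ a b) C
  have c4 := Finset.card_insert_le (ray a (S.out 0)) (insert (segment ℝ a b) C)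
  have c51 := Finset.card_insert_le (segment ℝ b c) C
  have c52 := Finset.card_insert_le (segment ℝ a b) (insert (segment ℝ b c) C)
  have c53 := Finset.card_insert_le (ray a (S.out 0))
    (insert (segment ℝ a b) (insert (segment ℝ b c) C))
  have c54 := Finset.card_insert_le ({d} : Set Plane)
    (insert (ray a (S.out 0)) (insert (segment ℝ a b) (insert (segment ℝ b c) C)))
  have e : K ∪ S.carrier = K ∪ ray a (S.out 0) ∪ segment ℝ a b ∪ segment ℝ b c ∪
      segment ℝ c d ∪ ray d (S.out 1) := by
    rw [S.carrier_eq]; simp only [union_assoc, a, b, c, d]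
  rw [e]
  refine ⟨k5, e5.trans ?_⟩
  refine (add_le_add (e4.trans (add_le_add (e3.trans (add_le_add (e2.trans (add_le_add e1
    le_rfl)) le_rfl)) le_rfl)) le_rfl).trans ?_
  simp only [add_assoc]
  gcongr
  norm_cast
  omega

theorem regionCount_empty : regionCount ∅ = 1 := by
  unfold regionCount
  rw [ENat.card_eq_one_iff_unique]
  have : PreconnectedSpace ↥((∅ : Set Plane)ᶜ) := by
    rw [compl_empty]
    exact Subtype.preconnectedSpace isPreconnected_univ
  have : Nonempty ↥((∅ : Set Plane)ᶜ) := ⟨⟨0, by simp⟩⟩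
  exact ⟨⟨⟨ConnectedComponents.mk (Classical.arbitrary _)⟩, fun a => Subsingleton.elim _ _⟩⟩

/-- The largest number of regions for `n` figures. -/
def maxRegions (n : ℕ) : ℕ := 1 + 7 * n + 25 * n.choose 2

theorem maxRegions_succ (n : ℕ) : maxRegions (n + 1) = maxRegions n + (5 * (5 * n) + 7) := by
  have : (n + 1).choose 2 = n + n.choose 2 := by simp [Nat.choose_succ_succ' n 1]
  unfold maxRegions
  rw [this]
  ring

theorem regionCount_iUnion_le {n : ℕ} (A : Fin n → Set Plane)
    (hA : ∀ i, ∀ (K : Set Plane) (N : ℕ), IsConvexUnion K N → IsConvexUnion (K ∪ A i) (N + 5) ∧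
      regionCount (K ∪ A i) ≤ regionCount K + (5 * N + 7 : ℕ)) :
    IsConvexUnion (⋃ i, A i) (5 * n) ∧ regionCount (⋃ i, A i) ≤ maxRegions n := by
  induction n with
  | zero =>
    simp only [iUnion_of_empty, regionCount_empty]
    exact ⟨isConvexUnion_empty, by simp [maxRegions]⟩
  | succ n ih =>
    obtain ⟨h1, h2⟩ := ih (fun i => A i.castSucc) (fun i => hA i.castSucc)
    have e : ⋃ i, A i = (⋃ i : Fin n, A i.castSucc) ∪ A (Fin.last n) := by
      ext x
      simp only [mem_iUnion, mem_union, Fin.exists_fin_succ']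
    obtain ⟨h3, h4⟩ := hA (Fin.last n) _ _ h1
    rw [e, maxRegions_succ]
    refine ⟨h3, h4.trans ?_⟩
    push_cast
    gcongr

end UpperBound

/-! ### Separating sets, and the cells of an arrangement of lines -/

section LowerBound
open Set Topology Filter

/-- `G` is a union of regions of the complement of `K`, possibly together with points of `K`. -/
def Separates (K G : Set Plane) : Prop := IsOpen G ∧ closure G ⊆ G ∪ K

theorem Separates.mono {K K' G : Set Plane} (h : Separates K G) (hK : K ⊆ K') : Separates K' G :=
  ⟨h.1, h.2.trans (union_subset_union_right _ hK)⟩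

theorem Separates.preimage {K G : Set Plane} (h : Separates K G) {φ : Plane → Plane}
    (hφ : Continuous φ) : Separates (φ ⁻¹' K) (φ ⁻¹' G) :=
  ⟨h.1.preimage hφ, (hφ.closure_preimage_subset G).trans (preimage_mono h.2)⟩

/-- Off `K`, the set `G` is both open and closed, so a connected set that avoids `K` cannot leave
it. -/
theorem Separates.mem_of_connected {K G : Set Plane} (h : Separates K G) {x y : Plane}
    (hx : x ∈ G) (hy : y ∈ connectedComponentIn Kᶜ x) (hxK : x ∉ K) : y ∈ G := by
  have : connectedComponentIn Kᶜ x ⊆ G := by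
    refine IsPreconnected.subset_left_of_subset_union h.1
      (isClosed_closure (s := G)).isOpen_compl
      (disjoint_compl_right.mono_left subset_closure) ?_
      ⟨x, mem_connectedComponentIn hxK, hx⟩ isPreconnected_connectedComponentIn
    intro z hz
    by_cases hc : z ∈ closure G
    · exact (h.2 hc).imp id fun hzK => absurd hzK (connectedComponentIn_subset _ _ hz)
    · exact Or.inr hc
  exact this hy

theorem card_le_regionCount {K : Set Plane} {J : Type} (s : J → Plane) (hs : ∀ j, s j ∉ K)
    (H : ∀ j j', j ≠ j' → ∃ G, Separates K G ∧ ¬ (s j ∈ G ↔ s j' ∈ G)) :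
    ENat.card J ≤ regionCount K := by
  refine ENat.card_le_card_of_injective
    (f := fun j => ConnectedComponents.mk (⟨s j, hs j⟩ : ↥(Kᶜ))) ?_
  intro j j' h
  by_contra hne
  obtain ⟨G, hG, hjj⟩ := H j j' hne
  have h1 := (mk_eq_mk_iff_mem_connectedComponentIn _ _).1 h
  have h2 := (mk_eq_mk_iff_mem_connectedComponentIn _ _).1 h.symm
  exact hjj ⟨fun hj => hG.mem_of_connected hj h1 (hs j), fun hj => hG.mem_of_connected hj h2 (hs j')⟩

/-- Points in different cells of an arrangement of the lines `y = m a * x + c a`, in the strip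
`0 ≤ x ≤ R`: one for each interval cut out on the axis `x = 0` and one for each of the crossings
indexed by `κ`, at which only two lines meet. -/
theorem exists_points_in_cells {ι κ : Type} [Finite ι] (m c : ι → ℝ) (R : ℝ) (hR : 0 ≤ R)
    (hc : Function.Injective c)
    (A B : κ → ι) (X : κ → ℝ) (hAB : ∀ κ₁ κ₂, A κ₁ = A κ₂ → B κ₁ = B κ₂ → κ₁ = κ₂)
    (hm : ∀ j, m (A j) < m (B j)) (hX : ∀ j, 0 < X j ∧ X j < R)
    (hcross : ∀ j, m (A j) * X j + c (A j) = m (B j) * X j + c (B j))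
    (honly : ∀ j a, m a * X j + c a = m (A j) * X j + c (A j) → a = A j ∨ a = B j) :
    ∃ s : Option ι ⊕ κ → Plane,
      (∀ j, 0 ≤ (s j).1 ∧ (s j).1 ≤ R ∧ ∀ a, (s j).2 ≠ m a * (s j).1 + c a) ∧
      ∀ j j', j ≠ j' → ∃ a, ¬ (m a * (s j).1 + c a < (s j).2 ↔ m a * (s j').1 + c a < (s j').2) := by
  -- The sample for `some a` lies just above the intercept `c a`, and the one for `none` below all
  -- intercepts. The lines below the sample pass at or below `z` on the axis and the others at or
  -- above it; for `some a` this is `z = c a`.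
  have hleft : ∀ o : Option ι, ∃ (z : ℝ) (s : Plane), s.1 = 0 ∧ (∀ a, s.2 ≠ c a) ∧
      (∀ a, c a < s.2 → c a ≤ z) ∧ (∀ a, s.2 ≤ c a → z ≤ c a) ∧
      (∀ a, o = some a → z = c a ∧ c a < s.2) ∧ (o = none → ∀ a, s.2 < c a) := by
    rintro (_ | a)
    · obtain ⟨b, hb⟩ := (finite_range c).bddBelow
      have hlt : ∀ a, b - 1 < c a := fun a => by linarith [hb (mem_range_self a)]
      exact ⟨b - 1, (0, b - 1), rfl, fun a => (hlt a).ne, fun a h => h.le, fun a h => h,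
        by simp, fun _ => hlt⟩
    · have hev : ∀ᶠ η : ℝ in 𝓝[>] 0, ∀ b, c a < c b → c a + η < c b := by
        refine eventually_all.2 fun b => ?_
        by_cases h : c a < c b
        · have : ∀ᶠ η : ℝ in 𝓝[>] 0, η < c b - c a :=
            nhdsWithin_le_nhds (eventually_lt_nhds (sub_pos.2 h))
          filter_upwards [this] with η hη _
          linarith
        · exact Eventually.of_forall fun η h' => absurd h' h
      obtain ⟨η, hη, hη0⟩ := (hev.and self_mem_nhdsWithin).exists
      have hη0 : 0 < η := hη0
      refine ⟨c a, (0, c a + η), rfl, ?_, ?_, ?_, ?_, by simp⟩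
      · intro b hb
        simp only at hb
        have := hη b (by linarith)
        linarith
      · intro b hb
        by_contra h
        simp only at hb h
        linarith [hη b (not_le.1 h)]
      · intro b hb
        simp only at hb ⊢
        linarith
      · rintro b hb
        obtain rfl := Option.some_injective _ hb
        exact ⟨rfl, by simp only; linarith⟩
  -- The sample for a crossing lies just to its right, between the two crossing lines, on the line
  -- through the crossing with their mean slope. Lines missing the crossing stay on their side when
  -- the displacement `η` is small.
  have hright : ∀ j : κ, ∃ s : Plane, 0 ≤ s.1 ∧ s.1 ≤ R ∧
      (∀ a, s.2 ≠ m a * s.1 + c a) ∧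
      (∀ a, m a * s.1 + c a < s.2 → m a * X j + c a ≤ m (A j) * X j + c (A j)) ∧
      (∀ a, s.2 ≤ m a * s.1 + c a → m (A j) * X j + c (A j) ≤ m a * X j + c a) ∧
      m (A j) * s.1 + c (A j) < s.2 ∧ s.2 < m (B j) * s.1 + c (B j) := by
    intro j
    set y := m (A j) * X j + c (A j) with hy
    set μ := (m (A j) + m (B j)) / 2 with hμ
    have hev : ∀ᶠ η : ℝ in 𝓝[>] 0, ∀ b,
        (m b * X j + c b < y → m b * (X j + η) + c b < y + μ * η) ∧
        (y < m b * X j + c b → y + μ * η < m b * (X j + η) + c b) := by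
      refine eventually_all.2 fun b => ?_
      have hcont : Tendsto (fun η : ℝ => m b * (X j + η) + c b - (y + μ * η)) (𝓝[>] 0)
          (𝓝 (m b * X j + c b - y)) := by
        have : Continuous fun η : ℝ => m b * (X j + η) + c b - (y + μ * η) := by fun_prop
        have h2 := this.tendsto 0
        simp only [add_zero, mul_zero] at h2
        exact h2.mono_left nhdsWithin_le_nhds
      rcases lt_trichotomy (m b * X j + c b) y with h | h | h
      · filter_upwards [hcont.eventually_lt_const (sub_neg.2 h)] with η hη
        exact ⟨fun _ => by linarith, fun h' => absurd h' (not_lt.2 h.le)⟩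
      · exact Eventually.of_forall fun η => ⟨fun h' => absurd h h'.ne, fun h' => absurd h h'.ne'⟩
      · filter_upwards [hcont.eventually_const_lt (sub_pos.2 h)] with η hη
        exact ⟨fun h' => absurd h' (not_lt.2 h.le), fun _ => by linarith⟩
    have hevR : ∀ᶠ η : ℝ in 𝓝[>] 0, η < R - X j :=
      nhdsWithin_le_nhds (eventually_lt_nhds (sub_pos.2 (hX j).2))
    obtain ⟨η, ⟨hη, hηR⟩, hη0⟩ := ((hev.and hevR).and self_mem_nhdsWithin).exists
    have hη0 : 0 < η := hη0
    have hA : m (A j) * (X j + η) + c (A j) < y + μ * η := by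
      have : 0 < (m (B j) - m (A j)) / 2 * η := by
        have := hm j
        have : 0 < (m (B j) - m (A j)) / 2 := by linarith
        positivity
      rw [hμ, hy]; linarith
    have hB : y + μ * η < m (B j) * (X j + η) + c (B j) := by
      have : 0 < (m (B j) - m (A j)) / 2 * η := by
        have := hm j
        have : 0 < (m (B j) - m (A j)) / 2 := by linarith
        positivity
      rw [hμ, hy, hcross j]; linarith
    refine ⟨(X j + η, y + μ * η), by simp only; linarith [(hX j).1], by simp only; linarith,
      ?_, ?_, ?_, hA, hB⟩
    · intro b hb
      simp only at hb
      rcases lt_trichotomy (m b * X j + c b) y with h | h | h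
      · exact absurd hb ((hη b).1 h).ne'
      · rcases honly j b h with rfl | rfl
        · exact absurd hb hA.ne'
        · exact absurd hb hB.ne
      · exact absurd hb ((hη b).2 h).ne
    · intro b hb
      by_contra h
      exact absurd hb (not_lt.2 ((hη b).2 (not_le.1 h)).le)
    · intro b hb
      by_contra h
      exact absurd hb (not_le.2 ((hη b).1 (not_le.1 h)))
  choose zl sl hl2 hl3 hl4 hl5 hl6 hl7 using hleft
  choose sr hr1 hr2 hr3 hr4 hr5 hr6 hr7 using hright
  -- The steeper line `B j` is above `A j` only to the right of their crossing. Hence a cell above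
  -- `A j` and below `B j` has the crossing as its leftmost point, and distinct crossings belong to
  -- distinct cells.
  have hpos : ∀ j x, 0 ≤ (m (B j) - m (A j)) * (x - X j) → X j ≤ x := by
    intro j x h
    by_contra hlt
    have := mul_neg_of_pos_of_neg (sub_pos.2 (hm j)) (sub_neg.2 (not_le.1 hlt))
    linarith
  -- Were the two samples in one cell, `A j` would pass at or below `z` and `B j` at or above it on
  -- the axis, putting the crossing at `X j ≤ 0`.
  have hLR : ∀ o j, ∃ a, ¬ (m a * (sl o).1 + c a < (sl o).2 ↔
      m a * (sr j).1 + c a < (sr j).2) := by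
    intro o j
    by_contra! h
    simp only [hl2, mul_zero, zero_add] at h
    have h1 := hl4 o (A j) ((h (A j)).2 (hr6 j))
    have h2 := hl5 o (B j) (not_lt.1 fun h' => absurd ((h (B j)).1 h') (not_lt.2 (hr7 j).le))
    have := hpos j 0 (by linarith [hcross j])
    linarith [(hX j).1]
  have hRR : ∀ j j', (∀ a, (m a * (sr j).1 + c a < (sr j).2 ↔
      m a * (sr j').1 + c a < (sr j').2)) →
      m (A j) * X j' + c (A j) ≤ m (A j') * X j' + c (A j') ∧
      m (A j') * X j' + c (A j') ≤ m (B j) * X j' + c (B j) := by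
    intro j j' h
    exact ⟨hr4 j' (A j) ((h _).1 (hr6 j)), hr5 j' (B j)
      (not_lt.1 fun h' => absurd ((h _).2 h') (not_lt.2 (hr7 j).le))⟩
  refine ⟨Sum.elim sl sr, ?_, ?_⟩
  · rintro (o | j)
    · refine ⟨(hl2 o).ge, (hl2 o).trans_le hR, fun a => ?_⟩
      simp only [Sum.elim_inl, hl2, mul_zero, zero_add]
      exact hl3 o a
    · exact ⟨hr1 j, hr2 j, hr3 j⟩
  · rintro (o | j) (o' | j') hne
    · simp only [Sum.elim_inl, hl2, mul_zero, zero_add]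
      rcases o with _ | a <;> rcases o' with _ | a'
      · exact absurd rfl hne
      · exact ⟨a', fun h => absurd (h.2 (hl6 _ a' rfl).2) (not_lt.2 (hl7 _ rfl a').le)⟩
      · exact ⟨a, fun h => absurd (h.1 (hl6 _ a rfl).2) (not_lt.2 (hl7 _ rfl a).le)⟩
      · by_contra! h
        have h1 := hl4 _ _ ((h a).1 (hl6 _ a rfl).2)
        have h2 := hl4 _ _ ((h a').2 (hl6 _ a' rfl).2)
        rw [(hl6 _ _ rfl).1] at h1 h2
        exact hne (by rw [hc (le_antisymm h1 h2)])
    · exact hLR o j'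
    · obtain ⟨a, ha⟩ := hLR o' j
      exact ⟨a, fun h => ha h.symm⟩
    · by_contra! h
      have h1 := hRR j j' h
      have h2 := hRR j' j fun a => (h a).symm
      -- Without a separating line each crossing lies in the closed wedge to the right of the other.
      -- So the two crossings coincide, and by `honly` they are crossings of the same two lines.
      have e1 := hpos j (X j') (by linarith [hcross j])
      have e2 := hpos j' (X j) (by linarith [hcross j'])
      have e := le_antisymm e1 e2
      rw [← e] at h1
      have hy : m (A j') * X j + c (A j') = m (A j) * X j + c (A j) := by
        linarith [hcross j, hcross j']
      have hyB : m (B j') * X j + c (B j') = m (A j) * X j + c (A j) := by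
        have := hcross j'
        rw [← e] at this
        linarith
      refine hne (congrArg Sum.inr (hAB j j' ?_ ?_))
      · rcases honly j _ hy with h3 | h3
        · exact h3.symm
        · rcases honly j _ hyB with h4 | h4
          · have := hm j'
            rw [h3, h4] at this
            linarith [hm j]
          · have := hm j'
            rw [h3, h4] at this
            exact absurd this (lt_irrefl _)
      · rcases honly j _ hyB with h3 | h3
        · rcases honly j _ hy with h4 | h4
          · have := hm j'
            rw [h3, h4] at this
            exact absurd this (lt_irrefl _)
          · have := hm j'
            rw [h3, h4] at this
            linarith [hm j]
        · exact h3.symm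

end LowerBound

/-! ### Arranging copies of a figure that looks like five lines -/

section StripModel
open Set Topology Filter

/-- Sample points in the two regions of a figure that do not meet the strip `|x| ≤ 1/10`. -/
noncomputable def pocketPoint : Fin 2 → Plane := ![(4 / 5, 1 / 2), (-1 / 2, 7 / 2)]

/-- A figure that consists of five nonintersecting lines within the strip `|x| ≤ 1/10`, with sets
separating the six parts of the strip from each other and from two further regions. -/
structure StripModel where
  carrier : Set Plane
  slope : Fin 5 → ℝ
  height : Fin 5 → ℝ
  cell : Fin 5 → Set Plane
  pocket : Fin 2 → Set Plane
  mem_carrier_iff : ∀ z : Plane, |z.1| ≤ 1 / 10 →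
    (z ∈ carrier ↔ ∃ k, z.2 = slope k * z.1 + height k)
  exists_of_mem_carrier : ∀ z ∈ carrier, ∃ k, z.2 = slope k * z.1 + height k
  strictMono : ∀ x, |x| ≤ 1 / 10 → StrictMono fun k => slope k * x + height k
  abs_slope_le : ∀ k, |slope k| ≤ 4
  height_nonneg : ∀ k, 0 ≤ height k
  height_le : ∀ k, height k ≤ 9 / 2
  abs_snd_le : ∀ z ∈ carrier, |z.1| ≤ 1 → |z.2| ≤ 10
  separates_cell : ∀ k, Separates carrier (cell k)
  mem_cell_iff : ∀ k, ∀ z : Plane, |z.1| ≤ 1 / 10 →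
    (z ∈ cell k ↔ slope k * z.1 + height k < z.2 ∧ ∀ l, k < l → z.2 < slope l * z.1 + height l)
  separates_pocket : ∀ m, Separates carrier (pocket m)
  pocketPoint_mem : ∀ m, pocketPoint m ∈ pocket m
  pocketPoint_notMem : ∀ m, pocketPoint m ∉ carrier
  eq_of_mem_pocket : ∀ m m', ∀ z ∈ pocket m, z.1 = (pocketPoint m').1 → m = m' ∧ |z.2| ≤ 10
  lt_abs_of_mem_pocket : ∀ m, ∀ z ∈ pocket m, 1 / 10 < |z.1|

/-- The coordinates in which the figure with number `i` of the arrangement is the model. -/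
noncomputable def frame (M : ℝ) (i : ℕ) (z : Plane) : Plane :=
  (z.1 / M, 100 * (z.2 - i * z.1 + i ^ 2))

/-- The inverse of `frame`. It carries the horizontal axis of the model to the line `y = i * x - i ^
2`, a tangent of the parabola `4 * y = x ^ 2`. The tangents number `i` and `j` meet at `x = i + j`,
so no three of them are concurrent. -/
noncomputable def unframe (M : ℝ) (i : ℕ) (z : Plane) : Plane :=
  (M * z.1, i * (M * z.1) - i ^ 2 + z.2 / 100)

theorem frame_unframe {M : ℝ} (hM : 0 < M) (i : ℕ) (z : Plane) : frame M i (unframe M i z) = z := by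
  have := hM.ne'
  ext
  · simp only [frame, unframe]; field_simp
  · simp only [frame, unframe]; ring

theorem unframe_frame {M : ℝ} (hM : 0 < M) (i : ℕ) (z : Plane) : unframe M i (frame M i z) = z := by
  have := hM.ne'
  ext
  · simp only [frame, unframe]; field_simp
  · simp only [frame, unframe]; field_simp; ring

theorem continuous_frame (M : ℝ) (i : ℕ) : Continuous (frame M i) := by
  unfold frame
  fun_prop

namespace StripModel

variable (S : StripModel)

/-- The union of the cells above the line `k`. -/
def above (k : Fin 5) : Set Plane := ⋃ m : {m // k ≤ m}, S.cell m

theorem separates_above (k : Fin 5) : Separates S.carrier (S.above k) := by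
  refine ⟨isOpen_iUnion fun m => (S.separates_cell m).1, ?_⟩
  rw [above, closure_iUnion_of_finite]
  refine iUnion_subset fun m => (S.separates_cell m).2.trans ?_
  exact union_subset_union_left _ (subset_iUnion (fun m : {m // k ≤ m} => S.cell m) m)

theorem mem_above_iff (k : Fin 5) (z : Plane) (hz : |z.1| ≤ 1 / 10) (hzK : z ∉ S.carrier) :
    z ∈ S.above k ↔ S.slope k * z.1 + S.height k < z.2 := by
  classical
  simp only [above, mem_iUnion, S.mem_cell_iff _ z hz, Subtype.exists, exists_prop]
  constructor
  · rintro ⟨m, hkm, h, -⟩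
    exact ((S.strictMono _ hz).monotone hkm).trans_lt h
  · intro h
    let s : Finset (Fin 5) := Finset.univ.filter fun m => S.slope m * z.1 + S.height m < z.2
    have hk : k ∈ s := by simpa [s] using h
    -- The cell containing `z` is the one above the highest of the lines that pass below `z`.
    refine ⟨s.max' ⟨k, hk⟩, s.le_max' k hk, ?_, fun l hl => ?_⟩
    · have := s.max'_mem ⟨k, hk⟩
      simpa [s] using this
    · by_contra hc
      rcases (not_lt.1 hc).lt_or_eq with h1 | h1
      · exact absurd hl (not_lt.2 (s.le_max' l (by simpa [s] using h1)))
      · exact hzK ((S.mem_carrier_iff z hz).2 ⟨l, h1.symm⟩)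

/-- The slope of the line `k` of the figure `i`. -/
noncomputable def lineSlope (M : ℝ) (a : ℕ × Fin 5) : ℝ := a.1 + S.slope a.2 / (100 * M)

/-- The intercept of the line `k` of the figure `i`. -/
noncomputable def lineHeight (a : ℕ × Fin 5) : ℝ := -(a.1 : ℝ) ^ 2 + S.height a.2 / 100

theorem frame_snd_eq_iff {M : ℝ} (hM : 0 < M) (i : ℕ) (k : Fin 5) (z : Plane) :
    (frame M i z).2 = S.slope k * (frame M i z).1 + S.height k ↔
      z.2 = S.lineSlope M (i, k) * z.1 + S.lineHeight (i, k) := by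
  have := hM.ne'
  simp only [frame, lineSlope, lineHeight]
  constructor
  · intro h
    field_simp at h ⊢
    linarith
  · intro h
    rw [h]
    field_simp
    ring

theorem lt_frame_snd_iff {M : ℝ} (hM : 0 < M) (i : ℕ) (k : Fin 5) (z : Plane) :
    S.slope k * (frame M i z).1 + S.height k < (frame M i z).2 ↔
      S.lineSlope M (i, k) * z.1 + S.lineHeight (i, k) < z.2 := by
  have := hM.ne'
  have e : (frame M i z).2 - (S.slope k * (frame M i z).1 + S.height k) =
      100 * (z.2 - (S.lineSlope M (i, k) * z.1 + S.lineHeight (i, k))) := by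
    simp only [frame, lineSlope, lineHeight]
    field_simp
    ring
  constructor <;> intro h <;> linarith

theorem strictMono_line {M : ℝ} (hM : 0 < M) (i : ℕ) {x : ℝ} (hx : |x| ≤ M / 10) :
    StrictMono fun k => S.lineSlope M (i, k) * x + S.lineHeight (i, k) := by
  have hx' : |x / M| ≤ 1 / 10 := by
    rw [abs_div, abs_of_pos hM, div_le_iff₀ hM]
    linarith
  intro k l hkl
  have h := S.strictMono _ hx' hkl
  have e : ∀ k, S.lineSlope M (i, k) * x + S.lineHeight (i, k) =
      i * x - i ^ 2 + (S.slope k * (x / M) + S.height k) / 100 := by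
    intro k
    have := hM.ne'
    simp only [lineSlope, lineHeight]
    field_simp
    ring
  simp only [e] at h ⊢
  linarith

/-- Lines of different figures `i` and `j` cross close to `x = i + j`. -/
theorem abs_crossing_sub_le {M : ℝ} {n : ℕ} (hM : M = 40 * (n + 1)) {i j : ℕ} (hi : i ≤ n)
    (hj : j ≤ n) (hij : i ≠ j) (k l : Fin 5) {x : ℝ}
    (hx : S.lineSlope M (i, k) * x + S.lineHeight (i, k) =
      S.lineSlope M (j, l) * x + S.lineHeight (j, l)) : |x - (i + j)| ≤ 1 / 10 := by
  wlog hlt : i < j generalizing i j k l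
  · rw [add_comm]
    exact this hj hi hij.symm l k hx.symm (by omega)
  have hn : (0 : ℝ) ≤ n := Nat.cast_nonneg n
  have hi' : (i : ℝ) ≤ n := Nat.cast_le.2 hi
  have hj' : (j : ℝ) ≤ n := Nat.cast_le.2 hj
  have hi0 : (0 : ℝ) ≤ i := Nat.cast_nonneg i
  have hj0 : (0 : ℝ) ≤ j := Nat.cast_nonneg j
  have hd : (i : ℝ) + 1 ≤ j := by exact_mod_cast hlt
  have hM0 : 0 < M := by rw [hM]; positivity
  set δ := (S.slope l - S.slope k) / (100 * M) with hδ
  have hδb : |δ| * M ≤ 8 / 100 := by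
    have h1 := (abs_sub (S.slope l) (S.slope k)).trans
      (add_le_add (S.abs_slope_le l) (S.abs_slope_le k))
    rw [hδ, abs_div, abs_of_pos (by positivity : 0 < 100 * M), div_mul_eq_mul_div,
      div_le_iff₀ (by positivity)]
    nlinarith
  have hδ40 : |δ| * 40 * (n + 1) ≤ 8 / 100 := by rw [hM] at hδb; linarith
  have h0 := abs_nonneg δ
  have hδn : 0 ≤ |δ| * n := by positivity
  have hδ1 : |δ| ≤ 1 / 100 := by nlinarith
  have hδs : |δ * (i + j)| ≤ 4 / 1000 := by
    rw [abs_mul, abs_of_nonneg (by positivity : (0 : ℝ) ≤ i + j)]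
    have : |δ| * (i + j) ≤ |δ| * (2 * n) := by gcongr; linarith
    nlinarith
  -- For the exact tangents the right side would be `0`. The heights contribute at most `0.045` and
  -- the slopes at most `0.004`, while the factor `(j - i) + δ` is at least `0.99`.
  have key : (x - (i + j)) * ((j - i) + δ) =
      -((S.height l - S.height k) / 100 + δ * (i + j)) := by
    have : (S.lineSlope M (j, l) - S.lineSlope M (i, k)) * x =
      S.lineHeight (i, k) - S.lineHeight (j, l) := by linarith
    have e : S.lineSlope M (j, l) - S.lineSlope M (i, k) = (j - i) + δ := by
      simp only [lineSlope, hδ]; ring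
    rw [e] at this
    simp only [lineHeight] at this
    linear_combination this
  have hnum : |(x - (i + j)) * ((j - i) + δ)| ≤ 49 / 1000 := by
    rw [key, abs_neg]
    refine (abs_add_le _ _).trans ?_
    have : |(S.height l - S.height k) / 100| ≤ 45 / 1000 := by
      rw [abs_le]
      constructor <;> linarith [S.height_nonneg l, S.height_nonneg k, S.height_le l, S.height_le k]
    linarith
  have hD : 99 / 100 ≤ |(j : ℝ) - i + δ| :=
    le_trans (by linarith [neg_abs_le δ]) (le_abs_self _)
  rw [abs_mul] at hnum
  nlinarith [abs_nonneg (x - (i + j))]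

theorem lineSlope_lt {M : ℝ} {n : ℕ} (hM : M = 40 * (n + 1)) {i j : ℕ} (hij : i < j)
    (k l : Fin 5) : S.lineSlope M (i, k) < S.lineSlope M (j, l) := by
  have hn : (0 : ℝ) ≤ n := Nat.cast_nonneg n
  have hd : (i : ℝ) + 1 ≤ j := by exact_mod_cast hij
  have hM0 : 40 ≤ M := by rw [hM]; linarith
  have h1 := abs_le.1 (S.abs_slope_le k)
  have h2 := abs_le.1 (S.abs_slope_le l)
  have h3 : S.slope k / (100 * M) ≤ 1 / 10 := by
    rw [div_le_iff₀ (by positivity)]; linarith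
  have h4 : -(1 / 10) ≤ S.slope l / (100 * M) := by
    rw [le_div_iff₀ (by positivity)]; linarith
  simp only [lineSlope]
  linarith

/-- The abscissa of the crossing of two lines. -/
noncomputable def crossing (M : ℝ) (a b : ℕ × Fin 5) : ℝ :=
  (S.lineHeight a - S.lineHeight b) / (S.lineSlope M b - S.lineSlope M a)

theorem crossing_spec {M : ℝ} {n : ℕ} (hM : M = 40 * (n + 1)) {i j : ℕ} (hij : i < j)
    (k l : Fin 5) (x : ℝ) : S.lineSlope M (i, k) * x + S.lineHeight (i, k) =
      S.lineSlope M (j, l) * x + S.lineHeight (j, l) ↔ x = S.crossing M (i, k) (j, l) := by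
  have h := sub_pos.2 (S.lineSlope_lt hM hij k l)
  rw [crossing, eq_div_iff h.ne']
  constructor <;> intro h <;> linarith

theorem crossing_bounds {M : ℝ} {n : ℕ} (hM : M = 40 * (n + 1)) {i j : ℕ} (hj : j ≤ n)
    (hij : i < j) (k l : Fin 5) :
    0 < S.crossing M (i, k) (j, l) ∧ S.crossing M (i, k) (j, l) < M / 10 := by
  have h := abs_le.1 (S.abs_crossing_sub_le hM (hij.le.trans hj) hj hij.ne k l
    ((S.crossing_spec hM hij k l _).2 rfl))
  have hi0 : (0 : ℝ) ≤ i := Nat.cast_nonneg i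
  have hd : (i : ℝ) + 1 ≤ j := by exact_mod_cast hij
  have hj' : (j : ℝ) ≤ n := Nat.cast_le.2 hj
  constructor <;> linarith

theorem mem_preimage_carrier_iff {M : ℝ} (hM : 0 < M) (i : ℕ) {z : Plane} (hz : |z.1| ≤ M / 10) :
    z ∈ frame M i ⁻¹' S.carrier ↔
      ∃ k, z.2 = S.lineSlope M (i, k) * z.1 + S.lineHeight (i, k) := by
  have hx' : |(frame M i z).1| ≤ 1 / 10 := by
    simp only [frame]
    rw [abs_div, abs_of_pos hM, div_le_iff₀ hM]
    linarith
  rw [mem_preimage, S.mem_carrier_iff _ hx']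
  simp only [S.frame_snd_eq_iff hM]

/-- Every point of a figure lies on one of its five lines, and all 25 crossings of lines of the two
figures fall within the strip, where the figures contain these lines. The scale `120` is `40 * (n +
1)` for `n = 2`. -/
theorem encard_inter_eq :
    (frame 120 0 ⁻¹' S.carrier ∩ frame 120 1 ⁻¹' S.carrier).encard = 25 := by
  have hM : (120 : ℝ) = 40 * ((2 : ℕ) + 1) := by norm_num
  let f : Fin 5 × Fin 5 → Plane := fun a => (S.crossing 120 (0, a.1) (1, a.2),
    S.lineSlope 120 (0, a.1) * S.crossing 120 (0, a.1) (1, a.2) + S.lineHeight (0, a.1))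
  have hb : ∀ a, |(f a).1| ≤ 120 / 10 := by
    intro a
    have h := S.crossing_bounds hM (i := 0) (j := 1) (by norm_num) one_pos a.1 a.2
    exact abs_le.2 ⟨by linarith [h.1], h.2.le⟩
  have hf0 : ∀ a, (f a).2 = S.lineSlope 120 (0, a.1) * (f a).1 + S.lineHeight (0, a.1) :=
    fun a => rfl
  have hf1 : ∀ a, (f a).2 = S.lineSlope 120 (1, a.2) * (f a).1 + S.lineHeight (1, a.2) :=
    fun a => (S.crossing_spec hM one_pos a.1 a.2 _).2 rfl
  have hrange : frame 120 0 ⁻¹' S.carrier ∩ frame 120 1 ⁻¹' S.carrier = range f := by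
    apply subset_antisymm
    · rintro z ⟨h0, h1⟩
      obtain ⟨k, hk⟩ := S.exists_of_mem_carrier _ h0
      obtain ⟨l, hl⟩ := S.exists_of_mem_carrier _ h1
      rw [S.frame_snd_eq_iff (by norm_num)] at hk hl
      have hx := (S.crossing_spec hM one_pos k l z.1).1 (hk.symm.trans hl)
      refine ⟨(k, l), Prod.ext hx.symm ?_⟩
      rw [hk, hx]
    · rintro _ ⟨a, rfl⟩
      exact ⟨(S.mem_preimage_carrier_iff (by norm_num) 0 (hb a)).2 ⟨a.1, hf0 a⟩,
        (S.mem_preimage_carrier_iff (by norm_num) 1 (hb a)).2 ⟨a.2, hf1 a⟩⟩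
  have hinj : Function.Injective f := by
    intro a b hab
    have h0 := hf0 a
    have h1 := hf1 a
    rw [hab, hf0 b] at h0
    rw [hab, hf1 b] at h1
    exact Prod.ext ((S.strictMono_line (by norm_num) 0 (hb b)).injective h0.symm)
      ((S.strictMono_line (by norm_num) 1 (hb b)).injective h1.symm)
  rw [hrange, ← image_univ, hinj.encard_image, encard_univ, ENat.card_eq_coe_fintype_card]
  simp

/-- The set of pairs of indices. -/
abbrev IndexPair (n : ℕ) : Type := Σ j : Fin n, Fin j

theorem card_indexPair (n : ℕ) : Fintype.card (IndexPair n) = n.choose 2 := by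
  simp only [Fintype.card_sigma, Fintype.card_fin]
  rw [Fin.sum_univ_eq_sum_range (fun i => i), Finset.sum_range_id, Nat.choose_two_right]

theorem unframe_frame_snd {M : ℝ} (i j : ℕ) (z : Plane) :
    (frame M j (unframe M i z)).2 = 100 * ((i - j) * (M * z.1 - (i + j))) + z.2 := by
  simp only [frame, unframe]
  ring

/-- The pocket points have abscissas `32 * (n + 1)` and `-20 * (n + 1)`, far from every crossing `i
+ j`. There the tangents are so far apart that, in the frame of another figure, the point has height
at least `100 - 7 / 2` in absolute value. -/
theorem eq_of_abs_frame_le {M : ℝ} {n : ℕ} (hM : M = 40 * (n + 1)) {i j : ℕ} (hi : i ≤ n)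
    (hj : j ≤ n) (m : Fin 2) (h : |(frame M j (unframe M i (pocketPoint m))).2| ≤ 10) : i = j := by
  by_contra hij
  have hn : (0 : ℝ) ≤ n := Nat.cast_nonneg n
  have hi' : (i : ℝ) ≤ n := Nat.cast_le.2 hi
  have hj' : (j : ℝ) ≤ n := Nat.cast_le.2 hj
  have hi0 : (0 : ℝ) ≤ i := Nat.cast_nonneg i
  have hj0 : (0 : ℝ) ≤ j := Nat.cast_nonneg j
  rw [unframe_frame_snd] at h
  have h1 : 1 ≤ |(i : ℝ) - j| := by
    have : (1 : ℤ) ≤ |(i : ℤ) - j| := Int.one_le_abs (by omega)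
    exact_mod_cast this
  have h2 : 1 ≤ |M * (pocketPoint m).1 - (i + j)| := by
    rw [hM]
    fin_cases m
    · refine le_trans ?_ (le_abs_self _)
      simp [pocketPoint]; linarith
    · refine le_trans ?_ (neg_le_abs _)
      simp [pocketPoint]; linarith
  have h3 : 1 ≤ |((i : ℝ) - j) * (M * (pocketPoint m).1 - (i + j))| := by
    rw [abs_mul]
    nlinarith
  have h4 : |(pocketPoint m).2| ≤ 7 / 2 := by
    fin_cases m <;> simp [pocketPoint, abs_le] <;> norm_num
  have h5 := abs_sub_abs_le_abs_sub (100 * (((i : ℝ) - j) * (M * (pocketPoint m).1 - (i + j))))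
    (-(pocketPoint m).2)
  rw [sub_neg_eq_add, abs_neg, abs_mul, abs_of_pos (by norm_num : (0 : ℝ) < 100)] at h5
  linarith

/-- The samples are `1 + 5 * n` points on the vertical axis, one point at each of the `25 * n.choose
2` crossings of lines, and `2 * n` pocket points. The first two kinds lie in the strip, where
figures and lines agree, and are told apart by the sets `above`; the pocket sets isolate the others.
-/
theorem maxRegions_le_regionCount (n : ℕ) :
    (maxRegions n : ℕ∞) ≤
      regionCount (⋃ i : Fin n, frame (40 * (n + 1)) i ⁻¹' S.carrier) := by
  set M : ℝ := 40 * (n + 1) with hM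
  have hM0 : 0 < M := by positivity
  have hM10 : M / 10 / M = 1 / 10 := by field_simp
  let κ := IndexPair n × Fin 5 × Fin 5
  let A : κ → Fin n × Fin 5 := fun j => (⟨j.1.2, j.1.2.2.trans j.1.1.2⟩, j.2.1)
  let B : κ → Fin n × Fin 5 := fun j => (j.1.1, j.2.2)
  let e : Fin n × Fin 5 → ℕ × Fin 5 := fun a => (a.1, a.2)
  have hlt : ∀ j : κ, ((A j).1 : ℕ) < (B j).1 := fun j => j.1.2.2
  obtain ⟨s, hs1, hs2⟩ := exists_points_in_cells (fun a => S.lineSlope M (e a))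
    (fun a => S.lineHeight (e a)) (M / 10) (by positivity) (by
      intro a b hab
      simp only [lineHeight] at hab
      -- Intercepts of different figures differ: the squares are distinct integers and the heights,
      -- divided by 100, are less than 1.
      have h1 : a.1 = b.1 := by
        by_contra hne
        have hne' : (a.1 : ℕ) ≠ b.1 := fun h => hne (Fin.ext h)
        have h2 : (((a.1 : ℕ) : ℝ) ^ 2 - ((b.1 : ℕ) : ℝ) ^ 2) =
          (S.height a.2 - S.height b.2) / 100 := by
          simp only [e] at hab; linarith
        have h3 : |(((a.1 : ℕ) : ℝ) ^ 2 - ((b.1 : ℕ) : ℝ) ^ 2)| < 1 := by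
          rw [h2, abs_lt]
          constructor <;> linarith [S.height_nonneg a.2, S.height_nonneg b.2, S.height_le a.2,
            S.height_le b.2]
        have h4 : |((a.1 : ℕ) : ℤ) ^ 2 - ((b.1 : ℕ) : ℤ) ^ 2| < 1 := by exact_mod_cast h3
        have h5 := sub_eq_zero.1 (Int.abs_lt_one_iff.1 h4)
        exact hne' (Nat.pow_left_injective two_ne_zero (by exact_mod_cast h5))
      refine Prod.ext h1 ((S.strictMono_line hM0 (a.1 : ℕ) (x := 0) (by simp; positivity)).injective
        ?_)
      simp only [mul_zero, zero_add, lineHeight]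
      simp only [e] at hab
      rw [h1] at hab ⊢
      exact hab)
    A B (fun j => S.crossing M (e (A j)) (e (B j))) (by
      rintro ⟨⟨j, i⟩, k, l⟩ ⟨⟨j', i'⟩, k', l'⟩ h1 h2
      simp only [A, B, Prod.mk.injEq, Fin.mk.injEq] at h1 h2
      obtain ⟨h1, rfl⟩ := h1
      obtain ⟨rfl, rfl⟩ := h2
      obtain rfl := Fin.ext h1
      rfl)
    (fun j => S.lineSlope_lt hM (hlt j) _ _)
    (fun j => S.crossing_bounds hM (B j).1.2.le (hlt j) _ _)
    (fun j => (S.crossing_spec hM (hlt j) _ _ _).2 rfl) (by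
      intro j a h
      have hb := S.crossing_bounds hM (B j).1.2.le (hlt j) (A j).2 (B j).2
      have hb' : |S.crossing M (e (A j)) (e (B j))| ≤ M / 10 :=
        abs_le.2 ⟨by linarith [hb.1], hb.2.le⟩
      have hAB := (S.crossing_spec hM (hlt j) (A j).2 (B j).2 _).2 rfl
      by_cases hA : a.1 = (A j).1
      · left
        refine Prod.ext hA ((S.strictMono_line hM0 (A j).1 hb').injective ?_)
        simp only [e] at h ⊢
        rw [hA] at h
        exact h
      by_cases hB : a.1 = (B j).1
      · right
        refine Prod.ext hB ((S.strictMono_line hM0 (B j).1 hb').injective ?_)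
        simp only [e] at h ⊢
        rw [hB] at h
        exact h.trans hAB
      exfalso
      have c1 := S.abs_crossing_sub_le hM (A j).1.2.le (B j).1.2.le (hlt j).ne _ _ hAB
      have c2 := S.abs_crossing_sub_le hM a.1.2.le (A j).1.2.le
        (fun h => hA (Fin.ext h)) _ _ h
      -- A third line through the crossing would give `i + j` and `i + k` within `1 / 10` of the
      -- same abscissa, so `j` and `k` would differ by less than 1.
      have c3 : |((a.1 : ℕ) : ℝ) - ((B j).1 : ℕ)| < 1 := by
        rw [abs_le] at c1 c2
        rw [abs_lt]
        constructor <;> linarith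
      have c4 : |((a.1 : ℕ) : ℤ) - ((B j).1 : ℕ)| < 1 := by exact_mod_cast c3
      have c5 := sub_eq_zero.1 (Int.abs_lt_one_iff.1 c4)
      exact hB (Fin.ext (by exact_mod_cast c5)))
  set K := ⋃ i : Fin n, frame M i ⁻¹' S.carrier with hK
  have hsub : ∀ i : Fin n, frame M i ⁻¹' S.carrier ⊆ K := fun i => subset_iUnion_of_subset i le_rfl
  have hstrip : ∀ j, |(s j).1| ≤ M / 10 := fun j =>
    abs_le.2 ⟨by linarith [(hs1 j).1], (hs1 j).2.1⟩
  have hstrip' : ∀ j (i : ℕ), |(frame M i (s j)).1| ≤ 1 / 10 := fun j i => by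
    simp only [frame]
    rw [abs_div, abs_of_pos hM0, div_le_iff₀ hM0]
    linarith [hstrip j]
  have hsK : ∀ j, ∀ i : Fin n, s j ∉ frame M i ⁻¹' S.carrier := by
    intro j i h
    obtain ⟨k, hk⟩ := (S.mem_preimage_carrier_iff hM0 i (hstrip j)).1 h
    exact (hs1 j).2.2 (i, k) hk
  let t : (Option (Fin n × Fin 5) ⊕ κ) ⊕ (Fin n × Fin 2) → Plane :=
    Sum.elim s fun a => unframe M a.1 (pocketPoint a.2)
  have hpK : ∀ a : Fin n × Fin 2, ∀ i : Fin n,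
      unframe M a.1 (pocketPoint a.2) ∉ frame M i ⁻¹' S.carrier := by
    intro a i h
    have h1 : (frame M i (unframe M a.1 (pocketPoint a.2))).1 = (pocketPoint a.2).1 := by
      simp only [frame, unframe]; field_simp
    have h2 := S.abs_snd_le _ h (by
      rw [h1]
      generalize a.2 = m
      fin_cases m <;> simp [pocketPoint, abs_le] <;> norm_num)
    have h3 := eq_of_abs_frame_le hM a.1.2.le i.2.le _ h2
    rw [mem_preimage, ← h3, frame_unframe hM0] at h
    exact S.pocketPoint_notMem _ h
  have hpocket : ∀ j (a : Fin n × Fin 2), ∃ G, Separates K G ∧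
      ¬ (s j ∈ G ↔ unframe M a.1 (pocketPoint a.2) ∈ G) := by
    intro j a
    refine ⟨frame M a.1 ⁻¹' S.pocket a.2,
      ((S.separates_pocket a.2).preimage (continuous_frame M a.1)).mono (hsub a.1), fun h => ?_⟩
    have h1 := h.2 (by
      rw [mem_preimage, frame_unframe hM0]
      exact S.pocketPoint_mem _)
    exact absurd (S.lt_abs_of_mem_pocket _ _ h1) (not_lt.2 (hstrip' j _))
  have key := card_le_regionCount (K := K) t (by
    rintro (j | a) h
    · obtain ⟨i, hi⟩ := mem_iUnion.1 h
      exact hsK j i hi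
    · obtain ⟨i, hi⟩ := mem_iUnion.1 h
      exact hpK a i hi) (by
    rintro (j | a) (j' | a') hne
    · obtain ⟨⟨i, k⟩, h⟩ := hs2 j j' (fun h => hne (congrArg _ h))
      refine ⟨frame M i ⁻¹' S.above k,
        ((S.separates_above k).preimage (continuous_frame M i)).mono (hsub i), ?_⟩
      simp only [t, Sum.elim_inl, mem_preimage]
      rw [S.mem_above_iff k _ (hstrip' j i) (hsK j i), S.mem_above_iff k _ (hstrip' j' i) (hsK j' i),
        S.lt_frame_snd_iff hM0, S.lt_frame_snd_iff hM0]
      exact h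
    · exact hpocket j a'
    · obtain ⟨G, hG, h⟩ := hpocket j' a
      exact ⟨G, hG, fun h' => h h'.symm⟩
    · refine ⟨frame M a.1 ⁻¹' S.pocket a.2,
        ((S.separates_pocket a.2).preimage (continuous_frame M a.1)).mono (hsub a.1), fun h => ?_⟩
      have h1 := h.1 (by
        simp only [t, Sum.elim_inr]
        rw [mem_preimage, frame_unframe hM0]
        exact S.pocketPoint_mem _)
      simp only [t, Sum.elim_inr] at h1
      obtain ⟨h2, h3⟩ := S.eq_of_mem_pocket _ a'.2 _ h1 (by
        simp only [frame, unframe]; field_simp)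
      have h4 := eq_of_abs_frame_le hM a'.1.2.le a.1.2.le _ h3
      exact hne (congrArg Sum.inr (Prod.ext (Fin.ext h4.symm) h2)))
  refine le_trans (le_of_eq ?_) key
  rw [ENat.card_eq_coe_fintype_card]
  have : Fintype.card κ = n.choose 2 * (5 * 5) := by
    simp only [κ, Fintype.card_prod, card_indexPair, Fintype.card_fin]
  simp only [Fintype.card_sum, Fintype.card_option, Fintype.card_prod, Fintype.card_fin, this,
    maxRegions]
  congr 1
  ring

end StripModel
end StripModel

/-! ### The model H and the model 5-chain -/

section Models
open Set Topology Filter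

/-- The open convex polygon defined by the inequalities `0 < a * x + b * y + c`. -/
def openPolygon (L : List (ℝ × ℝ × ℝ)) : Set Plane :=
  {z | ∀ f ∈ L, 0 < f.1 * z.1 + f.2.1 * z.2 + f.2.2}

theorem isOpen_openPolygon (L : List (ℝ × ℝ × ℝ)) : IsOpen (openPolygon L) := by
  have : openPolygon L = ⋂ f ∈ L.toFinset, {z | 0 < f.1 * z.1 + f.2.1 * z.2 + f.2.2} := by
    ext z
    simp [openPolygon]
  rw [this]
  refine isOpen_biInter_finset fun f _ => isOpen_lt continuous_const ?_
  fun_prop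

/-- A point of the closure satisfies all the weak inequalities; if it is not in the polygon, one of
them is an equality. So it suffices that the sides belong to `K`. -/
theorem separates_openPolygon (K : Set Plane) (L : List (ℝ × ℝ × ℝ))
    (h : ∀ x y : ℝ, (∀ f ∈ L, 0 ≤ f.1 * x + f.2.1 * y + f.2.2) →
      ∀ f ∈ L, f.1 * x + f.2.1 * y + f.2.2 = 0 → (x, y) ∈ K) : Separates K (openPolygon L) := by
  refine ⟨isOpen_openPolygon L, ?_⟩
  have hcl : IsClosed {z : Plane | ∀ f ∈ L, 0 ≤ f.1 * z.1 + f.2.1 * z.2 + f.2.2} := by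
    simp only [ofPred_forall]
    refine isClosed_biInter fun f _ => isClosed_le continuous_const ?_
    fun_prop
  intro z hz
  have hz' := closure_minimal (fun z hz f hf => (hz f hf).le) hcl hz
  by_cases hzG : z ∈ openPolygon L
  · exact Or.inl hzG
  · right
    simp only [openPolygon, mem_ofPred_eq, not_forall, not_lt] at hzG
    obtain ⟨f, hf, hle⟩ := hzG
    exact h z.1 z.2 hz' f hf (le_antisymm hle (hz' f hf))

/-- Tips `(-1, 0)` and `(1, 0)`, with legs of slopes `1`, `4` and `-2`, `-3`. The four crossings
have abscissas `1/3`, `1/2`, `-1/3`, `-1/7`, all outside the strip `|x| ≤ 1/10`. -/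
def hModelCarrier : Set Plane := {z |
  (z.2 = 0 ∧ -1 ≤ z.1 ∧ z.1 ≤ 1) ∨ (z.2 = z.1 + 1 ∧ -1 ≤ z.1) ∨ (z.2 = 4 * z.1 + 4 ∧ -1 ≤ z.1) ∨
  (z.2 = 2 - 2 * z.1 ∧ z.1 ≤ 1) ∨ (z.2 = 3 - 3 * z.1 ∧ z.1 ≤ 1)}

/-- The inner legs of the model H end at `(2, 3)` and `(-2, 6)`, and the segment between these nodes
replaces the bar. In the strip it becomes the highest of the five lines. -/
def chainModelCarrier : Set Plane := {z |
  (z.2 = 4 * z.1 + 4 ∧ -1 ≤ z.1) ∨ (z.2 = z.1 + 1 ∧ -1 ≤ z.1 ∧ z.1 ≤ 2) ∨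
  (z.2 = 9 / 2 - 3 / 4 * z.1 ∧ -2 ≤ z.1 ∧ z.1 ≤ 2) ∨
  (z.2 = 2 - 2 * z.1 ∧ -2 ≤ z.1 ∧ z.1 ≤ 1) ∨ (z.2 = 3 - 3 * z.1 ∧ z.1 ≤ 1)}

noncomputable def hModelCell : Fin 5 → Set Plane :=
  ![openPolygon [(0, 1, 0), (1, -1, 1), (-2, -1, 2)],
    openPolygon [(-1, 1, -1), (-2, -1, 2), (4, -1, 4)],
    openPolygon [(2, 1, -2), (-3, -1, 3), (-1, 1, -1), (4, -1, 4)],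
    openPolygon [(3, 1, -3), (-1, 1, -1), (4, -1, 4)],
    openPolygon [(-4, 1, -4), (3, 1, -3)]]

/-- Both pockets lie between the two legs at the tip `(1, 0)`: the triangle at that tip cut off by
the leg of slope `1`, and the unbounded part beyond the leg of slope `4`. -/
noncomputable def hModelPocket : Fin 2 → Set Plane :=
  ![openPolygon [(2, 1, -2), (-3, -1, 3), (1, -1, 1)],
    openPolygon [(2, 1, -2), (-3, -1, 3), (-4, 1, -4)]]

theorem separates_hModelCell : ∀ k, Separates hModelCarrier (hModelCell k) := by
    simp only [Fin.forall_fin_succ]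
    refine ⟨?_, ?_, ?_, ?_, ?_, fun i => i.elim0⟩ <;>
    · refine separates_openPolygon _ _ fun x y => ?_
      simp only [List.forall_mem_cons, List.not_mem_nil, false_imp_iff, implies_true, and_true,
        hModelCarrier, mem_ofPred_eq]
      intro h
      casesm* _ ∧ _
      constructorm* _ ∧ _ <;> intro e <;>
      first
      | exact Or.inl ⟨by linarith, by linarith, by linarith⟩
      | exact Or.inr (Or.inl ⟨by linarith, by linarith⟩)
      | exact Or.inr (Or.inr (Or.inl ⟨by linarith, by linarith⟩))
      | exact Or.inr (Or.inr (Or.inr (Or.inl ⟨by linarith, by linarith⟩)))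
      | exact Or.inr (Or.inr (Or.inr (Or.inr ⟨by linarith, by linarith⟩)))

theorem separates_hModelPocket : ∀ m, Separates hModelCarrier (hModelPocket m) := by
    simp only [Fin.forall_fin_succ]
    refine ⟨?_, ?_, fun i => i.elim0⟩ <;>
    · refine separates_openPolygon _ _ fun x y => ?_
      simp only [List.forall_mem_cons, List.not_mem_nil, false_imp_iff, implies_true, and_true,
        hModelCarrier, mem_ofPred_eq]
      intro h
      casesm* _ ∧ _
      constructorm* _ ∧ _ <;> intro e <;>
      first
      | exact Or.inr (Or.inl ⟨by linarith, by linarith⟩)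
      | exact Or.inr (Or.inr (Or.inl ⟨by linarith, by linarith⟩))
      | exact Or.inr (Or.inr (Or.inr (Or.inl ⟨by linarith, by linarith⟩)))
      | exact Or.inr (Or.inr (Or.inr (Or.inr ⟨by linarith, by linarith⟩)))

noncomputable def hModel : StripModel where
  carrier := hModelCarrier
  slope := ![0, 1, -2, -3, 4]
  height := ![0, 1, 2, 3, 4]
  cell := hModelCell
  pocket := hModelPocket
  mem_carrier_iff := by
    rintro ⟨x, y⟩ hx
    have hx := abs_le.1 hx
    simp only [hModelCarrier, mem_ofPred_eq, Fin.exists_fin_succ, Fin.exists_fin_zero]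
    simp at hx ⊢
    constructor
    · rintro (h | h | h | h | h)
      · exact Or.inl (by linarith [h.1])
      · exact Or.inr (Or.inl (by linarith [h.1]))
      · exact Or.inr (Or.inr (Or.inr (Or.inr ((by linarith [h.1])))))
      · exact Or.inr (Or.inr (Or.inl (by linarith [h.1])))
      · exact Or.inr (Or.inr (Or.inr (Or.inl (by linarith [h.1]))))
    · rintro (h | h | h | h | h)
      · exact Or.inl ⟨by linarith, by linarith, by linarith⟩
      · exact Or.inr (Or.inl ⟨by linarith, by linarith⟩)
      · exact Or.inr (Or.inr (Or.inr (Or.inl ⟨by linarith, by linarith⟩)))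
      · exact Or.inr (Or.inr (Or.inr (Or.inr ⟨by linarith, by linarith⟩)))
      · exact Or.inr (Or.inr (Or.inl ⟨by linarith, by linarith⟩))
  exists_of_mem_carrier := by
    rintro ⟨x, y⟩ h
    simp only [hModelCarrier, mem_ofPred_eq] at h
    rcases h with h | h | h | h | h
    · exact ⟨0, by simp [h.1]⟩
    · exact ⟨1, by simp [h.1]⟩
    · exact ⟨4, by simp [h.1]⟩
    · exact ⟨2, by simp [h.1]; ring⟩
    · exact ⟨3, by simp [h.1]; ring⟩
  strictMono := by
    intro x hx
    have hx := abs_le.1 hx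
    rw [Fin.strictMono_iff_lt_succ]
    simp only [Fin.forall_fin_succ]
    simp
    refine ⟨?_, ?_, ?_, ?_⟩ <;> linarith
  abs_slope_le := by simp [Fin.forall_fin_succ, abs_le]; norm_num
  height_nonneg := by simp [Fin.forall_fin_succ]
  height_le := by simp [Fin.forall_fin_succ]; norm_num
  abs_snd_le := by
    rintro ⟨x, y⟩ h hx
    have hx := abs_le.1 hx
    simp only [hModelCarrier, mem_ofPred_eq] at h hx ⊢
    rw [abs_le]
    rcases h with h | h | h | h | h <;> constructor <;> linarith
  separates_cell := separates_hModelCell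
  mem_cell_iff := by
    rintro k ⟨x, y⟩ hx
    have hx := abs_le.1 hx
    simp only at hx
    revert k
    simp only [Fin.forall_fin_succ]
    refine ⟨?_, ?_, ?_, ?_, ?_, fun i => i.elim0⟩ <;>
    · simp [openPolygon, hModelCell, -and_congr_right_iff, -and_iff_left_iff_imp, -and_iff_right_iff_imp]
      constructor <;> intro h <;> casesm* _ ∧ _ <;> (try constructorm* _ ∧ _) <;> linarith
  separates_pocket := separates_hModelPocket
  pocketPoint_mem := by
    simp [Fin.forall_fin_succ, openPolygon, hModelPocket, pocketPoint]
    norm_num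
  pocketPoint_notMem := by
    simp [Fin.forall_fin_succ, hModelCarrier, pocketPoint]
    norm_num
  eq_of_mem_pocket := by
    simp [Fin.forall_fin_succ, openPolygon, hModelPocket, pocketPoint]
    refine ⟨⟨?_, ?_⟩, ?_, ?_⟩ <;> intros <;> (try simp only [abs_le]) <;>
      (try constructor) <;> linarith
  lt_abs_of_mem_pocket := by
    simp only [Fin.forall_fin_succ]
    refine ⟨?_, ?_, fun i => i.elim0⟩ <;>
    · rintro ⟨x, y⟩ h
      simp [openPolygon, hModelPocket] at h
      rw [lt_abs]
      first
      | left; simp only; linarith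
      | right; simp only; linarith

noncomputable def chainModelCell : Fin 5 → Set Plane :=
  ![openPolygon [(-1, 1, -1), (-2, -1, 2), (4, -1, 4)],
    openPolygon [(2, 1, -2), (-3, -1, 3), (-1, 1, -1), (4, -1, 4)],
    openPolygon [(3, 1, -3), (4, -1, 4), (-1, 1, -1), (-3 / 4, -1, 9 / 2)],
    openPolygon [(-4, 1, -4), (3, 1, -3), (-3 / 4, -1, 9 / 2)],
    openPolygon [(-4, 1, -4), (3, 1, -3), (3 / 4, 1, -9 / 2)]]

noncomputable def chainModelPocket : Fin 2 → Set Plane :=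
  ![openPolygon [(2, 1, -2), (-3, -1, 3), (1, -1, 1)],
    openPolygon [(2, 1, -2), (-3, -1, 3), (-4, 1, -4), (-3 / 4, -1, 9 / 2)]]

theorem separates_chainModelCell : ∀ k, Separates chainModelCarrier (chainModelCell k) := by
    simp only [Fin.forall_fin_succ]
    refine ⟨?_, ?_, ?_, ?_, ?_, fun i => i.elim0⟩ <;>
    · refine separates_openPolygon _ _ fun x y => ?_
      simp only [List.forall_mem_cons, List.not_mem_nil, false_imp_iff, implies_true, and_true,
        chainModelCarrier, mem_ofPred_eq]
      intro h
      casesm* _ ∧ _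
      constructorm* _ ∧ _ <;> intro e <;>
      first
      | exact Or.inl ⟨by linarith, by linarith⟩
      | exact Or.inr (Or.inl ⟨by linarith, by linarith, by linarith⟩)
      | exact Or.inr (Or.inr (Or.inl ⟨by linarith, by linarith, by linarith⟩))
      | exact Or.inr (Or.inr (Or.inr (Or.inl ⟨by linarith, by linarith, by linarith⟩)))
      | exact Or.inr (Or.inr (Or.inr (Or.inr ⟨by linarith, by linarith⟩)))

theorem separates_chainModelPocket : ∀ m, Separates chainModelCarrier (chainModelPocket m) := by
    simp only [Fin.forall_fin_succ]
    refine ⟨?_, ?_, fun i => i.elim0⟩ <;>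
    · refine separates_openPolygon _ _ fun x y => ?_
      simp only [List.forall_mem_cons, List.not_mem_nil, false_imp_iff, implies_true, and_true,
        chainModelCarrier, mem_ofPred_eq]
      intro h
      casesm* _ ∧ _
      constructorm* _ ∧ _ <;> intro e <;>
      first
      | exact Or.inl ⟨by linarith, by linarith⟩
      | exact Or.inr (Or.inl ⟨by linarith, by linarith, by linarith⟩)
      | exact Or.inr (Or.inr (Or.inl ⟨by linarith, by linarith, by linarith⟩))
      | exact Or.inr (Or.inr (Or.inr (Or.inl ⟨by linarith, by linarith, by linarith⟩)))
      | exact Or.inr (Or.inr (Or.inr (Or.inr ⟨by linarith, by linarith⟩)))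

noncomputable def chainModel : StripModel where
  carrier := chainModelCarrier
  slope := ![1, -2, -3, 4, -3 / 4]
  height := ![1, 2, 3, 4, 9 / 2]
  cell := chainModelCell
  pocket := chainModelPocket
  mem_carrier_iff := by
    rintro ⟨x, y⟩ hx
    have hx := abs_le.1 hx
    simp only [chainModelCarrier, mem_ofPred_eq, Fin.exists_fin_succ, Fin.exists_fin_zero]
    simp at hx ⊢
    constructor
    · rintro (h | h | h | h | h)
      · exact Or.inr (Or.inr (Or.inr (Or.inl (by linarith [h.1]))))
      · exact Or.inl (by linarith [h.1])
      · exact Or.inr (Or.inr (Or.inr (Or.inr ((by linarith [h.1])))))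
      · exact Or.inr (Or.inl (by linarith [h.1]))
      · exact Or.inr (Or.inr (Or.inl (by linarith [h.1])))
    · rintro (h | h | h | h | h)
      · exact Or.inr (Or.inl ⟨by linarith, by linarith, by linarith⟩)
      · exact Or.inr (Or.inr (Or.inr (Or.inl ⟨by linarith, by linarith, by linarith⟩)))
      · exact Or.inr (Or.inr (Or.inr (Or.inr ⟨by linarith, by linarith⟩)))
      · exact Or.inl ⟨by linarith, by linarith⟩
      · exact Or.inr (Or.inr (Or.inl ⟨by linarith, by linarith, by linarith⟩))
  exists_of_mem_carrier := by
    rintro ⟨x, y⟩ h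
    simp only [chainModelCarrier, mem_ofPred_eq] at h
    rcases h with h | h | h | h | h
    · exact ⟨3, by simp [h.1]⟩
    · exact ⟨0, by simp [h.1]⟩
    · exact ⟨4, by simp [h.1]; ring⟩
    · exact ⟨1, by simp [h.1]; ring⟩
    · exact ⟨2, by simp [h.1]; ring⟩
  strictMono := by
    intro x hx
    have hx := abs_le.1 hx
    rw [Fin.strictMono_iff_lt_succ]
    simp only [Fin.forall_fin_succ]
    simp
    refine ⟨?_, ?_, ?_, ?_⟩ <;> linarith
  abs_slope_le := by simp [Fin.forall_fin_succ, abs_le]; norm_num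
  height_nonneg := by simp [Fin.forall_fin_succ]; norm_num
  height_le := by simp [Fin.forall_fin_succ]; norm_num
  abs_snd_le := by
    rintro ⟨x, y⟩ h hx
    have hx := abs_le.1 hx
    simp only [chainModelCarrier, mem_ofPred_eq] at h hx ⊢
    rw [abs_le]
    rcases h with h | h | h | h | h <;> constructor <;> linarith
  separates_cell := separates_chainModelCell
  mem_cell_iff := by
    rintro k ⟨x, y⟩ hx
    have hx := abs_le.1 hx
    simp only at hx
    revert k
    simp only [Fin.forall_fin_succ]
    refine ⟨?_, ?_, ?_, ?_, ?_, fun i => i.elim0⟩ <;>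
    · simp [openPolygon, chainModelCell, -and_congr_right_iff, -and_iff_left_iff_imp, -and_iff_right_iff_imp]
      constructor <;> intro h <;> casesm* _ ∧ _ <;> (try constructorm* _ ∧ _) <;> linarith
  separates_pocket := separates_chainModelPocket
  pocketPoint_mem := by
    simp [Fin.forall_fin_succ, openPolygon, chainModelPocket, pocketPoint]
    norm_num
  pocketPoint_notMem := by
    simp [Fin.forall_fin_succ, chainModelCarrier, pocketPoint]
    norm_num
  eq_of_mem_pocket := by
    simp [Fin.forall_fin_succ, openPolygon, chainModelPocket, pocketPoint]
    refine ⟨⟨?_, ?_⟩, ?_, ?_⟩ <;> intros <;> (try simp only [abs_le]) <;>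
      (try constructor) <;> linarith
  lt_abs_of_mem_pocket := by
    simp only [Fin.forall_fin_succ]
    refine ⟨?_, ?_, fun i => i.elim0⟩ <;>
    · rintro ⟨x, y⟩ h
      simp [openPolygon, chainModelPocket] at h
      rw [lt_abs]
      first
      | left; simp only; linarith
      | right; simp only; linarith

end Models

/-! ### The optimal arrangements, and the intersection of two H's -/

section Arrangement
open Set Topology

/-- The linear part of `unframe`. -/
noncomputable def unframeVec (M : ℝ) (i : ℕ) (v : Plane) : Plane :=
  (M * v.1, i * (M * v.1) + v.2 / 100)

theorem unframe_add_smul (M : ℝ) (i : ℕ) (p v : Plane) (t : ℝ) :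
    unframe M i (p + t • v) = unframe M i p + t • unframeVec M i v := by
  ext <;> simp [unframe, unframeVec] <;> ring

theorem unframe_sub (M : ℝ) (i : ℕ) (p q : Plane) :
    unframe M i q - unframe M i p = unframeVec M i (q - p) := by
  ext <;> simp [unframe, unframeVec] <;> ring

theorem eq_unframe_iff {M : ℝ} (hM : 0 < M) (i : ℕ) (z w : Plane) :
    z = unframe M i w ↔ frame M i z = w :=
  ⟨fun h => by rw [h, frame_unframe hM], fun h => by rw [← h, unframe_frame hM]⟩

theorem mem_ray_unframe {M : ℝ} (hM : 0 < M) (i : ℕ) (p v z : Plane) :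
    z ∈ ray (unframe M i p) (unframeVec M i v) ↔ frame M i z ∈ ray p v := by
  simp only [ray, mem_ofPred_eq, ← unframe_add_smul, eq_unframe_iff hM]

theorem mem_segment_unframe {M : ℝ} (hM : 0 < M) (i : ℕ) (p q z : Plane) :
    z ∈ segment ℝ (unframe M i p) (unframe M i q) ↔ frame M i z ∈ segment ℝ p q := by
  simp only [segment_eq_image_line, unframe_sub, mem_image, ← unframe_add_smul]
  simp only [eq_comm (b := z), eq_comm (b := frame M i z), eq_unframe_iff hM]

theorem mem_ray_iff_of_ne {p v : Plane} (hv : v.1 ≠ 0) (z : Plane) :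
    z ∈ ray p v ↔ 0 ≤ (z.1 - p.1) / v.1 ∧ z.2 = p.2 + (z.1 - p.1) / v.1 * v.2 := by
  constructor
  · rintro ⟨t, ht, rfl⟩
    simp [hv, ht]
  · rintro ⟨h1, h2⟩
    exact ⟨_, h1, Prod.ext (by simp [hv]) (by simpa using h2)⟩

theorem mem_segment_iff_of_ne {p q : Plane} (h : q.1 - p.1 ≠ 0) (z : Plane) :
    z ∈ segment ℝ p q ↔ (0 ≤ (z.1 - p.1) / (q.1 - p.1) ∧ (z.1 - p.1) / (q.1 - p.1) ≤ 1) ∧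
      z.2 = p.2 + (z.1 - p.1) / (q.1 - p.1) * (q.2 - p.2) := by
  rw [segment_eq_image_line]
  constructor
  · rintro ⟨t, ht, rfl⟩
    simp [h, ht.1, ht.2]
  · rintro ⟨h1, h2⟩
    exact ⟨_, h1, (Prod.ext (by simp [h]) (by simpa using h2)).symm⟩

/-- The cross product of two vectors of the plane. -/
def cross (u v : Plane) : ℝ := u.1 * v.2 - u.2 * v.1

theorem not_sameRay_of_cross_ne {u v : Plane} (h : cross u v ≠ 0) : ¬ SameRay ℝ u v := by
  rintro (rfl | rfl | ⟨a, b, ha, hb, hab⟩)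
  · simp [cross] at h
  · simp [cross] at h
  · apply h
    rw [cross]
    have h1 := congrArg Prod.fst hab
    have h2 := congrArg Prod.snd hab
    simp at h1 h2
    apply mul_left_cancel₀ ha.ne'
    linear_combination v.2 * h1 - v.1 * h2

/-- The figure with number `i` of the optimal arrangement. -/
noncomputable def optimalH (M : ℝ) (i : ℕ) : LongLeggedH where
  tip := ![unframe M i (-1, 0), unframe M i (1, 0)]
  leg := ![![unframeVec M i (3, 3), unframeVec M i (1, 4)],
    ![unframeVec M i (-3, 6), unframeVec M i (-1, 3)]]

theorem not_sameRay_unframeVec {M : ℝ} (hM : 0 < M) (i : ℕ) {u v : Plane}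
    (h : cross u v ≠ 0) : ¬ SameRay ℝ (unframeVec M i u) (unframeVec M i v) := by
  apply not_sameRay_of_cross_ne
  have : cross (unframeVec M i u) (unframeVec M i v) = M / 100 * cross u v := by
    simp only [unframeVec, cross]
    ring
  rw [this]
  exact mul_ne_zero (by positivity) h

theorem optimalH_proper {M : ℝ} (hM : 0 < M) (i : ℕ) : (optimalH M i).Proper := by
  refine ⟨?_, ?_, ?_⟩ <;> simp only [Fin.forall_fin_two, optimalH] <;> refine ⟨?_, ?_⟩ <;>
    simp only [Matrix.cons_val_zero, Matrix.cons_val_one, unframe_sub] <;>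
    apply not_sameRay_unframeVec hM <;> norm_num [cross]

theorem raiseBar_optimalH_node (M : ℝ) (i : ℕ) : (raiseBar (optimalH M i)).node =
    ![unframe M i (-1, 0), unframe M i (2, 3), unframe M i (-2, 6), unframe M i (1, 0)] := by
  have h1 : unframe M i (-1, 0) + unframeVec M i (3, 3) = unframe M i (2, 3) := by
    ext <;> simp [unframe, unframeVec] <;> ring
  have h2 : unframe M i (1, 0) + unframeVec M i (-3, 6) = unframe M i (-2, 6) := by
    ext <;> simp [unframe, unframeVec] <;> ring
  simp only [raiseBar, optimalH, Equiv.coe_fn_mk, Matrix.cons_val_zero, Matrix.cons_val_one, h1, h2]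

theorem raiseBar_optimalH_out (M : ℝ) (i : ℕ) : (raiseBar (optimalH M i)).out =
    ![unframeVec M i (1, 4), unframeVec M i (-1, 3)] := rfl

theorem raiseBar_optimalH_proper {M : ℝ} (hM : 0 < M) (i : ℕ) :
    (raiseBar (optimalH M i)).Proper := by
  rw [FiveChain.Proper, raiseBar_optimalH_node, raiseBar_optimalH_out]
  refine ⟨?_, ?_, ?_, ?_⟩ <;> simp [unframe_sub] <;>
    apply not_sameRay_unframeVec hM <;> norm_num [cross]

theorem optimalH_carrier {M : ℝ} (hM : 0 < M) (i : ℕ) :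
    (optimalH M i).carrier = frame M i ⁻¹' hModel.carrier := by
  rw [LongLeggedH.carrier_eq]
  ext z
  simp only [optimalH, Matrix.cons_val_zero, Matrix.cons_val_one, mem_union, mem_ray_unframe hM,
    mem_segment_unframe hM, mem_preimage]
  generalize frame M i z = w
  obtain ⟨x, y⟩ := w
  rw [mem_ray_iff_of_ne (by norm_num), mem_ray_iff_of_ne (by norm_num),
    mem_ray_iff_of_ne (by norm_num), mem_ray_iff_of_ne (by norm_num),
    mem_segment_iff_of_ne (by norm_num)]
  simp only [hModel, hModelCarrier, mem_ofPred_eq]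
  constructor
  · rintro ((((h | h) | h) | h) | h)
    · exact Or.inr (Or.inl ⟨by linarith [h.2], by linarith [h.1]⟩)
    · exact Or.inr (Or.inr (Or.inl ⟨by linarith [h.2], by linarith [h.1]⟩))
    · exact Or.inr (Or.inr (Or.inr (Or.inl ⟨by linarith [h.2], by linarith [h.1]⟩)))
    · exact Or.inr (Or.inr (Or.inr (Or.inr ⟨by linarith [h.2], by linarith [h.1]⟩)))
    · exact Or.inl ⟨by linarith [h.2], by linarith [h.1.1], by linarith [h.1.2]⟩
  · rintro (h | h | h | h | h)
    · exact Or.inr ⟨⟨by linarith, by linarith⟩, by linarith⟩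
    · exact Or.inl (Or.inl (Or.inl (Or.inl ⟨by linarith, by linarith⟩)))
    · exact Or.inl (Or.inl (Or.inl (Or.inr ⟨by linarith, by linarith⟩)))
    · exact Or.inl (Or.inl (Or.inr ⟨by linarith, by linarith⟩))
    · exact Or.inl (Or.inr ⟨by linarith, by linarith⟩)

theorem raiseBar_optimalH_carrier {M : ℝ} (hM : 0 < M) (i : ℕ) :
    (raiseBar (optimalH M i)).carrier = frame M i ⁻¹' chainModel.carrier := by
  rw [FiveChain.carrier_eq, raiseBar_optimalH_node, raiseBar_optimalH_out]
  ext z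
  simp only [Matrix.cons_val, Matrix.cons_val_zero, Matrix.cons_val_one, mem_union,
    mem_ray_unframe hM, mem_segment_unframe hM, mem_preimage]
  generalize frame M i z = w
  obtain ⟨x, y⟩ := w
  rw [mem_ray_iff_of_ne (by norm_num), mem_ray_iff_of_ne (by norm_num),
    mem_segment_iff_of_ne (by norm_num), mem_segment_iff_of_ne (by norm_num),
    mem_segment_iff_of_ne (by norm_num)]
  have e : (x - 2) / (-2 - 2) = (2 - x) / 4 := by ring
  simp only [chainModel, chainModelCarrier, mem_ofPred_eq, e]
  constructor
  · rintro ((((h | h) | h) | h) | h)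
    · exact Or.inl ⟨by linarith [h.2], by linarith [h.1]⟩
    · exact Or.inr (Or.inl ⟨by linarith [h.2], by linarith [h.1.1], by linarith [h.1.2]⟩)
    · exact Or.inr (Or.inr (Or.inl ⟨by linarith [h.2], by linarith [h.1.2], by linarith [h.1.1]⟩))
    · exact Or.inr (Or.inr (Or.inr (Or.inl
        ⟨by linarith [h.2], by linarith [h.1.1], by linarith [h.1.2]⟩)))
    · exact Or.inr (Or.inr (Or.inr (Or.inr ⟨by linarith [h.2], by linarith [h.1]⟩)))
  · rintro (h | h | h | h | h)
    · exact Or.inl (Or.inl (Or.inl (Or.inl ⟨by linarith, by linarith⟩)))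
    · exact Or.inl (Or.inl (Or.inl (Or.inr ⟨⟨by linarith, by linarith⟩, by linarith⟩)))
    · exact Or.inl (Or.inl (Or.inr ⟨⟨by linarith, by linarith⟩, by linarith⟩))
    · exact Or.inl (Or.inr ⟨⟨by linarith, by linarith⟩, by linarith⟩)
    · exact Or.inr ⟨by linarith, by linarith⟩

theorem regionCount_optimalH (n : ℕ) :
    regionCount (⋃ i : Fin n, (optimalH (40 * (n + 1)) i).carrier) = maxRegions n := by
  have hM : (0 : ℝ) < 40 * (n + 1) := by positivity
  refine le_antisymm (regionCount_iUnion_le _ fun i K N hK =>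
    (optimalH_proper hM i).regionCount_union_le hK).2 ?_
  simp only [optimalH_carrier hM]
  exact hModel.maxRegions_le_regionCount n

theorem regionCount_raiseBar_optimalH (n : ℕ) :
    regionCount (⋃ i : Fin n, (raiseBar (optimalH (40 * (n + 1)) i)).carrier) = maxRegions n := by
  have hM : (0 : ℝ) < 40 * (n + 1) := by positivity
  refine le_antisymm (regionCount_iUnion_le _ fun i K N hK =>
    (raiseBar_optimalH_proper hM i).regionCount_union_le hK).2 ?_
  simp only [raiseBar_optimalH_carrier hM]
  exact chainModel.maxRegions_le_regionCount n

theorem isGreatest_hRegionCounts (n : ℕ) : IsGreatest (hRegionCounts n) (maxRegions n : ℕ∞) := by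
  refine ⟨⟨fun i => optimalH (40 * (n + 1)) i, fun i => optimalH_proper (by positivity) i,
    (regionCount_optimalH n).symm⟩, ?_⟩
  rintro _ ⟨S, hS, rfl⟩
  exact (regionCount_iUnion_le _ fun i K N hK => (hS i).regionCount_union_le hK).2

theorem isGreatest_chainRegionCounts (n : ℕ) :
    IsGreatest (chainRegionCounts n) (maxRegions n : ℕ∞) := by
  refine ⟨⟨fun i => raiseBar (optimalH (40 * (n + 1)) i),
    fun i => raiseBar_optimalH_proper (by positivity) i,
    (regionCount_raiseBar_optimalH n).symm⟩, ?_⟩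
  rintro _ ⟨S, hS, rfl⟩
  exact (regionCount_iUnion_le _ fun i K N hK => (hS i).regionCount_union_le hK).2

theorem maxRegions_cast (n : ℕ) :
    (maxRegions n : ℚ) = (25 * (n : ℚ) ^ 2 - 11 * n + 2) / 2 := by
  simp only [maxRegions]
  push_cast
  rw [Nat.cast_choose_two]
  ring

theorem Convex.subsingleton_of_finite {s : Set Plane} (hs : Convex ℝ s) (h : s.Finite) :
    s.Subsingleton := by
  by_contra hn
  exact hs.isPreconnected.infinite_of_nontrivial (not_subsingleton_iff.1 hn) h

theorem encard_iUnion_le_card {ι : Type} [Fintype ι] (A : ι → Set Plane)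
    (hA : ∀ k, (A k).Subsingleton) : (⋃ k, A k).encard ≤ Fintype.card ι := by
  rcases isEmpty_or_nonempty ι with h | h
  · simp
  choose f hf using fun x : ⋃ k, A k => mem_iUnion.1 x.2
  have hinj : Function.Injective f := fun x y hxy => Subtype.ext (hA _ (hf x) (hxy ▸ hf y))
  rw [encard, ← ENat.card_eq_coe_fintype_card]
  exact ENat.card_le_card_of_injective hinj

theorem LongLeggedH.convex_arm (S : LongLeggedH) (a) : Convex ℝ (S.arm a) := by
  rcases a with _ | ⟨i, j⟩
  · exact convex_segment _ _
  · exact convex_ray _ _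

/-- The intersection is the union of `5 * 5` intersections of arms. Each is convex and finite, hence
has at most one point. -/
theorem LongLeggedH.encard_inter_le (S T : LongLeggedH) (h : (S.carrier ∩ T.carrier).Finite) :
    (S.carrier ∩ T.carrier).encard ≤ 25 := by
  have e : S.carrier ∩ T.carrier =
      ⋃ k : Option (Fin 2 × Fin 2) × Option (Fin 2 × Fin 2), S.arm k.1 ∩ T.arm k.2 := by
    ext x
    simp only [carrier, mem_inter_iff, mem_iUnion, Prod.exists (p := fun k :
      Option (Fin 2 × Fin 2) × Option (Fin 2 × Fin 2) => x ∈ S.arm k.1 ∧ x ∈ T.arm k.2)]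
    exact ⟨fun ⟨⟨a, ha⟩, b, hb⟩ => ⟨a, b, ha, hb⟩, fun ⟨a, b, ha, hb⟩ => ⟨⟨a, ha⟩, b, hb⟩⟩
  rw [e]
  refine (encard_iUnion_le_card _ fun k => ?_).trans (by simp)
  refine Convex.subsingleton_of_finite ((S.convex_arm _).inter (T.convex_arm _))
    (h.subset ?_)
  rw [e]
  exact subset_iUnion (fun k : Option (Fin 2 × Fin 2) × Option (Fin 2 × Fin 2) =>
    S.arm k.1 ∩ T.arm k.2) k

theorem isGreatest_encard_inter : IsGreatest {c : ℕ∞ | ∃ S T : LongLeggedH, S.Proper ∧ T.Proper ∧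
      (S.carrier ∩ T.carrier).Finite ∧ c = (S.carrier ∩ T.carrier).encard} 25 := by
  constructor
  · have h : ((optimalH 120 0).carrier ∩ (optimalH 120 1).carrier).encard = 25 := by
      rw [optimalH_carrier (by norm_num), optimalH_carrier (by norm_num)]
      exact hModel.encard_inter_eq
    exact ⟨optimalH 120 0, optimalH 120 1, optimalH_proper (by norm_num) 0,
      optimalH_proper (by norm_num) 1, finite_of_encard_eq_coe (k := 25) h, h.symm⟩
  · rintro _ ⟨S, T, -, -, h, rfl⟩
    exact S.encard_inter_le T h

end Arrangement

/-! ### Self-crossings, and lowering the bar -/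

section SelfCrossings
open Set

theorem cross_self_eq_zero (u : Plane) : cross u u = 0 := by simp only [cross]; ring

theorem cross_swap (u v : Plane) : cross u v = -cross v u := by simp only [cross]; ring

theorem cross_add_smul_sub (w p z : Plane) (μ : ℝ) : cross w (p + μ • z - p) = μ * cross w z := by
  simp [cross]; ring

theorem cross_sub_right (w x y z : Plane) : cross w (x - z) = cross w (x - y) + cross w (y - z) := by
  simp [cross]; ring

theorem cross_smul_sub_cross_smul (u v w : Plane) :
    cross u v • w - cross u w • v = -cross v w • u := by
  ext <;> simp [cross] <;> ring

theorem sameRay_of_cross_eq_zero {d u v : Plane} (hu : 0 < cross d u) (hv : 0 < cross d v)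
    (h : cross u v = 0) : SameRay ℝ u v := by
  have := cross_smul_sub_cross_smul d v u
  rw [cross_swap v u, h, neg_zero, neg_zero, zero_smul, sub_eq_zero] at this
  exact Or.inr (Or.inr ⟨_, _, hv, hu, this⟩)

/-- Rays in the directions `u` and `v` that start at the two ends of the vector `d`, and neither
of which overlaps with it, can only meet if they are not parallel. -/
theorem cross_ne_zero_of_meet {d u v : Plane} {s t : ℝ} (hs : 0 ≤ s) (ht : 0 ≤ t)
    (h : s • u - t • v = d) (hu : ¬ SameRay ℝ u d) (hv : ¬ SameRay ℝ v (-d)) : cross u v ≠ 0 := by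
  intro h0
  have hu0 := ne_zero_of_not_sameRay_left hu
  obtain ⟨c, rfl⟩ : ∃ c : ℝ, v = c • u := by
    simp only [cross] at h0
    by_cases h1 : u.1 = 0
    · have h2 : u.2 ≠ 0 := fun h2 => hu0 (Prod.ext h1 h2)
      refine ⟨v.2 / u.2, Prod.ext ?_ (by simp [h2])⟩
      rw [h1, zero_mul, zero_sub, neg_eq_zero] at h0
      simpa [h1] using (mul_eq_zero.1 h0).resolve_left h2
    · refine ⟨v.1 / u.1, Prod.ext (by simp [h1]) ?_⟩
      simp only [Prod.smul_snd, smul_eq_mul]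
      field_simp
      linarith
  -- If `u` and `v` were parallel, `d` would be parallel to them too. Then either `u` points along
  -- `d`, or `v` points along `-d`.
  have hd : d = (s - t * c) • u := by rw [← h]; module
  rcases le_or_gt 0 (s - t * c) with h1 | h1
  · exact hu (hd ▸ SameRay.sameRay_nonneg_smul_right u h1)
  · have hc : 0 < c := by
      by_contra hc
      nlinarith [mul_nonneg ht (neg_nonneg.2 (not_lt.1 hc))]
    refine hv (Or.inr (Or.inr ⟨t * c - s, c, by linarith, hc, ?_⟩))
    rw [hd]
    module

theorem subsingleton_ray_inter_ray {p q u v : Plane} (h : cross u v ≠ 0) :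
    (ray p u ∩ ray q v).Subsingleton := by
  rintro x ⟨⟨s, -, hs⟩, ⟨t, -, ht⟩⟩ y ⟨⟨s', -, hs'⟩, ⟨t', -, ht'⟩⟩
  have h1 : (s - s') • u = (t - t') • v := by
    have : (s - s') • u = x - y := by rw [hs, hs']; module
    rw [this, ht, ht']
    module
  have h2 := congrArg (fun z => cross z v) h1
  have h3 : (s - s') * cross u v = 0 := by
    simp [cross] at h2
    simp only [cross]
    linarith
  have h4 := sub_eq_zero.1 ((mul_eq_zero.1 h3).resolve_right h)
  rw [hs, hs', h4]

theorem ray_smul (p v : Plane) {s : ℝ} (hs : 0 < s) : ray p (s • v) = ray p v := by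
  ext x
  constructor
  · rintro ⟨t, ht, rfl⟩
    exact ⟨t * s, by positivity, by rw [mul_smul]⟩
  · rintro ⟨t, ht, rfl⟩
    exact ⟨t / s, by positivity, by rw [smul_smul, div_mul_cancel₀ _ hs.ne']⟩

/-- Sets with at most one point each have a union of maximal size exactly when all are nonempty and
their points are distinct. This turns a maximal number of crossings into a list of crossings. -/
theorem encard_iUnion_eq_card_iff {ι : Type} [Fintype ι] {A : ι → Set Plane}
    (hA : ∀ k, (A k).Subsingleton) : (⋃ k, A k).encard = Fintype.card ι ↔
      ∃ f : ι → Plane, Function.Injective f ∧ ∀ k, f k ∈ A k := by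
  constructor
  · intro h
    choose g hg using fun x : ⋃ k, A k => mem_iUnion.1 x.2
    have hinj : Function.Injective g := fun x y hxy => Subtype.ext (hA _ (hg x) (hxy ▸ hg y))
    have hfin : Finite (⋃ k, A k : Set Plane) := Finite.of_injective g hinj
    have hcard : Nat.card (⋃ k, A k : Set Plane) = Nat.card ι := by
      have h2 := Set.Finite.encard_eq_coe_toFinset_card (toFinite (⋃ k, A k))
      rw [Nat.card_eq_fintype_card (α := ι), Nat.card_coe_set_eq]
      rw [(toFinite (⋃ k, A k)).encard_eq_coe] at h
      exact_mod_cast h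
    have hbij := (Nat.bijective_iff_injective_and_card g).2 ⟨hinj, hcard⟩
    let e := Equiv.ofBijective g hbij
    refine ⟨fun k => e.symm k, Subtype.val_injective.comp e.symm.injective, fun k => ?_⟩
    have := hg (e.symm k)
    rwa [show g (e.symm k) = k from e.apply_symm_apply k] at this
  · rintro ⟨f, hf, hfA⟩
    refine le_antisymm (encard_iUnion_le_card A hA) ?_
    have h : range f ⊆ ⋃ k, A k := by
      rintro _ ⟨k, rfl⟩
      exact mem_iUnion.2 ⟨k, hfA k⟩
    refine le_trans ?_ (encard_le_encard h)
    rw [← image_univ, hf.encard_image, encard_univ, ENat.card_eq_coe_fintype_card]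

namespace LongLeggedH

theorem Proper.tip_ne {S : LongLeggedH} (hS : S.Proper) : S.tip 0 ≠ S.tip 1 :=
  (sub_ne_zero.1 (ne_zero_of_not_sameRay_right (hS.2.1 0))).symm

theorem Proper.tip_zero_notMem {S : LongLeggedH} (hS : S.Proper) (j : Fin 2) :
    S.tip 0 ∉ ray (S.tip 1) (S.leg 1 j) := fun h =>
  hS.tip_ne (eq_of_mem_ray_of_not_sameRay (hS.2.2 j) h ⟨1, zero_le_one, by simp⟩)

theorem Proper.tip_one_notMem {S : LongLeggedH} (hS : S.Proper) (j : Fin 2) :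
    S.tip 1 ∉ ray (S.tip 0) (S.leg 0 j) := fun h =>
  hS.tip_ne.symm (eq_of_mem_ray_of_not_sameRay (hS.2.1 j) h ⟨1, zero_le_one, by simp⟩)

/-- Arms leaving a common tip in different directions meet only there. This excludes the bar and
pairs of legs at the same tip, leaving four pairs. -/
theorem Proper.selfCrossings_eq {S : LongLeggedH} (hS : S.Proper) : S.selfCrossings =
    ⋃ k : Fin 2 × Fin 2, ray (S.tip 0) (S.leg 0 k.1) ∩ ray (S.tip 1) (S.leg 1 k.2) := by
  have hbar : ∀ i j, ∀ x ∈ segment ℝ (S.tip 0) (S.tip 1), x ∈ ray (S.tip i) (S.leg i j) →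
      x = S.tip i := by
    intro i j x hx hxr
    fin_cases i
    · exact eq_of_mem_ray_of_not_sameRay (hS.2.1 j) hxr (segment_subset_ray _ _ hx)
    · exact eq_of_mem_ray_of_not_sameRay (hS.2.2 j) hxr (segment_subset_ray' _ _ hx)
  ext x
  simp only [mem_iUnion, selfCrossings, mem_ofPred_eq]
  constructor
  · rintro ⟨hx, a, b, hab, ha, hb⟩
    rcases a with _ | ⟨i, j⟩ <;> rcases b with _ | ⟨i', j'⟩
    · exact absurd rfl hab
    · exact absurd ⟨_, (hbar i' j' x ha hb).symm⟩ hx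
    · exact absurd ⟨_, (hbar i j x hb ha).symm⟩ hx
    · have hself : ∀ i j j', j ≠ j' → x ∈ ray (S.tip i) (S.leg i j) →
          x ∈ ray (S.tip i) (S.leg i j') → x = S.tip i := by
        intro i j j' hj h1 h2
        fin_cases j <;> fin_cases j'
        · exact absurd rfl hj
        · exact eq_of_mem_ray_of_not_sameRay (hS.1 i) h1 h2
        · exact eq_of_mem_ray_of_not_sameRay (hS.1 i) h2 h1
        · exact absurd rfl hj
      by_cases hi : i = i'
      · subst hi
        exact absurd ⟨_, (hself i j j' (fun h => hab (by rw [h])) ha hb).symm⟩ hx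
      · fin_cases i <;> fin_cases i'
        · exact absurd rfl hi
        · exact ⟨(j, j'), ha, hb⟩
        · exact ⟨(j', j), hb, ha⟩
        · exact absurd rfl hi
  · rintro ⟨⟨j, j'⟩, h0, h1⟩
    refine ⟨?_, some (0, j), some (1, j'), by simp, h0, h1⟩
    rintro ⟨i, rfl⟩
    fin_cases i
    · exact hS.tip_zero_notMem j' h1
    · exact hS.tip_one_notMem j h0

theorem Proper.cross_ne_zero {S : LongLeggedH} (hS : S.Proper) {j j' : Fin 2} {x : Plane}
    (h0 : x ∈ ray (S.tip 0) (S.leg 0 j)) (h1 : x ∈ ray (S.tip 1) (S.leg 1 j')) :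
    cross (S.leg 0 j) (S.leg 1 j') ≠ 0 := by
  obtain ⟨s, hs, hxs⟩ := h0
  obtain ⟨t, ht, hxt⟩ := h1
  refine cross_ne_zero_of_meet hs ht ?_ (hS.2.1 j) (by rw [neg_sub]; exact hS.2.2 j')
  rw [hxs] at hxt
  rw [sub_eq_sub_iff_add_eq_add, add_comm, hxt, add_comm]

theorem Proper.subsingleton_crossing {S : LongLeggedH} (hS : S.Proper) (k : Fin 2 × Fin 2) :
    (ray (S.tip 0) (S.leg 0 k.1) ∩ ray (S.tip 1) (S.leg 1 k.2)).Subsingleton := fun _ hx _ hy =>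
  subsingleton_ray_inter_ray (hS.cross_ne_zero hx.1 hx.2) hx hy

theorem Proper.encard_selfCrossings_le {S : LongLeggedH} (hS : S.Proper) :
    S.selfCrossings.encard ≤ 4 := by
  rw [hS.selfCrossings_eq]
  exact (encard_iUnion_le_card _ hS.subsingleton_crossing).trans (by simp)

theorem Proper.encard_selfCrossings_eq_four_iff {S : LongLeggedH} (hS : S.Proper) :
    S.selfCrossings.encard = 4 ↔ ∃ f : Fin 2 × Fin 2 → Plane, Function.Injective f ∧
      ∀ k, f k ∈ ray (S.tip 0) (S.leg 0 k.1) ∩ ray (S.tip 1) (S.leg 1 k.2) := by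
  rw [hS.selfCrossings_eq, ← encard_iUnion_eq_card_iff hS.subsingleton_crossing]
  simp

end LongLeggedH

theorem isGreatest_encard_selfCrossings :
    IsGreatest {c : ℕ∞ | ∃ S : LongLeggedH, S.Proper ∧ c = S.selfCrossings.encard} 4 := by
  constructor
  · let S : LongLeggedH := ⟨![(-1, 0), (1, 0)], ![![(1, 1), (1, 4)], ![(-1, 2), (-1, 3)]]⟩
    have hS : S.Proper := by
      refine ⟨?_, ?_, ?_⟩ <;> simp only [Fin.forall_fin_two, S] <;> refine ⟨?_, ?_⟩ <;>
        apply not_sameRay_of_cross_ne <;> norm_num [cross]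
    refine ⟨S, hS, ((hS.encard_selfCrossings_eq_four_iff).2
      ⟨fun k => ![![(1 / 3, 4 / 3), (1 / 2, 3 / 2)], ![(-1 / 3, 8 / 3), (-1 / 7, 24 / 7)]] k.1 k.2,
        ?_, ?_⟩).symm⟩
    · rintro ⟨i, j⟩ ⟨i', j'⟩ h
      fin_cases i <;> fin_cases j <;> fin_cases i' <;> fin_cases j' <;>
        first | rfl | (norm_num at h)
    · rintro ⟨i, j⟩
      fin_cases i <;> fin_cases j <;> constructor <;> rw [mem_ray_iff_of_ne] <;> simp [S] <;>
        norm_num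
  · rintro _ ⟨S, hS, rfl⟩
    exact hS.encard_selfCrossings_le

namespace FiveChain

/-- The pairs of arms that have no node in common. -/
def disjointArms : Fin 6 → Fin 5 × Fin 5 := ![(0, 2), (0, 3), (0, 4), (1, 3), (1, 4), (2, 4)]

theorem convex_arm (C : FiveChain) (a : Fin 5) : Convex ℝ (C.arm a) := by
  fin_cases a
  exacts [convex_ray _ _, convex_segment _ _, convex_segment _ _, convex_segment _ _,
    convex_ray _ _]

theorem Proper.eq_node {C : FiveChain} (hC : C.Proper) (k : Fin 4) {x : Plane}
    (h0 : x ∈ C.arm k.castSucc) (h1 : x ∈ C.arm k.succ) : x = C.node k := by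
  obtain ⟨c0, c1, c2, c3⟩ := hC
  fin_cases k
  · exact eq_of_mem_ray_of_not_sameRay c0 h0 (segment_subset_ray _ _ h1)
  · exact eq_of_mem_ray_of_not_sameRay c1 (segment_subset_ray' _ _ h0) (segment_subset_ray _ _ h1)
  · exact eq_of_mem_ray_of_not_sameRay c2 (segment_subset_ray' _ _ h0) (segment_subset_ray _ _ h1)
  · exact eq_of_mem_ray_of_not_sameRay c3 (segment_subset_ray' _ _ h0) h1

theorem Proper.selfCrossings_eq {C : FiveChain} (hC : C.Proper) : C.selfCrossings =
    ⋃ k, (C.arm (disjointArms k).1 ∩ C.arm (disjointArms k).2) \ range C.node := by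
  have hpair : ∀ a b : Fin 5, a < b →
      (∃ k : Fin 4, a = k.castSucc ∧ b = k.succ) ∨ ∃ k, disjointArms k = (a, b) := by decide
  have key : ∀ a b : Fin 5, a < b → ∀ x ∉ range C.node, x ∈ C.arm a → x ∈ C.arm b →
      ∃ k, (x ∈ C.arm (disjointArms k).1 ∧ x ∈ C.arm (disjointArms k).2) ∧ x ∉ range C.node := by
    intro a b hab x hx ha hb
    rcases hpair a b hab with ⟨k, rfl, rfl⟩ | ⟨k, hk⟩
    · exact absurd ⟨k, (hC.eq_node k ha hb).symm⟩ hx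
    · exact ⟨k, by rw [hk]; exact ⟨ha, hb⟩, hx⟩
  have hne : ∀ k, (disjointArms k).1 ≠ (disjointArms k).2 := by decide
  ext x
  simp only [mem_iUnion, selfCrossings, mem_ofPred_eq, mem_sdiff, mem_inter_iff]
  constructor
  · rintro ⟨hx, a, b, hab, ha, hb⟩
    rcases lt_or_gt_of_ne hab with h | h
    · exact key a b h x hx ha hb
    · exact key b a h x hx hb ha
  · rintro ⟨k, ⟨h0, h1⟩, hx⟩
    exact ⟨hx, _, _, hne k, h0, h1⟩

/-- Two crossings can coincide only at a point on at least three arms. Of these arms two are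
consecutive, and the point is a node, unless they are the arms `0`, `2`, `4`; so these are the only
triple to be excluded. -/
theorem Proper.encard_selfCrossings_eq_six {C : FiveChain} (hC : C.Proper)
    (hsub : ∀ k, (C.arm (disjointArms k).1 ∩ C.arm (disjointArms k).2).Subsingleton)
    (hne : ∀ k, ∃ x ∈ C.arm (disjointArms k).1 ∩ C.arm (disjointArms k).2, x ∉ range C.node)
    (h024 : ∀ x ∈ C.arm 0, x ∈ C.arm 2 → x ∉ C.arm 4) : C.selfCrossings.encard = 6 := by
  choose f hf hfn using hne
  have h := (encard_iUnion_eq_card_iff (fun k => (hsub k).anti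
    (sdiff_subset (t := range C.node)))).2 ⟨f, ?_, fun k => ⟨hf k, hfn k⟩⟩
  · rw [hC.selfCrossings_eq, h]
    simp
  · intro k l hkl
    by_contra hne
    have hcomb : ∀ k l : Fin 6, k ≠ l → ∀ P : Fin 5 → Prop,
        P (disjointArms k).1 → P (disjointArms k).2 → P (disjointArms l).1 →
        P (disjointArms l).2 → (P 0 ∧ P 1) ∨ (P 1 ∧ P 2) ∨ (P 2 ∧ P 3) ∨ (P 3 ∧ P 4) ∨
          (P 0 ∧ P 2 ∧ P 4) := by
      intro k l hkl P
      fin_cases k <;> fin_cases l <;> simp [disjointArms] at hkl ⊢ <;> tauto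
    have hl := hf l
    rw [← hkl] at hl
    rcases hcomb k l hne (fun a => f k ∈ C.arm a) (hf k).1 (hf k).2 hl.1 hl.2 with
      h | h | h | h | h
    · exact hfn k ⟨0, (hC.eq_node 0 h.1 h.2).symm⟩
    · exact hfn k ⟨1, (hC.eq_node 1 h.1 h.2).symm⟩
    · exact hfn k ⟨2, (hC.eq_node 2 h.1 h.2).symm⟩
    · exact hfn k ⟨3, (hC.eq_node 3 h.1 h.2).symm⟩
    · exact h024 _ h.1 h.2.1 h.2.2

theorem Proper.exists_crossings {C : FiveChain} (hC : C.Proper)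
    (h6 : C.selfCrossings.encard = 6) :
    (∀ k, (C.arm (disjointArms k).1 ∩ C.arm (disjointArms k).2).Subsingleton) ∧
      ∃ f : Fin 6 → Plane, Function.Injective f ∧
        ∀ k, f k ∈ C.arm (disjointArms k).1 ∩ C.arm (disjointArms k).2 ∧ f k ∉ range C.node := by
  have hfin : C.selfCrossings.Finite := finite_of_encard_eq_coe (k := 6) h6
  -- Having just six self-crossings excludes overlapping arms: the common part of two arms is
  -- convex, and it is finite because it consists of self-crossings and nodes.
  have hsub : ∀ k, (C.arm (disjointArms k).1 ∩ C.arm (disjointArms k).2).Subsingleton := by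
    intro k
    refine ((C.convex_arm _).inter (C.convex_arm _)).subsingleton_of_finite ?_
    refine (hfin.union (finite_range C.node)).subset fun x hx => ?_
    by_cases hn : x ∈ range C.node
    · exact Or.inr hn
    · left
      rw [hC.selfCrossings_eq]
      exact mem_iUnion.2 ⟨k, hx, hn⟩
  refine ⟨hsub, (encard_iUnion_eq_card_iff (fun k => (hsub k).anti
    (sdiff_subset (t := range C.node)))).1 ?_⟩
  rw [← hC.selfCrossings_eq, h6]
  simp

/-- A convex part `A` of a ray from `p` that meets two arms at `q` in single points other than `q`
does not point to `q`. -/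
theorem not_sameRay_of_crossings {p q u w₁ w₂ x₁ x₂ : Plane} {A B : Set Plane} (hA : Convex ℝ A)
    (hpA : p ∈ A) (hAu : A ⊆ ray p u) (hu : u ≠ 0) (hqB : q ∈ B) (hAB : (A ∩ B).Subsingleton)
    (hw : ¬ SameRay ℝ w₁ w₂) (h₁A : x₁ ∈ A) (h₁B : x₁ ∈ B) (h₁w : x₁ ∈ ray q w₁) (h₁q : x₁ ≠ q)
    (h₂A : x₂ ∈ A) (h₂w : x₂ ∈ ray q w₂) (h₂q : x₂ ≠ q) :
    ¬ SameRay ℝ u (q - p) := by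
  intro h
  have hqA : q ∉ A := fun hqA => h₁q (hAB ⟨h₁A, h₁B⟩ ⟨hqA, hqB⟩)
  have hpq : q - p ≠ 0 := fun h0 => hqA (sub_eq_zero.1 h0 ▸ hpA)
  obtain ⟨r, hr, hru⟩ := h.exists_pos_left hu hpq
  have hq : q = p + r • u := by rw [hru]; abel
  -- If `u` pointed to `q`, then `A`, being convex and not containing `q`, would stop before
  -- reaching `q`. The points `x₁` and `x₂` would then both be seen from `q` in the direction of
  -- `p`, making `w₁` and `w₂` the same direction.
  have hlt : ∀ s, 0 ≤ s → p + s • u ∈ A → s < r := by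
    intro s hs hsA
    by_contra hrs
    rw [not_lt] at hrs
    have hs0 : 0 < s := hr.trans_le hrs
    refine hqA (hA.segment_subset hpA hsA ?_)
    rw [segment_eq_image_line]
    refine ⟨r / s, ⟨by positivity, (div_le_one hs0).2 hrs⟩, ?_⟩
    simp only [add_sub_cancel_left, smul_smul, div_mul_cancel₀ _ hs0.ne']
    exact hq.symm
  obtain ⟨s₁, hs₁, rfl⟩ := hAu h₁A
  obtain ⟨s₂, hs₂, rfl⟩ := hAu h₂A
  have l₁ := hlt s₁ hs₁ h₁A
  have l₂ := hlt s₂ hs₂ h₂A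
  obtain ⟨t₁, ht₁, e₁⟩ := h₁w
  obtain ⟨t₂, ht₂, e₂⟩ := h₂w
  have ht₁' : 0 < t₁ := ht₁.lt_of_ne (by rintro rfl; exact h₁q (by rw [e₁]; simp))
  have ht₂' : 0 < t₂ := ht₂.lt_of_ne (by rintro rfl; exact h₂q (by rw [e₂]; simp))
  rw [hq] at e₁ e₂
  have f₁ : t₁ • w₁ = (s₁ - r) • u := by
    have : t₁ • w₁ = (p + s₁ • u) - (p + r • u) := by rw [e₁]; abel
    rw [this]; module
  have f₂ : t₂ • w₂ = (s₂ - r) • u := by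
    have : t₂ • w₂ = (p + s₂ • u) - (p + r • u) := by rw [e₂]; abel
    rw [this]; module
  refine hw (Or.inr (Or.inr ⟨(r - s₂) * t₁, (r - s₁) * t₂, mul_pos (by linarith) ht₁',
    mul_pos (by linarith) ht₂', ?_⟩))
  rw [mul_smul, mul_smul, f₁, f₂]
  module

/-- The legs of the lowered H extend the arms `0`, `1` and `3`, `4`, so the crossings of these arms
already provide four distinct self-crossings. What remains is that no leg overlaps the new bar; each
leg meets both arms at the opposite end, so `not_sameRay_of_crossings` applies. -/
theorem Proper.lowerBar {C : FiveChain} (hC : C.Proper) (h6 : C.selfCrossings.encard = 6) :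
    (raiseBar.symm C).Proper ∧ (raiseBar.symm C).selfCrossings.encard = 4 := by
  obtain ⟨hsub, f, hf, hfm⟩ := hC.exists_crossings h6
  obtain ⟨c0, -, -, c3⟩ := id hC
  have n0 := ne_zero_of_not_sameRay_left c0
  have n1 := ne_zero_of_not_sameRay_right c0
  have n2 := ne_zero_of_not_sameRay_left c3
  have n3 := ne_zero_of_not_sameRay_right c3
  have hn : ∀ k j, f k ≠ C.node j := fun k j h => (hfm k).2 ⟨j, h.symm⟩
  have c0' : ¬ SameRay ℝ (C.node 1 - C.node 0) (C.out 0) := fun h => c0 h.symm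
  have a1 : C.arm 1 ⊆ ray (C.node 0) (C.node 1 - C.node 0) := segment_subset_ray _ _
  have a3 : C.arm 3 ⊆ ray (C.node 3) (C.node 2 - C.node 3) := segment_subset_ray' _ _
  have m0 : C.node 0 ∈ C.arm 0 := mem_ray_self _ _
  have m1 : C.node 0 ∈ C.arm 1 := left_mem_segment ℝ _ _
  have m3 : C.node 3 ∈ C.arm 3 := right_mem_segment ℝ _ _
  have m4 : C.node 3 ∈ C.arm 4 := mem_ray_self _ _
  have s03 : (C.arm 0 ∩ C.arm 3).Subsingleton := hsub 1
  have s13 : (C.arm 1 ∩ C.arm 3).Subsingleton := hsub 3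
  have s14 : (C.arm 1 ∩ C.arm 4).Subsingleton := hsub 4
  have f03 : f 1 ∈ C.arm 0 ∩ C.arm 3 := (hfm 1).1
  have f04 : f 2 ∈ C.arm 0 ∩ C.arm 4 := (hfm 2).1
  have f13 : f 3 ∈ C.arm 1 ∩ C.arm 3 := (hfm 3).1
  have f14 : f 4 ∈ C.arm 1 ∩ C.arm 4 := (hfm 4).1
  have hP : (raiseBar.symm C).Proper := by
    refine ⟨?_, ?_, ?_⟩ <;> simp only [Fin.forall_fin_two]
    · exact ⟨c0', c3⟩
    · exact ⟨not_sameRay_of_crossings (C.convex_arm 1) m1 a1 n1 m3 s13 c3 f13.1 f13.2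
        (a3 f13.2) (hn 3 3) f14.1 f14.2 (hn 4 3),
        not_sameRay_of_crossings (C.convex_arm 0) m0 subset_rfl n0 m3 s03 c3 f03.1 f03.2
        (a3 f03.2) (hn 1 3) f04.1 f04.2 (hn 2 3)⟩
    · exact ⟨not_sameRay_of_crossings (C.convex_arm 3) m3 a3 n2 m1 (inter_comm _ _ ▸ s13) c0'
        f13.2 f13.1 (a1 f13.1) (hn 3 0) f03.2 f03.1 (hn 1 0),
        not_sameRay_of_crossings (C.convex_arm 4) m4 subset_rfl n3 m1 (inter_comm _ _ ▸ s14) c0'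
        f14.2 f14.1 (a1 f14.1) (hn 4 0) f04.2 f04.1 (hn 2 0)⟩
  refine ⟨hP, hP.encard_selfCrossings_eq_four_iff.2
    ⟨fun k => f (![![3, 4], ![1, 2]] k.1 k.2), hf.comp (by decide), ?_⟩⟩
  rintro ⟨i, j⟩
  fin_cases i <;> fin_cases j
  · exact ⟨a1 f13.1, a3 f13.2⟩
  · exact ⟨a1 f14.1, f14.2⟩
  · exact ⟨f03.1, a3 f03.2⟩
  · exact ⟨f04.1, f04.2⟩

end FiveChain
end SelfCrossings

/-! ### Raising the bar -/

section Raising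
open Set

theorem mem_segment_add_smul {p u : Plane} {s σ : ℝ} (h0 : 0 ≤ σ) (h : σ < s) :
    p + σ • u ∈ segment ℝ p (p + s • u) := by
  have hs : 0 < s := h0.trans_lt h
  rw [segment_eq_image_line]
  refine ⟨σ / s, ⟨by positivity, (div_le_one hs).2 h.le⟩, ?_⟩
  simp only [add_sub_cancel_left, smul_smul, div_mul_cancel₀ _ hs.ne']

theorem exists_meet {p d u v : Plane} (hu : 0 < cross d u) (hv : 0 < cross d v)
    (huv : 0 < cross u v) : ∃ σ τ : ℝ, 0 < σ ∧ 0 < τ ∧ p + σ • u = p + d + τ • v ∧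
      σ * cross u v = cross d v ∧ τ * cross u v = cross d u := by
  refine ⟨cross d v / cross u v, cross d u / cross u v, by positivity, by positivity, ?_,
    div_mul_cancel₀ _ huv.ne', div_mul_cancel₀ _ huv.ne'⟩
  have h : cross d v • u = cross u v • d + cross d u • v := by
    ext <;> simp [cross] <;> ring
  rw [add_assoc, div_eq_inv_mul, mul_smul, h, smul_add, smul_smul, inv_mul_cancel₀ huv.ne',
    one_smul, smul_smul, div_eq_inv_mul]

/-- A segment whose ends lie on different sides of a ray and on the same side of the line through
its starting point meets the ray. -/
theorem exists_segment_meets_ray {p a b d w : Plane} (hw : 0 < cross d w)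
    (ha : 0 < cross d (a - p)) (hb : 0 < cross d (b - p)) (hwa : cross w (a - p) < 0)
    (hwb : 0 < cross w (b - p)) : ∃ μ : ℝ, 0 < μ ∧ p + μ • w ∈ segment ℝ a b := by
  set D := cross w (b - p) - cross w (a - p) with hD
  have hD0 : 0 < D := by linarith
  set l := -cross w (a - p) / D with hl
  have hl0 : 0 < l := div_pos (by linarith) hD0
  have hl1 : l < 1 := (div_lt_one hD0).2 (by linarith)
  set z := a + l • (b - a) - p with hz
  have hwz : cross w z = 0 := by
    have e : cross w z = cross w (a - p) + l * D := by
      rw [hz, hD]; simp [cross]; ring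
    rw [e, hl, div_mul_cancel₀ _ hD0.ne']
    ring
  have hdz : 0 < cross d z := by
    have e : cross d z = (1 - l) * cross d (a - p) + l * cross d (b - p) := by
      rw [hz]; simp [cross]; ring
    rw [e]
    have := sub_pos.2 hl1
    positivity
  refine ⟨cross d z / cross d w, by positivity, ?_⟩
  have e : (cross d z / cross d w) • w = z := by
    have h := cross_smul_sub_cross_smul d z w
    rw [cross_swap z w, hwz, neg_zero, neg_zero, zero_smul, sub_eq_zero] at h
    rw [div_eq_inv_mul, mul_smul, h, smul_smul, inv_mul_cancel₀ hw.ne', one_smul]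
  rw [e, segment_eq_image_line]
  exact ⟨l, ⟨hl0.le, hl1.le⟩, by rw [hz, add_sub_cancel]⟩

theorem eq_of_cross_smul {w p z z' : Plane} {s s' : ℝ} (h : p + s • z = p + s' • z') :
    s * cross w z = s' * cross w z' := by
  rw [← cross_add_smul_sub w p z s, ← cross_add_smul_sub w p z' s', h]

/-- Raising the bar of an H whose legs are given in the order in which they leave the tips. -/
theorem exists_raised_of_ordered {p d u u' v v' : Plane} (hu : 0 < cross d u)
    (hu' : 0 < cross d u') (hv : 0 < cross d v) (hv' : 0 < cross d v') (huv : 0 < cross u v)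
    (huv' : 0 < cross u v') (hu'v : 0 < cross u' v) (hu'v' : 0 < cross u' v')
    (huu : 0 < cross u u') (hvv : 0 < cross v' v) :
    ∃ S : LongLeggedH, S.Proper ∧ S.carrier = (((ray p u ∪ ray p u') ∪ ray (p + d) v) ∪
      ray (p + d) v') ∪ segment ℝ p (p + d) ∧ (raiseBar S).Proper ∧
      (raiseBar S).selfCrossings.encard = 6 := by
  set q := p + d with hq
  have hdq : q - p = d := add_sub_cancel_left p d
  have hdq' : p - q = -d := sub_add_cancel_left p d
  obtain ⟨σ, τ, hσ, hτ, e13, hσe, hτe⟩ := exists_meet (p := p) hu hv huv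
  obtain ⟨σ₂, τ₂, hσ₂, hτ₂, e14, hσ₂e, hτ₂e⟩ := exists_meet (p := p) hu hv' huv'
  obtain ⟨σ₃, τ₃, hσ₃, hτ₃, e03, hσ₃e, hτ₃e⟩ := exists_meet (p := p) hu' hv hu'v
  obtain ⟨σ₄, τ₄, hσ₄, hτ₄, e04, hσ₄e, hτ₄e⟩ := exists_meet (p := p) hu' hv' hu'v'
  rw [← hq] at e13 e14 e03 e04
  -- The two signs `huu` and `hvv` make `u` and `v` the inner legs, the ones nearer to the bar. The
  -- node `b` lies on `v` beyond its crossings with `u` (at `τ`) and with `u'` (at `τ₃`).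
  set t := τ + τ₃ + 1 with ht
  have ht0 : 0 < t := by positivity
  set b := q + t • v with hb
  set x := p + σ₄ • u' with hx
  have hub : 0 < cross u (b - p) := by
    have e : cross u (b - p) = t * cross u v - cross d u := by
      rw [hb, hq]; simp [cross]; ring
    rw [e, ← hτe, ht]
    nlinarith
  -- The node `a` must lie on `u` beyond its crossings with `v` and `v'`, and the new bar `ab` must
  -- avoid the crossing `x` of the outer legs. The condition that `ab` passes through `x` is affine
  -- in `s`; holding for two values of `s` it would hold at `s = 0`, but `b` and `x` are not
  -- collinear with `p`, since `b` lies strictly to one side of `u'`.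
  obtain ⟨s, hsσ, hsσ₂, hsx⟩ : ∃ s : ℝ, σ < s ∧ σ₂ < s ∧
      cross (b - (p + s • u)) (x - (p + s • u)) ≠ 0 := by
    by_contra! h
    have h1 := h (σ + σ₂ + 1) (by linarith) (by linarith)
    have h2 := h (σ + σ₂ + 2) (by linarith) (by linarith)
    have hlin : ∀ s, cross (b - (p + s • u)) (x - (p + s • u)) =
        cross (b - p) (x - p) + s * (cross u (b - p) - cross u (x - p)) := by
      intro s; simp [cross]; ring
    rw [hlin] at h1 h2
    have h3 : cross u (b - p) = cross u (x - p) := by linarith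
    rw [h3, sub_self, mul_zero, add_zero] at h1
    have h4 : cross (b - p) (x - p) = 0 := h1
    have h5 : cross (b - p) (x - p) = -(σ₄ * cross u' (b - p)) := by
      rw [hx]; simp [cross]; ring
    have h6 : cross u' (b - p) = t * cross u' v - cross d u' := by
      rw [hb, hq]; simp [cross]; ring
    rw [h5, h6, ← hτ₃e, ht] at h4
    have : 0 < σ₄ * ((τ + τ₃ + 1) * cross u' v - τ₃ * cross u' v) := by
      have : (τ + τ₃ + 1) * cross u' v - τ₃ * cross u' v = (τ + 1) * cross u' v := by ring
      rw [this]; positivity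
    linarith
  have hs0 : 0 < s := hσ.trans hsσ
  set a := p + s • u with ha
  have hap : ∀ w, cross w (a - p) = s * cross w u := fun w => by rw [ha, cross_add_smul_sub]
  have hbq : ∀ w, cross w (b - q) = t * cross w v := fun w => by rw [hb, cross_add_smul_sub]
  have hwq : ∀ w z, cross w (z - p) = cross w (z - q) + cross w d := fun w z => by
    rw [cross_sub_right w z q p, hdq]
  have hdd : cross d d = 0 := cross_self_eq_zero d
  have hu'b : 0 < cross u' (b - p) := by
    rw [hwq, hbq, cross_swap u' d, ← hτ₃e, ht]
    nlinarith
  have hu'a : cross u' (a - p) < 0 := by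
    rw [hap, cross_swap]
    nlinarith
  have hv'b : 0 < cross v' (b - q) := by rw [hbq]; positivity
  have hv'a : cross v' (a - q) < 0 := by
    have := hwq v' a
    rw [hap, cross_swap v' u, cross_swap v' d, ← hσ₂e] at this
    nlinarith
  -- The nodes `a` and `b` lie on different sides of each outer leg, so `ab` crosses both.
  obtain ⟨μ, hμ, hμm⟩ := exists_segment_meets_ray (p := p) (a := a) (b := b) hu'
    (by rw [hap]; positivity) (by rw [hwq, hbq, hdd]; linarith [mul_pos ht0 hv]) hu'a hu'b
  obtain ⟨ν, hν, hνm⟩ := exists_segment_meets_ray (p := q) (a := a) (b := b) hv'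
    (by linarith [hwq d a, hap d, mul_pos hs0 hu]) (by rw [hbq]; positivity) hv'a hv'b
  let S : LongLeggedH := ⟨![p, q], ![![s • u, u'], ![t • v, v']]⟩
  have hcu : ∀ w, cross (s • u) w = s * cross u w := fun w => by simp [cross]; ring
  have hcv : ∀ w, cross (t • v) w = t * cross v w := fun w => by simp [cross]; ring
  have hSP : S.Proper := by
    refine ⟨?_, ?_, ?_⟩ <;> simp only [Fin.forall_fin_two] <;> refine ⟨?_, ?_⟩ <;>
      apply not_sameRay_of_cross_ne <;>
      simp only [S, Matrix.cons_val_zero, Matrix.cons_val_one, hdq, hdq', hcu, hcv]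
    · positivity
    · rw [cross_swap]
      exact (mul_neg_of_pos_of_neg ht0 (neg_neg_of_pos hvv)).ne
    · rw [cross_swap]
      exact (mul_neg_of_pos_of_neg hs0 (neg_neg_of_pos hu)).ne
    · rw [cross_swap]
      exact (neg_neg_of_pos hu').ne
    · have : cross v (-d) = cross d v := by simp [cross]; ring
      rw [this]; positivity
    · have : cross v' (-d) = cross d v' := by simp [cross]; ring
      rw [this]; positivity
  have hCP : (raiseBar S).Proper := by
    refine ⟨?_, ?_, ?_, ?_⟩ <;> apply not_sameRay_of_cross_ne
    · change cross u' (a - p) ≠ 0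
      exact hu'a.ne
    · change cross (p - a) (b - a) ≠ 0
      have : cross (p - a) (b - a) = -(s * cross u (b - p)) := by rw [ha]; simp [cross]; ring
      rw [this]
      exact (neg_neg_of_pos (mul_pos hs0 hub)).ne
    · change cross (a - b) (q - b) ≠ 0
      have : cross (a - b) (q - b) = -(t * (cross u v * s - cross d v)) := by
        rw [ha, hb, hq]; simp [cross]; ring
      rw [this, ← hσe]
      have : 0 < t * (cross u v * s - σ * cross u v) := by
        have : cross u v * s - σ * cross u v = cross u v * (s - σ) := by ring
        rw [this]
        have := sub_pos.2 hsσ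
        positivity
      exact neg_ne_zero.2 this.ne'
    · change cross (b - q) v' ≠ 0
      rw [cross_swap]
      exact (neg_neg_of_pos hv'b).ne
  have hcross1 : cross u' (b - a) ≠ 0 := by
    have : cross u' (b - a) = cross u' (b - p) - cross u' (a - p) := by simp [cross]; ring
    rw [this]
    linarith
  have hcross2 : cross (b - a) v' ≠ 0 := by
    have : cross (b - a) v' = cross v' (a - q) - cross v' (b - q) := by simp [cross]; ring
    rw [this]
    linarith
  have hSa : segment ℝ p a ⊆ ray p u := by
    refine (segment_subset_ray p a).trans ?_
    rw [ha, add_sub_cancel_left, ray_smul p u hs0]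
  have hSb : segment ℝ b q ⊆ ray q v := by
    refine (segment_subset_ray' b q).trans ?_
    rw [hb, add_sub_cancel_left, ray_smul q v ht0]
  have hnode : ∀ z, z ∈ range (raiseBar S).node → z = p ∨ z = a ∨ z = b ∨ z = q := by
    rintro _ ⟨i, rfl⟩
    fin_cases i
    exacts [Or.inl rfl, Or.inr (Or.inl rfl), Or.inr (Or.inr (Or.inl rfl)),
      Or.inr (Or.inr (Or.inr rfl))]
  have hp_of : ∀ z, 0 < cross d (z - p) → z ≠ p ∧ z ≠ q := by
    intro z hz
    constructor
    · rintro rfl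
      simp [cross] at hz
    · rintro rfl
      rw [hdq, hdd] at hz
      exact lt_irrefl _ hz
  have hline : ∀ (μ : ℝ) w, 0 < μ → 0 < cross d w → p + μ • w ≠ p ∧ p + μ • w ≠ q :=
    fun μ w hμ hw => hp_of _ (by rw [cross_add_smul_sub]; positivity)
  have hna : ∀ μ : ℝ, 0 < μ → p + μ • u' ≠ a := by
    intro μ hμ h
    have := eq_of_cross_smul (w := u) h
    rw [cross_self_eq_zero, mul_zero] at this
    exact (mul_pos hμ huu).ne' this
  have hnb : ∀ μ : ℝ, 0 < μ → q + μ • v' ≠ b := by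
    intro μ hμ h
    have := eq_of_cross_smul (w := v') h
    rw [cross_self_eq_zero, mul_zero] at this
    exact (mul_pos ht0 hvv).ne this
  have hna' : ∀ σ : ℝ, σ < s → p + σ • u ≠ a := by
    intro σ hσ h
    have := eq_of_cross_smul (w := d) h
    exact hσ.ne (mul_right_cancel₀ hu.ne' this)
  have hnb' : ∀ τ : ℝ, τ < t → q + τ • v ≠ b := by
    intro τ hτ h
    have := eq_of_cross_smul (w := d) h
    exact hτ.ne (mul_right_cancel₀ hv.ne' this)
  refine ⟨S, hSP, ?_, hCP, hCP.encard_selfCrossings_eq_six ?_ ?_ ?_⟩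
  · rw [S.carrier_eq]
    simp only [S, Matrix.cons_val_zero, Matrix.cons_val_one, ray_smul _ _ hs0, ray_smul _ _ ht0]
  · intro k
    fin_cases k
    · exact (subsingleton_ray_inter_ray (p := p) (q := a) hcross1).anti
        (inter_subset_inter subset_rfl (segment_subset_ray _ _))
    · exact (subsingleton_ray_inter_ray (p := p) (q := q) hu'v.ne').anti
        (inter_subset_inter subset_rfl hSb)
    · exact subsingleton_ray_inter_ray (p := p) (q := q) hu'v'.ne'
    · exact (subsingleton_ray_inter_ray (p := p) (q := q) huv.ne').anti
        (inter_subset_inter hSa hSb)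
    · exact (subsingleton_ray_inter_ray (p := p) (q := q) huv'.ne').anti
        (inter_subset_inter hSa subset_rfl)
    · exact (subsingleton_ray_inter_ray (p := a) (q := q) hcross2).anti
        (inter_subset_inter (segment_subset_ray _ _) subset_rfl)
  · have hτt : τ < t := by linarith
    have hτ₃t : τ₃ < t := by linarith
    have mb : ∀ τ : ℝ, 0 < τ → τ < t → q + τ • v ∈ segment ℝ b q := fun τ h0 h => by
      rw [segment_symm]
      exact mem_segment_add_smul h0.le h
    intro k
    fin_cases k
    · refine ⟨p + μ • u', ⟨⟨μ, hμ.le, rfl⟩, hμm⟩, fun h => ?_⟩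
      rcases hnode _ h with h | h | h | h
      · exact (hline μ u' hμ hu').1 h
      · exact hna μ hμ h
      · rw [← h, cross_add_smul_sub, cross_self_eq_zero, mul_zero] at hu'b
        exact lt_irrefl _ hu'b
      · exact (hline μ u' hμ hu').2 h
    · refine ⟨p + σ₃ • u', ⟨⟨σ₃, hσ₃.le, rfl⟩, e03 ▸ mb τ₃ hτ₃ hτ₃t⟩, fun h => ?_⟩
      rcases hnode _ h with h | h | h | h
      · exact (hline σ₃ u' hσ₃ hu').1 h
      · exact hna σ₃ hσ₃ h
      · exact hnb' τ₃ hτ₃t (e03.symm.trans h)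
      · exact (hline σ₃ u' hσ₃ hu').2 h
    · refine ⟨p + σ₄ • u', ⟨⟨σ₄, hσ₄.le, rfl⟩, ⟨τ₄, hτ₄.le, e04⟩⟩, fun h => ?_⟩
      rcases hnode _ h with h | h | h | h
      · exact (hline σ₄ u' hσ₄ hu').1 h
      · exact hna σ₄ hσ₄ h
      · exact hnb τ₄ hτ₄ (e04.symm.trans h)
      · exact (hline σ₄ u' hσ₄ hu').2 h
    · refine ⟨p + σ • u, ⟨mem_segment_add_smul hσ.le hsσ, e13 ▸ mb τ hτ hτt⟩, fun h => ?_⟩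
      rcases hnode _ h with h | h | h | h
      · exact (hline σ u hσ hu).1 h
      · exact hna' σ hsσ h
      · exact hnb' τ hτt (e13.symm.trans h)
      · exact (hline σ u hσ hu).2 h
    · refine ⟨p + σ₂ • u, ⟨mem_segment_add_smul hσ₂.le hsσ₂, ⟨τ₂, hτ₂.le, e14⟩⟩, fun h => ?_⟩
      rcases hnode _ h with h | h | h | h
      · exact (hline σ₂ u hσ₂ hu).1 h
      · exact hna' σ₂ hsσ₂ h
      · exact hnb τ₂ hτ₂ (e14.symm.trans h)
      · exact (hline σ₂ u hσ₂ hu).2 h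
    · have hz := hp_of (q + ν • v') (by
        rw [hwq, cross_add_smul_sub, hdd, add_zero]; positivity)
      refine ⟨q + ν • v', ⟨hνm, ⟨ν, hν.le, rfl⟩⟩, fun h => ?_⟩
      rcases hnode _ h with h | h | h | h
      · exact hz.1 h
      · rw [← h, cross_add_smul_sub, cross_self_eq_zero, mul_zero] at hv'a
        exact lt_irrefl _ hv'a
      · exact hnb ν hν h
      · exact hz.2 h
  · intro z h0 h2 h4
    have hzx : z = x := subsingleton_ray_inter_ray hu'v'.ne' ⟨h0, h4⟩
      ⟨⟨σ₄, hσ₄.le, rfl⟩, ⟨τ₄, hτ₄.le, e04⟩⟩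
    have h2' : z ∈ ray a (b - a) := segment_subset_ray a b h2
    obtain ⟨l, -, hl⟩ := h2'
    apply hsx
    rw [← hzx, hl, cross_add_smul_sub, cross_self_eq_zero, mul_zero]

/-- Interchanging the two legs at a tip does not change the figure, so the legs may be assumed to be
in the order needed. -/
theorem exists_raised_of_pos {p d u u' v v' : Plane} (hu : 0 < cross d u)
    (hu' : 0 < cross d u') (hv : 0 < cross d v) (hv' : 0 < cross d v') (huv : 0 < cross u v)
    (huv' : 0 < cross u v') (hu'v : 0 < cross u' v) (hu'v' : 0 < cross u' v')
    (huu : ¬ SameRay ℝ u u') (hvv : ¬ SameRay ℝ v v') :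
    ∃ S : LongLeggedH, S.Proper ∧ S.carrier = (((ray p u ∪ ray p u') ∪ ray (p + d) v) ∪
      ray (p + d) v') ∪ segment ℝ p (p + d) ∧ (raiseBar S).Proper ∧
      (raiseBar S).selfCrossings.encard = 6 := by
  wlog h1 : 0 < cross u u' generalizing u u'
  · have h0 : cross u u' ≠ 0 := fun h => huu (sameRay_of_cross_eq_zero hu hu' h)
    have h2 : 0 < cross u' u := by
      rw [cross_swap]
      exact neg_pos.2 (lt_of_le_of_ne (not_lt.1 h1) h0)
    obtain ⟨S, hS, hc, hr⟩ := this hu' hu hu'v hu'v' huv huv' (fun h => huu h.symm) h2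
    exact ⟨S, hS, by rw [hc, union_comm (ray p u')], hr⟩
  wlog h2 : 0 < cross v' v generalizing v v'
  · have h0 : cross v' v ≠ 0 := fun h => hvv (sameRay_of_cross_eq_zero hv' hv h).symm
    have h3 : 0 < cross v v' := by
      rw [cross_swap]
      exact neg_pos.2 (lt_of_le_of_ne (not_lt.1 h2) h0)
    obtain ⟨S, hS, hc, hr⟩ := this hv' hv (fun h => hvv h.symm) huv' huv hu'v' hu'v h3
    exact ⟨S, hS, by rw [hc, union_right_comm _ (ray (p + d) v')], hr⟩
  exact exists_raised_of_ordered hu hu' hv hv' huv huv' hu'v hu'v' h1 h2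

theorem LongLeggedH.Proper.exists_raised {S : LongLeggedH} (hS : S.Proper)
    (h4 : S.selfCrossings.encard = 4) : ∃ S' : LongLeggedH, S'.Proper ∧ S'.carrier = S.carrier ∧
      (raiseBar S').Proper ∧ (raiseBar S').selfCrossings.encard = 6 := by
  obtain ⟨f, -, hf⟩ := hS.encard_selfCrossings_eq_four_iff.1 h4
  set p := S.tip 0 with hp
  set q := S.tip 1 with hq
  set d := q - p with hd
  have hqd : q = p + d := (add_sub_cancel p q).symm
  have hpd : p = q + -d := by rw [hd, neg_sub, add_sub_cancel]
  -- A crossing of two legs solves `s • u - t • v = d` with positive `s` and `t`. Taking cross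
  -- products with `u` and `v` shows that `cross d u`, `cross d v` and `cross u v` have the same
  -- sign; with all four crossings present there is a single sign for the whole figure.
  have hpos : ∀ i j, 0 < cross (S.leg 0 i) (S.leg 1 j) * cross d (S.leg 0 i) ∧
      0 < cross (S.leg 0 i) (S.leg 1 j) * cross d (S.leg 1 j) := by
    intro i j
    have hne := hS.cross_ne_zero (hf (i, j)).1 (hf (i, j)).2
    obtain ⟨⟨s, hs, es⟩, ⟨t, ht, et⟩⟩ := hf (i, j)
    have hs0 : 0 < s := hs.lt_of_ne (by
      rintro rfl
      refine hS.tip_zero_notMem j ⟨t, ht, ?_⟩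
      rw [← et, es, zero_smul, add_zero])
    have ht0 : 0 < t := ht.lt_of_ne (by
      rintro rfl
      refine hS.tip_one_notMem i ⟨s, hs, ?_⟩
      rw [← es, et, zero_smul, add_zero])
    have e : s • S.leg 0 i - t • S.leg 1 j = d := by
      rw [hd, sub_eq_sub_iff_add_eq_add, add_comm, ← es, et]
    have e1 : cross d (S.leg 0 i) = t * cross (S.leg 0 i) (S.leg 1 j) := by
      rw [← e]; simp [cross]; ring
    have e2 : cross d (S.leg 1 j) = s * cross (S.leg 0 i) (S.leg 1 j) := by
      rw [← e]; simp [cross]; ring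
    have hsq := mul_self_pos.2 hne
    rw [e1, e2]
    constructor
    · rw [mul_left_comm]; positivity
    · rw [mul_left_comm]; positivity
  have hcarrier : S.carrier = (((ray p (S.leg 0 0) ∪ ray p (S.leg 0 1)) ∪ ray q (S.leg 1 0)) ∪
      ray q (S.leg 1 1)) ∪ segment ℝ p q := S.carrier_eq
  rcases lt_or_gt_of_ne (left_ne_zero_of_mul (hpos 0 0).1.ne') with h | h
  · have c00 := neg_of_mul_pos_right (hpos 0 0).1 h.le
    have c10 := neg_of_mul_pos_right (hpos 0 0).2 h.le
    have h01 := neg_of_mul_pos_left (hpos 0 1).1 c00.le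
    have h10 := neg_of_mul_pos_left (hpos 1 0).2 c10.le
    have c01 := neg_of_mul_pos_right (hpos 1 0).1 h10.le
    have c11 := neg_of_mul_pos_right (hpos 0 1).2 h01.le
    have h11 := neg_of_mul_pos_left (hpos 1 1).1 c01.le
    -- With the legs on the negative side of `d`, exchanging the roles of the tips makes all the
    -- signs positive.
    have hneg : ∀ w, cross (-d) w = -cross d w := fun w => by simp [cross]; ring
    obtain ⟨S', hS', hc, hr⟩ := exists_raised_of_pos (p := q) (d := -d) (u := S.leg 1 0)
      (u' := S.leg 1 1) (v := S.leg 0 0) (v' := S.leg 0 1) (by rw [hneg]; linarith)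
      (by rw [hneg]; linarith) (by rw [hneg]; linarith) (by rw [hneg]; linarith)
      (by rw [cross_swap]; linarith) (by rw [cross_swap]; linarith) (by rw [cross_swap]; linarith)
      (by rw [cross_swap]; linarith) (hS.1 1) (hS.1 0)
    refine ⟨S', hS', ?_, hr⟩
    rw [hc, hcarrier, ← hpd, segment_symm ℝ q p]
    ext z
    simp only [mem_union]
    tauto
  · have c00 := pos_of_mul_pos_right (hpos 0 0).1 h.le
    have c10 := pos_of_mul_pos_right (hpos 0 0).2 h.le
    have h01 := pos_of_mul_pos_left (hpos 0 1).1 c00.le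
    have h10 := pos_of_mul_pos_left (hpos 1 0).2 c10.le
    have c01 := pos_of_mul_pos_right (hpos 1 0).1 h10.le
    have c11 := pos_of_mul_pos_right (hpos 0 1).2 h01.le
    have h11 := pos_of_mul_pos_left (hpos 1 1).1 c01.le
    obtain ⟨S', hS', hc, hr⟩ := exists_raised_of_pos (p := p) c00 c01 c10 c11 h h01 h10 h11
      (hS.1 0) (hS.1 1)
    exact ⟨S', hS', by rw [hc, hcarrier, ← hqd], hr⟩

end Raising

theorem mainTheorem8 :
    -- the maximum number of self-crossings of an H is 4
    IsGreatest {c : ℕ∞ | ∃ S : LongLeggedH, S.Proper ∧ c = S.selfCrossings.encard} 4 ∧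
    -- the maximum number of intersections of two H's is 25
    IsGreatest {c : ℕ∞ | ∃ S T : LongLeggedH, S.Proper ∧ T.Proper ∧
      (S.carrier ∩ T.carrier).Finite ∧ c = (S.carrier ∩ T.carrier).encard} 25 ∧
    -- an H with 4 self-crossings can be turned into a 5-chain with 6, and conversely
    (∀ S : LongLeggedH, S.Proper → S.selfCrossings.encard = 4 →
      ∃ S' : LongLeggedH, S'.Proper ∧ S'.carrier = S.carrier ∧
        (raiseBar S').Proper ∧ (raiseBar S').selfCrossings.encard = 6) ∧
    (∀ C : FiveChain, C.Proper → C.selfCrossings.encard = 6 →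
      (raiseBar.symm C).Proper ∧ (raiseBar.symm C).selfCrossings.encard = 4) ∧
    -- the maximum number of regions for H's and for 5-chains, with optimal arrangements of both
    -- that correspond to each other
    ∀ n : ℕ, ∃ m : ℕ, (m : ℚ) = (25 * (n : ℚ) ^ 2 - 11 * n + 2) / 2 ∧
      IsGreatest (hRegionCounts n) (m : ℕ∞) ∧
      IsGreatest (chainRegionCounts n) (m : ℕ∞) ∧
      ∃ S : Fin n → LongLeggedH,
        (∀ i, (S i).Proper) ∧ regionCount (⋃ i, (S i).carrier) = m ∧
        (∀ i, (raiseBar (S i)).Proper) ∧ regionCount (⋃ i, (raiseBar (S i)).carrier) = m :=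
  ⟨isGreatest_encard_selfCrossings, isGreatest_encard_inter,
    fun _ hS h => hS.exists_raised h, fun _ hC h => hC.lowerBar h,
    fun n => ⟨maxRegions n, maxRegions_cast n, isGreatest_hRegionCounts n,
      isGreatest_chainRegionCounts n, fun i => optimalH (40 * (n + 1)) i,
      fun i => optimalH_proper (by positivity) i, regionCount_optimalH n,
      fun i => raiseBar_optimalH_proper (by positivity) i, regionCount_raiseBar_optimalH n⟩⟩
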